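/- Let $(\Omega,\mathscr F,\mathsf P,\{\mathscr F_t\}_{t\ge 0})$ be a filtered probability space such that $\mathscr F_0$ consists of exactly the events of probability $0$ or $1$. Let $r$ be a piecewise continuous adapted process and $M_t=\exp\int_0^t r_s\,\mathrm ds$. For each $T\ge 0$ let $P(T)=\{P_t(T)\}_{t\ge0}$ be a continuous adapted process (the price of the zero coupon bond with maturity $T$) with $P_t(T)=M_t/M_T$ for $t\ge T$, and let $\mathsf Q$ be a probability measure equivalent to $\mathsf P$ under which $P(T)/M$ is a martingale for every $T\ge0$. Let $0=T_0<T_1<\dots<T_N$, $\theta_j=T_j-T_{j-1}$, $1\le I<J\le N$, and $$R^j=\frac1{\theta_j}\Bigl(\frac{P(T_{j-1})}{P(T_j)}-1\Bigr),\qquad A=\sum_{j=I+1}^J\theta_jP(T_j),\qquad S=\frac{P(T_I)-P(T_J)}{A}.$$ Let $\mathsf Q^*(F)=\frac1{A_0}\mathsf E_{\mathsf Q}\bigl[\frac{A_{T_N}}{M_{T_N}};F\bigr]$, $F\in\mathscr F$, be the forward swap measure, and $$\Pi^j=\frac{\theta_jP(T_j)}{A\,P(T_{j-1})}\Bigl(P(T_J)+S\sum_{k=j}^J\theta_kP(T_k)\Bigr),\qquad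 j=I+1,\dots,J.$$ (i) Each $R^j$, $j=I+1,\dots,J$, is a continuous semimartingale under $\mathsf Q^*$, and, $R^{j*}$ denoting its local martingale part under $\mathsf Q^*$, $$\mathrm dS=\sum_{j=I+1}^J\Pi^j\,\mathrm dR^{j*}.$$ (ii) If $R^j\ge0$ for all $j=I+1,\dots,J$, then $\Pi^jR^j\le S$ for all $j=I+1,\dots,J$. (iii) If $R^j>0$ for all $j=I+1,\dots,J$, then there are bounded (continuous adapted) processes $X^{ji}$ and $Y^{jik}$ such that, for all $j=I+1,\dots,J$, $$\mathrm d\,\frac{\Pi^jR^j}{S}=\sum_{i=I+1}^JX^{ji}\,\frac{\mathrm dR^i}{R^i}+\sum_{i,k=I+1}^JY^{jik}\,\mathrm d\langle\log R^i,\log R^k\rangle .$$ All path statements hold almost surely. -/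

import Mathlib

open MeasureTheory ProbabilityTheory Filter Topology
open scoped NNReal ENNReal

noncomputable section

namespace SwapRate

/-! ### Continuous processes, local martingales, semimartingales

Time runs over `ℝ≥0 = [0, ∞)`. Path properties are required almost surely. -/

section Processes

variable {Ω : Type*} {mΩ : MeasurableSpace Ω}

/-- `f : [0, ∞) → ℝ` is piecewise continuous: on each compact interval it is continuous off a
finite set, and it has finite one-sided limits everywhere. -/
def PiecewiseContinuous (f : ℝ≥0 → ℝ) : Prop :=
  (∀ b : ℝ≥0, {t | t ≤ b ∧ ¬ ContinuousAt f t}.Finite) ∧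
    ∀ t : ℝ≥0, (∃ l, Tendsto f (𝓝[>] t) (𝓝 l)) ∧ (∃ l, Tendsto f (𝓝[<] t) (𝓝 l))

/-- Adapted process with almost surely continuous paths. -/
structure IsContAdapted (𝓕 : Filtration ℝ≥0 mΩ) (μ : Measure Ω) (X : ℝ≥0 → Ω → ℝ) : Prop where
  adapted : StronglyAdapted 𝓕 X
  continuous : ∀ᵐ ω ∂μ, Continuous fun t => X t ω

/-- Continuous local martingale under `μ`. -/
structure IsContLocalMartingale (𝓕 : Filtration ℝ≥0 mΩ) (μ : Measure Ω) (L : ℝ≥0 → Ω → ℝ) :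
    Prop extends IsContAdapted 𝓕 μ L where
  locally_martingale : Locally (fun N => Martingale N 𝓕 μ) 𝓕 L μ

/-- `L` is the local martingale part of the continuous process `X` under `μ`: `L` is a continuous
local martingale null at `0`, and `X - X₀ - L` is a continuous adapted process whose paths have
finite variation on compact intervals. -/
structure IsLocalMartingalePart (𝓕 : Filtration ℝ≥0 mΩ) (μ : Measure Ω)
    (X L : ℝ≥0 → Ω → ℝ) : Prop where
  localMartingale : IsContLocalMartingale 𝓕 μ L
  null_zero : ∀ᵐ ω ∂μ, L 0 ω = 0
  contAdapted : IsContAdapted 𝓕 μ fun t ω => X t ω - X 0 ω - L t ω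
  finiteVariation :
    ∀ᵐ ω ∂μ, LocallyBoundedVariationOn (fun t => X t ω - X 0 ω - L t ω) Set.univ

/-- Continuous semimartingale under `μ`. -/
def IsContSemimartingale (𝓕 : Filtration ℝ≥0 mΩ) (μ : Measure Ω) (X : ℝ≥0 → Ω → ℝ) : Prop :=
  IsContAdapted 𝓕 μ X ∧ ∃ L, IsLocalMartingalePart 𝓕 μ X L

/-- The process `X` is bounded by a deterministic constant. -/
def IsBoundedProcess (μ : Measure Ω) (X : ℝ≥0 → Ω → ℝ) : Prop :=
  ∃ C : ℝ, ∀ᵐ ω ∂μ, ∀ t, |X t ω| ≤ C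

/-! ### Itô integral and covariation as limits along partitions -/

/-- A sequence of locally finite partitions `0 = π n 0 ≤ π n 1 ≤ …` of `[0, ∞)`, with mesh
tending to `0`. -/
structure IsPartitionSeq (π : ℕ → ℕ → ℝ≥0) : Prop where
  zero : ∀ n, π n 0 = 0
  mono : ∀ n, Monotone (π n)
  tendsto_atTop : ∀ n, Tendsto (π n) atTop atTop
  mesh : ∀ δ : ℝ≥0, 0 < δ → ∀ᶠ n in atTop, ∀ k, π n (k + 1) ≤ π n k + δ

/-- Convergence uniformly on compact time intervals in probability. -/
def TendstoUCP (μ : Measure Ω) (Z : ℕ → ℝ≥0 → Ω → ℝ) (Z' : ℝ≥0 → Ω → ℝ) : Prop :=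
  ∀ (t : ℝ≥0) (ε : ℝ), 0 < ε →
    Tendsto (fun n => μ {ω | ∃ s ≤ t, ε ≤ |Z n s ω - Z' s ω|}) atTop (𝓝 0)

/-- Left-point Riemann sum `∑ₖ H(πₖ) (X(πₖ₊₁ ∧ t) - X(πₖ ∧ t))`; only finitely many terms are
nonzero. -/
def leftSum (π : ℕ → ℝ≥0) (H X : ℝ≥0 → Ω → ℝ) (t : ℝ≥0) (ω : Ω) : ℝ :=
  ∑' k : ℕ, H (π k) ω * (X (min (π (k + 1)) t) ω - X (min (π k) t) ω)

/-- `∑ₖ (X(πₖ₊₁ ∧ t) - X(πₖ ∧ t)) (Y(πₖ₊₁ ∧ t) - Y(πₖ ∧ t))`; only finitely many terms are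
nonzero. -/
def covSum (π : ℕ → ℝ≥0) (X Y : ℝ≥0 → Ω → ℝ) (t : ℝ≥0) (ω : Ω) : ℝ :=
  ∑' k : ℕ, (X (min (π (k + 1)) t) ω - X (min (π k) t) ω) *
    (Y (min (π (k + 1)) t) ω - Y (min (π k) t) ω)

/-- `I = ∫₀^· H dX` (Itô integral) for a continuous adapted integrand `H` and a continuous
semimartingale `X`: the ucp limit of the left-point Riemann sums along every sequence of
partitions with mesh tending to `0`. -/
structure IsItoIntegral (𝓕 : Filtration ℝ≥0 mΩ) (μ : Measure Ω)
    (H X I : ℝ≥0 → Ω → ℝ) : Prop where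
  integrand : IsContAdapted 𝓕 μ H
  integrator : IsContSemimartingale 𝓕 μ X
  contAdapted : IsContAdapted 𝓕 μ I
  tendsto : ∀ π, IsPartitionSeq π → TendstoUCP μ (fun n => leftSum (π n) H X) I

/-- `B = ⟨X, Y⟩`, the quadratic covariation of the continuous semimartingales `X` and `Y`. -/
structure IsCovariation (𝓕 : Filtration ℝ≥0 mΩ) (μ : Measure Ω)
    (X Y B : ℝ≥0 → Ω → ℝ) : Prop where
  left : IsContSemimartingale 𝓕 μ X
  right : IsContSemimartingale 𝓕 μ Y
  contAdapted : IsContAdapted 𝓕 μ B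
  tendsto : ∀ π, IsPartitionSeq π → TendstoUCP μ (fun n => covSum (π n) X Y) B

end Processes

/-! ### The interest rate market

`r` is the spot rate, `P t u` the price at time `t` of the zero coupon bond with maturity `u`,
`T` the tenor structure. -/

section Market

variable {Ω : Type*}

/-- Money market account `M_t = exp (∫₀ᵗ r_s ds)`. -/
def moneyMarket (r : ℝ≥0 → Ω → ℝ) (t : ℝ≥0) (ω : Ω) : ℝ :=
  Real.exp (∫ s in (0 : ℝ)..t, r s.toNNReal ω)

/-- `θ_j = T_j - T_{j-1}`, for `1 ≤ j`. -/
def accrual (T : ℕ → ℝ≥0) (j : ℕ) : ℝ := (T j : ℝ) - T (j - 1)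

/-- Forward term rate `R^j_t = (P_t(T_{j-1}) / P_t(T_j) - 1) / θ_j`. -/
def termRate (P : ℝ≥0 → ℝ≥0 → Ω → ℝ) (T : ℕ → ℝ≥0) (j : ℕ) (t : ℝ≥0) (ω : Ω) : ℝ :=
  1 / accrual T j * (P t (T (j - 1)) ω / P t (T j) ω - 1)

/-- Annuity `A_t = ∑_{j=I+1}^J θ_j P_t(T_j)`. -/
def annuity (P : ℝ≥0 → ℝ≥0 → Ω → ℝ) (T : ℕ → ℝ≥0) (I J : ℕ) (t : ℝ≥0) (ω : Ω) : ℝ :=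
  ∑ j ∈ Finset.Icc (I + 1) J, accrual T j * P t (T j) ω

/-- Forward swap rate `S_t = (P_t(T_I) - P_t(T_J)) / A_t`. -/
def swapRate (P : ℝ≥0 → ℝ≥0 → Ω → ℝ) (T : ℕ → ℝ≥0) (I J : ℕ) (t : ℝ≥0) (ω : Ω) : ℝ :=
  (P t (T I) ω - P t (T J) ω) / annuity P T I J t ω

/-- `Π^j = θ_j P(T_j) / (A P(T_{j-1})) * (P(T_J) + S ∑_{k=j}^J θ_k P(T_k))`. -/
def swapWeight (P : ℝ≥0 → ℝ≥0 → Ω → ℝ) (T : ℕ → ℝ≥0) (I J j : ℕ) (t : ℝ≥0) (ω : Ω) : ℝ :=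
  accrual T j * P t (T j) ω / (annuity P T I J t ω * P t (T (j - 1)) ω) *
    (P t (T J) ω + swapRate P T I J t ω * ∑ k ∈ Finset.Icc j J, accrual T k * P t (T k) ω)

/-- Forward swap measure `Q*(F) = E_Q[A_{T_N} / M_{T_N} ; F] / A_0`. (Here `A_0` is almost surely
constant, since the initial σ-algebra is trivial in the market model.) -/
def swapMeasure [MeasurableSpace Ω] (Q : Measure Ω) (r : ℝ≥0 → Ω → ℝ)
    (P : ℝ≥0 → ℝ≥0 → Ω → ℝ) (T : ℕ → ℝ≥0) (N I J : ℕ) : Measure Ω :=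
  Q.withDensity fun ω => ENNReal.ofReal
    (1 / annuity P T I J 0 ω * (annuity P T I J (T N) ω / moneyMarket r (T N) ω))

/-- The standing assumptions on the market: a filtered probability space whose initial σ-algebra
consists of the events of probability `0` or `1`, a piecewise continuous adapted spot rate,
continuous adapted bond prices extended beyond maturity by rolling over in the money market
account, and a risk neutral measure `Q` equivalent to the physical measure `Pr`, under which
discounted bond prices are martingales. -/
structure IsMarket [mΩ : MeasurableSpace Ω] (Pr Q : Measure Ω) (𝓕 : Filtration ℝ≥0 mΩ)
    (r : ℝ≥0 → Ω → ℝ) (P : ℝ≥0 → ℝ≥0 → Ω → ℝ) : Prop where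
  prob : IsProbabilityMeasure Pr
  prob_riskNeutral : IsProbabilityMeasure Q
  absCont : Q ≪ Pr
  absCont' : Pr ≪ Q
  initial : ∀ F : Set Ω,
    MeasurableSet[𝓕 0] F ↔ MeasurableSet F ∧ (Pr F = 0 ∨ Pr F = 1)
  rate_adapted : StronglyAdapted 𝓕 r
  rate_piecewise : ∀ ω, PiecewiseContinuous fun t => r t ω
  bond_contAdapted : ∀ u : ℝ≥0, IsContAdapted 𝓕 Pr fun t => P t u
  bond_extend : ∀ (t u : ℝ≥0) (ω : Ω), u ≤ t → P t u ω = moneyMarket r t ω / moneyMarket r u ω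
  bond_martingale : ∀ u : ℝ≥0, Martingale (fun t ω => P t u ω / moneyMarket r t ω) 𝓕 Q

end Market

end SwapRate

end

/-!
# Forward swap rates under the swap measure

**Dynamics of the swap rate.** Under the forward swap measure the discounted prices
`n k = P(T k) / A` are martingales (`swapMeasure_martingale`): this is Bayes' formula, as the
density process `A / M` is a martingale that is constant from time `T N` on. All prices are positive
because a continuous martingale that is positive at some time is positive before it
(`ae_pos_of_martingale`). Each `R j` is a function of the ratio `n (j - 1) / n j`, hence a
semimartingale, whose martingale part has a differential that is linear in those of `n (j - 1)` and
`n j`. As `S = n I - n J` is itself a martingale, `∑ j, Π j dR j*` and `dS` have no drift, and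
comparing the coefficients of the `dn k` is a summation by parts (`sum_smul_sub_eq`,
`differential_swapRate`).

**The bound.** `Π j R j ≤ S` is an inequality between positive real numbers, true for every
nonincreasing sequence of prices (`weight_mul_rate_le`).

**Bounded coefficients.** `Π j R j / S` is an expression in the `R i` that uses only positive
constants, sums, products and quotients (`weight_mul_rate_div`). A positive process `G` such that
`dG / G` has bounded coefficients with respect to `d log R i` and `d⟨log R i, log R k⟩` is called
logarithmically regular (`IsLogRegular`). Such processes are closed under sums, products and
inverses; for sums this is because `G / (G + H)` lies between `0` and `1`. Hence `Π j R j / S` is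
logarithmically regular, and as it is at most `1` by the bound, the coefficients of its own
differential are bounded too (`IsLogRegular.exists_bounded_coefficients`).

**Stochastic calculus.** Integrals are limits of left Riemann sums, uniformly on compacts in
probability. A process is a *good integrator* if its Riemann sums with small integrands are
uniformly small in probability. For a continuous good integrator the Riemann sums converge
(`IsGoodIntegrator.exists_integral`) and the integral is associative (`IsGoodIntegrator.assoc`), and
both need nothing but the definition. Processes of finite variation are good integrators
(`isGoodIntegrator_of_finiteVariation`), and so are bounded continuous martingales, by stopping and
Chebyshev's inequality (`isGoodIntegrator_of_bounded_martingale`), hence all continuous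
semimartingales by localization. The covariation of integrals (`IsCovLimit.integral`) and Itô's
formula (`ito_formula`) follow. From there on, the calculus is algebra: the continuous
semimartingales modulo initial values form a module `Differential` over the ring `ProcessRing` of
continuous adapted processes, with a bilinear `bracket` that vanishes on drifts; local martingales
and processes of finite variation give two submodules with trivial intersection
(`disjoint_martingaleDifferentials`).

The filtration is not assumed to be right-continuous, only to contain the null sets. Processes with
almost surely continuous paths are replaced by versions all of whose paths are continuous where
hitting times are used.
-/


noncomputable section

namespace SwapRate

/-! ### Riemann sums along a single partition -/

section Partition

/-- A locally finite partition `0 = π 0 ≤ π 1 ≤ …` of `[0, ∞)`, without any control of the mesh. -/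
structure IsPartition (π : ℕ → ℝ≥0) : Prop where
  zero : π 0 = 0
  mono : Monotone π
  tendsto_atTop : Tendsto π atTop atTop

lemma IsPartitionSeq.isPartition {π : ℕ → ℕ → ℝ≥0} (h : IsPartitionSeq π) (n : ℕ) :
    IsPartition (π n) :=
  ⟨h.zero n, h.mono n, h.tendsto_atTop n⟩

variable {Ω : Type*} {π σ : ℕ → ℝ≥0} {H K X Y : ℝ≥0 → Ω → ℝ} {t : ℝ≥0} {ω : Ω}

lemma IsPartition.exists_ge (hπ : IsPartition π) (t : ℝ≥0) : ∃ n, t ≤ π n :=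
  (hπ.tendsto_atTop.eventually_ge_atTop t).exists

lemma IsPartition.exists_gt (hπ : IsPartition π) (t : ℝ≥0) : ∃ n, t < π n :=
  (hπ.tendsto_atTop.eventually_gt_atTop t).exists

lemma IsPartition.exists_mem_Ico (hπ : IsPartition π) (t : ℝ≥0) :
    ∃ n, π n ≤ t ∧ t < π (n + 1) := by
  classical
  have h := hπ.exists_gt t
  obtain ⟨m, hm⟩ : ∃ m, Nat.find h = m + 1 := by
    refine Nat.exists_eq_succ_of_ne_zero fun h0 => ?_
    have := Nat.find_spec h
    rw [h0, hπ.zero] at this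
    exact not_lt_zero this
  refine ⟨m, not_lt.1 (Nat.find_min h (by omega)), hm ▸ Nat.find_spec h⟩

/-- The last point of the partition `π` that does not exceed `s`. -/
def leftPoint (π : ℕ → ℝ≥0) (s : ℝ≥0) : ℝ≥0 := sSup (Set.range π ∩ Set.Iic s)

/-- The step process equal to `H (π k)` on `[π k, π (k + 1))`. -/
def stepProcess (π : ℕ → ℝ≥0) (H : ℝ≥0 → Ω → ℝ) : ℝ≥0 → Ω → ℝ := fun s ω => H (leftPoint π s) ω

lemma leftPoint_eq (hπ : IsPartition π) {k : ℕ} {s : ℝ≥0} (h1 : π k ≤ s) (h2 : s < π (k + 1)) :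
    leftPoint π s = π k := by
  refine IsGreatest.csSup_eq ⟨⟨⟨k, rfl⟩, h1⟩, ?_⟩
  rintro _ ⟨⟨j, rfl⟩, hj⟩
  refine hπ.mono (Nat.lt_succ_iff.1 (not_le.1 fun hkj => ?_))
  exact absurd (lt_of_lt_of_le h2 (hπ.mono hkj)) (not_lt.2 hj)

lemma leftPoint_le (hπ : IsPartition π) (s : ℝ≥0) : leftPoint π s ≤ s := by
  obtain ⟨k, h1, h2⟩ := hπ.exists_mem_Ico s
  rwa [leftPoint_eq hπ h1 h2]

lemma le_leftPoint_add (hπ : IsPartition π) {δ : ℝ≥0} (hδ : ∀ k, π (k + 1) ≤ π k + δ) (s : ℝ≥0) :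
    s ≤ leftPoint π s + δ := by
  obtain ⟨k, h1, h2⟩ := hπ.exists_mem_Ico s
  rw [leftPoint_eq hπ h1 h2]
  exact h2.le.trans (hδ k)

/-- The increment of a path over the `k`-th interval of a partition, stopped at time `t`. -/
def increment (π : ℕ → ℝ≥0) (X : ℝ≥0 → Ω → ℝ) (t : ℝ≥0) (ω : Ω) (k : ℕ) : ℝ :=
  X (min (π (k + 1)) t) ω - X (min (π k) t) ω

lemma increment_eq_zero (hπ : IsPartition π) {k : ℕ} (h : t ≤ π k) : increment π X t ω k = 0 := by
  rw [increment, min_eq_right h, min_eq_right (h.trans (hπ.mono k.le_succ)), sub_self]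

lemma leftSum_eq_sum (hπ : IsPartition π) {n : ℕ} (h : t ≤ π n) :
    leftSum π H X t ω = ∑ k ∈ Finset.range n, H (π k) ω * increment π X t ω k :=
  tsum_eq_sum fun k hk => by
    rw [← increment, increment_eq_zero hπ (h.trans (hπ.mono (by simpa using hk))), mul_zero]

/-- Weighted sum of products of increments, `∑ₖ H(πₖ) ΔₖX ΔₖY`. -/
def weightedCovSum (π : ℕ → ℝ≥0) (H X Y : ℝ≥0 → Ω → ℝ) (t : ℝ≥0) (ω : Ω) : ℝ :=
  ∑' k : ℕ, H (π k) ω * (increment π X t ω k * increment π Y t ω k)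

lemma weightedCovSum_eq_sum (hπ : IsPartition π) {n : ℕ} (h : t ≤ π n) :
    weightedCovSum π H X Y t ω =
      ∑ k ∈ Finset.range n, H (π k) ω * (increment π X t ω k * increment π Y t ω k) :=
  tsum_eq_sum fun k hk => by
    rw [increment_eq_zero hπ (h.trans (hπ.mono (by simpa using hk))), zero_mul, mul_zero]

lemma covSum_eq_weighted : covSum π X Y = weightedCovSum π 1 X Y := by
  funext t ω; simp [covSum, weightedCovSum, increment]

lemma leftSum_add_left (hπ : IsPartition π) : leftSum π (H + K) X = leftSum π H X + leftSum π K X := by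
  funext t ω
  obtain ⟨n, hn⟩ := hπ.exists_ge t
  simp [leftSum_eq_sum hπ hn, add_mul, Finset.sum_add_distrib]

lemma leftSum_sub_left (hπ : IsPartition π) : leftSum π (H - K) X = leftSum π H X - leftSum π K X := by
  funext t ω
  obtain ⟨n, hn⟩ := hπ.exists_ge t
  simp [leftSum_eq_sum hπ hn, sub_mul, Finset.sum_sub_distrib]

lemma leftSum_add_right (hπ : IsPartition π) : leftSum π H (X + Y) = leftSum π H X + leftSum π H Y := by
  funext t ω
  obtain ⟨n, hn⟩ := hπ.exists_ge t
  simp only [leftSum_eq_sum hπ hn, Pi.add_apply, increment, ← Finset.sum_add_distrib]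
  exact Finset.sum_congr rfl fun _ _ => by ring

lemma leftSum_smul_right (c : ℝ) : leftSum π H (c • X) = c • leftSum π H X := by
  funext t ω
  simp only [leftSum, Pi.smul_apply, smul_eq_mul, ← tsum_mul_left]
  exact tsum_congr fun _ => by ring

lemma leftSum_neg_right : leftSum π H (-X) = -leftSum π H X := by
  rw [← neg_one_smul ℝ X, leftSum_smul_right, neg_one_smul]

lemma leftSum_sub_right (hπ : IsPartition π) : leftSum π H (X - Y) = leftSum π H X - leftSum π H Y := by
  rw [sub_eq_add_neg, leftSum_add_right hπ, leftSum_neg_right, ← sub_eq_add_neg]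

lemma leftSum_one (hπ : IsPartition π) : leftSum π 1 X t ω = X t ω - X 0 ω := by
  obtain ⟨n, hn⟩ := hπ.exists_ge t
  simp only [leftSum_eq_sum hπ hn, Pi.one_apply, one_mul, increment]
  rw [Finset.sum_range_sub (fun k => X (min (π k) t) ω), min_eq_right hn, hπ.zero]
  simp

lemma leftSum_zero_time (hπ : IsPartition π) : leftSum π H X 0 ω = 0 := by
  rw [leftSum_eq_sum hπ (n := 0) zero_le]; simp

/-- Summation by parts. -/
lemma weightedCovSum_eq (hπ : IsPartition π) :
    weightedCovSum π H X Y =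
      leftSum π H (X * Y) - leftSum π (H * X) Y - leftSum π (H * Y) X := by
  funext t ω
  obtain ⟨n, hn⟩ := hπ.exists_ge t
  simp only [weightedCovSum_eq_sum hπ hn, Pi.sub_apply, leftSum_eq_sum hπ hn,
    ← Finset.sum_sub_distrib]
  refine Finset.sum_congr rfl fun k _ => ?_
  rcases le_total (π k) t with h | h
  · simp only [increment, Pi.mul_apply, min_eq_left h]; ring
  · simp [increment_eq_zero hπ h]

lemma covSum_eq (hπ : IsPartition π) :
    covSum π X Y t ω =
      X t ω * Y t ω - X 0 ω * Y 0 ω - leftSum π X Y t ω - leftSum π Y X t ω := by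
  rw [covSum_eq_weighted, weightedCovSum_eq hπ]
  simp [leftSum_one hπ]

lemma leftSum_congr_path {H' X' : ℝ≥0 → Ω → ℝ} (hH : ∀ s, H s ω = H' s ω)
    (hX : ∀ s, X s ω = X' s ω) : leftSum π H X t ω = leftSum π H' X' t ω := by
  simp [leftSum, hH, hX]

lemma continuous_leftSum (hπ : IsPartition π) (hX : Continuous fun t => X t ω) :
    Continuous fun t => leftSum π H X t ω := by
  refine continuous_iff_continuousAt.2 fun t => ?_
  obtain ⟨n, hn⟩ := hπ.exists_gt t
  have hc : Continuous fun t => ∑ k ∈ Finset.range n, H (π k) ω * increment π X t ω k := by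
    unfold increment
    exact continuous_finsetSum _ fun k _ => continuous_const.mul
      ((hX.comp (continuous_const.min continuous_id)).sub
        (hX.comp (continuous_const.min continuous_id)))
  refine hc.continuousAt.congr ?_
  filter_upwards [eventually_lt_nhds hn] with s hs using (leftSum_eq_sum hπ hs.le).symm

lemma leftSum_stopped (τ : ℝ≥0) :
    leftSum π H X (min t τ) ω = leftSum π H (fun s ω => X (min s τ) ω) t ω := by
  simp [leftSum, min_assoc]

lemma increment_leftSum (hσ : IsPartition σ) (k : ℕ) :
    increment σ (leftSum σ H X) t ω k = H (σ k) ω * increment σ X t ω k := by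
  rw [increment, leftSum_eq_sum hσ (min_le_left (σ (k + 1)) t), leftSum_eq_sum hσ (min_le_left (σ k) t),
    Finset.sum_range_succ]
  have h1 : ∀ i ∈ Finset.range k, increment σ X (min (σ (k + 1)) t) ω i = increment σ X t ω i := by
    intro i hi
    have hi := Finset.mem_range.1 hi
    simp only [increment, ← min_assoc, min_eq_left (hσ.mono (show i + 1 ≤ k + 1 by omega)),
      min_eq_left (hσ.mono (show i ≤ k + 1 by omega))]
  have h2 : ∀ i ∈ Finset.range k, increment σ X (min (σ k) t) ω i = increment σ X t ω i := by
    intro i hi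
    have hi := Finset.mem_range.1 hi
    simp only [increment, ← min_assoc, min_eq_left (hσ.mono (show i + 1 ≤ k by omega)),
      min_eq_left (hσ.mono (show i ≤ k by omega))]
  have h3 : increment σ X (min (σ (k + 1)) t) ω k = increment σ X t ω k := by
    simp only [increment, ← min_assoc, min_self, min_eq_left (hσ.mono k.le_succ)]
  have h4 : ∀ i ∈ Finset.range k, H (σ i) ω * increment σ X (min (σ (k + 1)) t) ω i =
      H (σ i) ω * increment σ X (min (σ k) t) ω i := fun i hi => by rw [h1 i hi, h2 i hi]
  rw [Finset.sum_congr rfl h4, h3]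
  ring

/-- Associativity of the integral, exact for Riemann sums along one partition. -/
lemma leftSum_leftSum (hσ : IsPartition σ) :
    leftSum σ K (leftSum σ H X) = leftSum σ (K * H) X := by
  funext t ω
  obtain ⟨n, hn⟩ := hσ.exists_ge t
  simp only [leftSum_eq_sum hσ hn, increment_leftSum hσ, Pi.mul_apply, mul_assoc]

/-- A Riemann sum along `π` is a Riemann sum along any refinement `σ` of `π`, the integrand being
frozen at the points of `π`. -/
lemma leftSum_step_of_subseq (hπ : IsPartition π) (hσ : IsPartition σ) {κ : ℕ → ℕ}
    (hκ : Monotone κ) (hκ0 : κ 0 = 0) (h : ∀ k, σ (κ k) = π k) (H X : ℝ≥0 → Ω → ℝ) :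
    leftSum π H X = leftSum σ (stepProcess π H) X := by
  funext t ω
  obtain ⟨n, hn⟩ := hπ.exists_ge t
  rw [leftSum_eq_sum hπ hn, leftSum_eq_sum hσ (n := κ n) (by rwa [h])]
  clear hn
  induction n with
  | zero => simp [hκ0]
  | succ n ih =>
    have key : ∀ j, κ n ≤ j → j ≤ κ (n + 1) →
        ∑ i ∈ Finset.range j, stepProcess π H (σ i) ω * increment σ X t ω i =
          ∑ i ∈ Finset.range (κ n), stepProcess π H (σ i) ω * increment σ X t ω i +
            H (π n) ω * (X (min (σ j) t) ω - X (min (π n) t) ω) := by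
      intro j hj
      induction j, hj using Nat.le_induction with
      | base => intro _; simp [h]
      | succ j hj ihj =>
        intro hj'
        rw [Finset.sum_range_succ, ihj (by omega)]
        have hle : σ j ≤ π (n + 1) := h (n + 1) ▸ hσ.mono (by omega)
        rcases hle.lt_or_eq with hlt | heq
        · rw [stepProcess, leftPoint_eq hπ (h n ▸ hσ.mono hj) hlt, increment]; ring
        · have : σ (j + 1) = σ j :=
            le_antisymm (heq ▸ h (n + 1) ▸ hσ.mono hj') (hσ.mono j.le_succ)
          simp [increment, this]
    rw [Finset.sum_range_succ, ih, key _ (hκ n.le_succ) le_rfl, h, increment]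

/-- Two partitions have a common refinement, along which Riemann sums for either of them are
Riemann sums of step processes. -/
theorem exists_common_refinement {ρ : ℕ → ℝ≥0} (hπ : IsPartition π) (hρ : IsPartition ρ) :
    ∃ σ, IsPartition σ ∧
      (∀ H X : ℝ≥0 → Ω → ℝ, leftSum π H X = leftSum σ (stepProcess π H) X) ∧
      ∀ H X : ℝ≥0 → Ω → ℝ, leftSum ρ H X = leftSum σ (stepProcess ρ H) X := by
  classical
  have hfin : ∀ {π : ℕ → ℝ≥0}, IsPartition π → ∀ b, (Set.range π ∩ Set.Iic b).Finite := by
    intro π hπ b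
    obtain ⟨n, hn⟩ := hπ.exists_gt b
    refine ((Set.finite_lt_nat n).image π).subset ?_
    rintro _ ⟨⟨k, rfl⟩, hk⟩
    exact ⟨k, not_le.1 fun hnk => absurd (hn.trans_le (hπ.mono hnk)) (not_lt.2 hk), rfl⟩
  let S : Set ℝ≥0 := Set.range π ∪ Set.range ρ
  have hS : ∀ b, (S ∩ Set.Iic b).Finite := fun b => by
    rw [Set.union_inter_distrib_right]; exact (hfin hπ b).union (hfin hρ b)
  let : OrderBot S := { bot := ⟨0, Or.inl ⟨0, hπ.zero⟩⟩, bot_le := fun a => (zero_le : (0 : ℝ≥0) ≤ a.1) }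
  let : LocallyFiniteOrder S := LocallyFiniteOrder.ofFiniteIcc fun a b => by
    refine Set.Finite.of_finite_image ((hS b.1).subset ?_) Subtype.val_injective.injOn
    rintro _ ⟨x, hx, rfl⟩
    exact ⟨x.2, hx.2⟩
  have : NoMaxOrder S := ⟨fun a => by
    obtain ⟨n, hn⟩ := hπ.exists_gt a.1
    exact ⟨⟨π n, Or.inl ⟨n, rfl⟩⟩, hn⟩⟩
  let := LinearLocallyFiniteOrder.succOrder S
  let := LinearLocallyFiniteOrder.predOrder S
  let e : S ≃o ℕ := orderIsoNatOfLinearSuccPredArch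
  have hσ : IsPartition fun i => (e.symm i : ℝ≥0) := by
    refine ⟨?_, fun i j hij => e.symm.monotone hij, tendsto_atTop_atTop_of_monotone
      (fun i j hij => e.symm.monotone hij) fun b => ?_⟩
    · have : e.symm 0 = (⊥ : S) := e.symm.map_bot
      rw [this]; rfl
    · obtain ⟨n, hn⟩ := hπ.exists_ge b
      exact ⟨e ⟨π n, Or.inl ⟨n, rfl⟩⟩, by simpa using hn⟩
  have h0 : ∀ x : S, (x : ℝ≥0) = 0 → e x = 0 := fun x hx => by
    rw [show x = ⊥ from Subtype.ext hx]; exact e.map_bot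
  refine ⟨_, hσ, fun H X => ?_, fun H X => ?_⟩
  · exact leftSum_step_of_subseq hπ hσ (κ := fun k => e ⟨π k, Or.inl ⟨k, rfl⟩⟩)
      (fun i j hij => e.monotone (Subtype.mk_le_mk.2 (hπ.mono hij))) (h0 _ hπ.zero) (by simp) H X
  · exact leftSum_step_of_subseq hρ hσ (κ := fun k => e ⟨ρ k, Or.inr ⟨k, rfl⟩⟩)
      (fun i j hij => e.monotone (Subtype.mk_le_mk.2 (hρ.mono hij))) (h0 _ hρ.zero) (by simp) H X

lemma stronglyAdapted_leftSum {mΩ : MeasurableSpace Ω} {𝓕 : Filtration ℝ≥0 mΩ}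
    (hπ : IsPartition π) (hH : StronglyAdapted 𝓕 H) (hX : StronglyAdapted 𝓕 X) :
    StronglyAdapted 𝓕 (leftSum π H X) := by
  intro t
  obtain ⟨n, hn⟩ := hπ.exists_ge t
  have : leftSum π H X t = fun ω => ∑ k ∈ Finset.range n, H (π k) ω * increment π X t ω k :=
    funext fun ω => leftSum_eq_sum hπ hn
  rw [this]
  refine Finset.stronglyMeasurable_fun_sum _ fun k _ => ?_
  rcases le_total (π k) t with h | h
  · exact ((hH (π k)).mono (𝓕.mono h)).mul
      (((hX _).mono (𝓕.mono (min_le_right _ _))).sub ((hX _).mono (𝓕.mono (min_le_right _ _))))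
  · simp only [increment_eq_zero hπ h, mul_zero]
    exact stronglyMeasurable_const

lemma stronglyAdapted_stepProcess {mΩ : MeasurableSpace Ω} {𝓕 : Filtration ℝ≥0 mΩ}
    (hπ : IsPartition π) (hH : StronglyAdapted 𝓕 H) : StronglyAdapted 𝓕 (stepProcess π H) :=
  fun s => (hH _).mono (𝓕.mono (leftPoint_le hπ s))

/-- The dyadic partition `k / 2 ^ n`. -/
def dyadic (n k : ℕ) : ℝ≥0 := k / 2 ^ n

lemma isPartitionSeq_dyadic : IsPartitionSeq dyadic where
  zero n := by simp [dyadic]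
  mono n i j hij := by unfold dyadic; gcongr
  tendsto_atTop n := by
    refine Tendsto.atTop_div_const (by positivity) ?_
    exact tendsto_natCast_atTop_atTop
  mesh δ hδ := by
    have h : Tendsto (fun n : ℕ => ((1 / 2 : ℝ≥0)) ^ n) atTop (𝓝 0) :=
      NNReal.tendsto_pow_atTop_nhds_zero_of_lt_one (by rw [← NNReal.coe_lt_coe]; norm_num)
    filter_upwards [h.eventually_le_const hδ] with n hn k
    rw [dyadic, dyadic, Nat.cast_succ, add_div]
    gcongr
    simpa using hn

end Partition

/-! ### Continuous adapted processes and convergence in ucp -/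

/-- The initial σ-algebra contains all measurable null sets. -/
class ContainsNullSets {Ω : Type*} {mΩ : MeasurableSpace Ω} (𝓕 : Filtration ℝ≥0 mΩ)
    (μ : Measure Ω) : Prop where
  measurableSet_of_null : ∀ s, MeasurableSet s → μ s = 0 → MeasurableSet[𝓕 0] s

section Ucp

variable {Ω : Type*} {mΩ : MeasurableSpace Ω} {𝓕 : Filtration ℝ≥0 mΩ} {μ : Measure Ω}
  {X Y : ℝ≥0 → Ω → ℝ}

/-- Two processes are indistinguishable if almost surely their paths agree. -/
def Indist (μ : Measure Ω) (X Y : ℝ≥0 → Ω → ℝ) : Prop := ∀ᵐ ω ∂μ, ∀ t, X t ω = Y t ω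

lemma Indist.refl (X : ℝ≥0 → Ω → ℝ) : Indist μ X X := ae_of_all _ fun _ _ => rfl

lemma Indist.symm (h : Indist μ X Y) : Indist μ Y X := by
  filter_upwards [h] with ω hω t using (hω t).symm

lemma Indist.trans {Z : ℝ≥0 → Ω → ℝ} (h : Indist μ X Y) (h' : Indist μ Y Z) : Indist μ X Z := by
  filter_upwards [h, h'] with ω hω hω' t using (hω t).trans (hω' t)

lemma Indist.add {X' Y' : ℝ≥0 → Ω → ℝ} (h : Indist μ X X') (h' : Indist μ Y Y') :
    Indist μ (X + Y) (X' + Y') := by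
  filter_upwards [h, h'] with ω hω hω' t using by simp [hω t, hω' t]

lemma Indist.sub {X' Y' : ℝ≥0 → Ω → ℝ} (h : Indist μ X X') (h' : Indist μ Y Y') :
    Indist μ (X - Y) (X' - Y') := by
  filter_upwards [h, h'] with ω hω hω' t using by simp [hω t, hω' t]

lemma Indist.mul {X' Y' : ℝ≥0 → Ω → ℝ} (h : Indist μ X X') (h' : Indist μ Y Y') :
    Indist μ (X * Y) (X' * Y') := by
  filter_upwards [h, h'] with ω hω hω' t using by simp [hω t, hω' t]

lemma Indist.smul (c : ℝ) (h : Indist μ X Y) : Indist μ (c • X) (c • Y) := by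
  filter_upwards [h] with ω hω t using by simp [hω t]

namespace IsContAdapted

lemma add (hX : IsContAdapted 𝓕 μ X) (hY : IsContAdapted 𝓕 μ Y) : IsContAdapted 𝓕 μ (X + Y) :=
  ⟨fun t => (hX.adapted t).add (hY.adapted t), by
    filter_upwards [hX.continuous, hY.continuous] with ω h h' using h.add h'⟩

lemma sub (hX : IsContAdapted 𝓕 μ X) (hY : IsContAdapted 𝓕 μ Y) : IsContAdapted 𝓕 μ (X - Y) :=
  ⟨fun t => (hX.adapted t).sub (hY.adapted t), by
    filter_upwards [hX.continuous, hY.continuous] with ω h h' using h.sub h'⟩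

lemma mul (hX : IsContAdapted 𝓕 μ X) (hY : IsContAdapted 𝓕 μ Y) : IsContAdapted 𝓕 μ (X * Y) :=
  ⟨fun t => (hX.adapted t).mul (hY.adapted t), by
    filter_upwards [hX.continuous, hY.continuous] with ω h h' using h.mul h'⟩

lemma neg (hX : IsContAdapted 𝓕 μ X) : IsContAdapted 𝓕 μ (-X) :=
  ⟨fun t => (hX.adapted t).neg, by filter_upwards [hX.continuous] with ω h using h.neg⟩

lemma smul (c : ℝ) (hX : IsContAdapted 𝓕 μ X) : IsContAdapted 𝓕 μ (c • X) :=
  ⟨fun t => (hX.adapted t).const_smul c, by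
    filter_upwards [hX.continuous] with ω h using h.const_smul c⟩

lemma const (c : ℝ) : IsContAdapted 𝓕 μ fun _ _ => c :=
  ⟨fun _ => stronglyMeasurable_const, ae_of_all _ fun _ => continuous_const⟩

lemma initial (hX : IsContAdapted 𝓕 μ X) : IsContAdapted 𝓕 μ fun _ => X 0 :=
  ⟨fun _ => (hX.adapted 0).mono (𝓕.mono zero_le), ae_of_all _ fun _ => continuous_const⟩

lemma sum {ι : Type*} {s : Finset ι} {X : ι → ℝ≥0 → Ω → ℝ}
    (hX : ∀ i ∈ s, IsContAdapted 𝓕 μ (X i)) : IsContAdapted 𝓕 μ (∑ i ∈ s, X i) := by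
  classical
  induction s using Finset.induction_on with
  | empty => exact const (𝓕 := 𝓕) (μ := μ) 0
  | insert a s ha ih =>
    rw [Finset.sum_insert ha]
    exact (hX a (by simp)).add (ih fun i hi => hX i (by simp [hi]))

lemma comp {f : ℝ → ℝ} (hf : Measurable f) {s : Set ℝ} (hs : ContinuousOn f s)
    (hX : IsContAdapted 𝓕 μ X) (h : ∀ᵐ ω ∂μ, ∀ t, X t ω ∈ s) :
    IsContAdapted 𝓕 μ fun t ω => f (X t ω) :=
  ⟨fun t => (hf.comp (hX.adapted t).measurable).stronglyMeasurable, by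
    filter_upwards [hX.continuous, h] with ω h h' using hs.comp_continuous h h'⟩

lemma inv (hX : IsContAdapted 𝓕 μ X) (h : ∀ᵐ ω ∂μ, ∀ t, X t ω ≠ 0) : IsContAdapted 𝓕 μ X⁻¹ :=
  hX.comp (s := {0}ᶜ) measurable_inv continuousOn_inv₀ h

lemma div (hY : IsContAdapted 𝓕 μ Y) (hX : IsContAdapted 𝓕 μ X) (h : ∀ᵐ ω ∂μ, ∀ t, X t ω ≠ 0) :
    IsContAdapted 𝓕 μ (Y / X) := by
  rw [div_eq_mul_inv]; exact hY.mul (hX.inv h)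

lemma log (hX : IsContAdapted 𝓕 μ X) (h : ∀ᵐ ω ∂μ, ∀ t, 0 < X t ω) :
    IsContAdapted 𝓕 μ fun t ω => Real.log (X t ω) :=
  hX.comp (s := {0}ᶜ) Real.measurable_log Real.continuousOn_log
    (by filter_upwards [h] with ω hω t using (hω t).ne')

end IsContAdapted

/-- An almost sure property holds on an event of the initial σ-algebra of full measure. -/
lemma exists_initial_event [ContainsNullSets 𝓕 μ] {p : Ω → Prop} (h : ∀ᵐ ω ∂μ, p ω) :
    ∃ G, MeasurableSet[𝓕 0] G ∧ (∀ᵐ ω ∂μ, ω ∈ G) ∧ ∀ ω ∈ G, p ω := by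
  obtain ⟨t, ht, htm, ht0⟩ := exists_measurable_superset_of_null (ae_iff.1 h)
  refine ⟨tᶜ, (ContainsNullSets.measurableSet_of_null t htm ht0).compl,
    ae_iff.2 (by simpa using ht0), fun ω hω => ?_⟩
  by_contra hp
  exact hω (ht hp)

lemma stronglyAdapted_indicator {G : Set Ω} (hG : MeasurableSet[𝓕 0] G)
    (hX : StronglyAdapted 𝓕 X) : StronglyAdapted 𝓕 fun t => G.indicator (X t) :=
  fun t => (hX t).indicator (𝓕.mono zero_le _ hG)

lemma indist_indicator {G : Set Ω} (hG : ∀ᵐ ω ∂μ, ω ∈ G) (X : ℝ≥0 → Ω → ℝ) :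
    Indist μ X fun t => G.indicator (X t) := by
  filter_upwards [hG] with ω hω t using (Set.indicator_of_mem hω _).symm

/-- A continuous adapted process is indistinguishable from an adapted process all of whose paths
are continuous. -/
lemma IsContAdapted.exists_version [ContainsNullSets 𝓕 μ] (hX : IsContAdapted 𝓕 μ X) :
    ∃ X', StronglyAdapted 𝓕 X' ∧ (∀ ω, Continuous fun t => X' t ω) ∧ Indist μ X X' := by
  obtain ⟨G, hG, hG1, h⟩ := exists_initial_event (𝓕 := 𝓕) hX.continuous
  refine ⟨fun t => G.indicator (X t), stronglyAdapted_indicator hG hX.adapted, fun ω => ?_,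
    indist_indicator hG1 X⟩
  by_cases hω : ω ∈ G
  · simpa [hω] using h ω hω
  · simpa [hω] using continuous_const

/-- The event that `|X|` reaches the level `a` before time `t`. -/
def exceed (X : ℝ≥0 → Ω → ℝ) (t : ℝ≥0) (a : ℝ) : Set Ω := {ω | ∃ s ≤ t, a ≤ |X s ω|}

lemma exceed_anti {t : ℝ≥0} {a b : ℝ} (h : a ≤ b) : exceed X t b ⊆ exceed X t a :=
  fun _ ⟨s, hs, hb⟩ => ⟨s, hs, h.trans hb⟩

lemma measure_exceed_congr (h : Indist μ X Y) (t : ℝ≥0) (a : ℝ) :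
    μ (exceed X t a) = μ (exceed Y t a) := by
  refine measure_congr ?_
  filter_upwards [h] with ω hω
  refine propext ?_
  change (∃ s ≤ t, a ≤ |X s ω|) ↔ ∃ s ≤ t, a ≤ |Y s ω|
  simp [hω]

lemma exceed_add_subset (X Y : ℝ≥0 → Ω → ℝ) (t : ℝ≥0) (a b : ℝ) :
    exceed (X + Y) t (a + b) ⊆ exceed X t a ∪ exceed Y t b := by
  rintro ω ⟨s, hs, h⟩
  by_contra hc
  simp only [exceed, Set.mem_union, Set.mem_ofPred_eq, not_or, not_exists, not_and, not_le] at hc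
  have := hc.1 s hs
  have := hc.2 s hs
  have := abs_add_le (X s ω) (Y s ω)
  simp only [Pi.add_apply] at h
  linarith

lemma measure_exceed_add_le (X Y : ℝ≥0 → Ω → ℝ) (t : ℝ≥0) (a b : ℝ) :
    μ (exceed (X + Y) t (a + b)) ≤ μ (exceed X t a) + μ (exceed Y t b) :=
  (measure_mono (exceed_add_subset X Y t a b)).trans (measure_union_le _ _)

lemma exceed_neg : exceed (-X) = exceed X := by
  funext t a; simp [exceed]

lemma measure_exceed_sub_le (X Y : ℝ≥0 → Ω → ℝ) (t : ℝ≥0) (a b : ℝ) :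
    μ (exceed (X - Y) t (a + b)) ≤ μ (exceed X t a) + μ (exceed Y t b) := by
  rw [sub_eq_add_neg]
  simpa [exceed_neg] using measure_exceed_add_le (μ := μ) X (-Y) t a b

/-- Because paths are continuous, the level is reached iff it is approached along a countable dense
set of times. -/
lemma measurableSet_exceed (hX : StronglyAdapted 𝓕 X) (hc : ∀ ω, Continuous fun t => X t ω)
    (t : ℝ≥0) (a : ℝ) : MeasurableSet[𝓕 t] (exceed X t a) := by
  let d := TopologicalSpace.denseSeq ℝ≥0
  have hd : DenseRange d := TopologicalSpace.denseRange_denseSeq _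
  have : exceed X t a = ⋂ m : ℕ, ⋃ n : ℕ, {ω | a - 1 / ((m : ℝ) + 1) < |X (min (d n) t) ω|} := by
    ext ω
    simp only [exceed, Set.mem_ofPred_eq, Set.mem_iInter, Set.mem_iUnion]
    have hc' : Continuous fun s => |X (min s t) ω| :=
      continuous_abs.comp ((hc ω).comp (continuous_id.min continuous_const))
    constructor
    · rintro ⟨s, hs, h⟩ m
      have hpos : 0 < 1 / ((m : ℝ) + 1) := by positivity
      obtain ⟨n, hn⟩ := hd.exists_mem_open (isOpen_lt continuous_const hc')
        ⟨s, show a - 1 / ((m : ℝ) + 1) < _ by rw [min_eq_left hs]; linarith⟩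
      exact ⟨n, hn⟩
    · intro h
      obtain ⟨s, hs, hmax⟩ := (isCompact_Icc (a := (0 : ℝ≥0)) (b := t)).exists_isMaxOn
        ⟨0, by simp⟩ (continuous_abs.comp (hc ω)).continuousOn
      refine ⟨s, hs.2, le_of_forall_pos_lt_add fun ε hε => ?_⟩
      obtain ⟨m, hm⟩ := exists_nat_one_div_lt hε
      obtain ⟨n, hn⟩ := h m
      have : |X (min (d n) t) ω| ≤ |X s ω| := hmax ⟨zero_le, min_le_right _ _⟩
      linarith
  rw [this]
  refine MeasurableSet.iInter fun m => MeasurableSet.iUnion fun n => ?_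
  exact StronglyMeasurable.measurableSet_lt stronglyMeasurable_const
    ((hX _).mono (𝓕.mono (min_le_right _ _))).norm

/-- Continuous adapted processes are bounded on compacts, up to small probability. -/
lemma IsContAdapted.exists_bound [IsFiniteMeasure μ] [ContainsNullSets 𝓕 μ]
    (hX : IsContAdapted 𝓕 μ X) (t : ℝ≥0) {δ : ℝ≥0∞} (hδ : 0 < δ) :
    ∃ K : ℝ, 0 < K ∧ μ (exceed X t K) ≤ δ := by
  obtain ⟨X', hX', hc, h⟩ := hX.exists_version
  have ht : Tendsto (μ ∘ fun n : ℕ => exceed X' t n) atTop (𝓝 (μ (⋂ n : ℕ, exceed X' t n))) :=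
    tendsto_measure_iInter_atTop
      (fun n => (𝓕.le t _ (measurableSet_exceed hX' hc t n)).nullMeasurableSet)
      (fun m n hmn => exceed_anti (by exact_mod_cast hmn)) ⟨0, measure_ne_top _ _⟩
  have h0 : ⋂ n : ℕ, exceed X' t n = ∅ := by
    refine Set.eq_empty_of_forall_notMem fun ω hω => ?_
    obtain ⟨s, hs, hmax⟩ := (isCompact_Icc (a := (0 : ℝ≥0)) (b := t)).exists_isMaxOn
      ⟨0, by simp⟩ (continuous_abs.comp (hc ω)).continuousOn
    obtain ⟨n, hn⟩ := exists_nat_gt |X' s ω|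
    obtain ⟨u, hu, h⟩ := Set.mem_iInter.1 hω n
    have : |X' u ω| ≤ |X' s ω| := hmax ⟨zero_le, hu⟩
    linarith
  rw [h0, measure_empty] at ht
  obtain ⟨n, hn, hn'⟩ := ((ht.eventually_le_const hδ).and (eventually_gt_atTop 0)).exists
  exact ⟨n, by exact_mod_cast hn', (measure_exceed_congr h t n).trans_le hn⟩

/-- Continuous adapted processes are uniformly continuous on compacts, up to small probability. -/
lemma IsContAdapted.exists_modulus [IsFiniteMeasure μ] [ContainsNullSets 𝓕 μ]
    (hX : IsContAdapted 𝓕 μ X) (t : ℝ≥0) {ε : ℝ} (hε : 0 < ε) {δ : ℝ≥0∞} (hδ : 0 < δ) :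
    ∃ η : ℝ≥0, 0 < η ∧
      μ {ω | ∃ p ≤ t, ∃ q ≤ t, p ≤ q + η ∧ q ≤ p + η ∧ ε ≤ |X p ω - X q ω|} ≤ δ := by
  obtain ⟨X', hX', hc, h⟩ := hX.exists_version
  let d := TopologicalSpace.denseSeq ℝ≥0
  have hd : DenseRange d := TopologicalSpace.denseRange_denseSeq _
  let E : ℕ → Set Ω := fun m => ⋃ (i : ℕ) (j : ℕ) (_ : dist (min (d i) t) (min (d j) t) <
    1 / ((m : ℝ) + 1)), {ω | ε / 2 < |X' (min (d i) t) ω - X' (min (d j) t) ω|}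
  have hE : ∀ m, MeasurableSet (E m) := fun m => by
    refine MeasurableSet.iUnion fun i => MeasurableSet.iUnion fun j => MeasurableSet.iUnion fun _ =>
      StronglyMeasurable.measurableSet_lt stronglyMeasurable_const ?_
    have h1 (u : ℝ≥0) : StronglyMeasurable (X' u) := (hX' u).mono (𝓕.le u)
    exact ((h1 _).sub (h1 _)).norm
  have hanti : Antitone E := fun m n hmn => by
    refine Set.iUnion_mono fun i => Set.iUnion_mono fun j => Set.iUnion_mono' fun hij => ?_
    refine ⟨hij.trans_le ?_, subset_rfl⟩
    gcongr
  have ht := tendsto_measure_iInter_atTop (μ := μ) (fun m => (hE m).nullMeasurableSet) hanti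
    ⟨0, measure_ne_top _ _⟩
  have h0 : ⋂ n : ℕ, E n = ∅ := by
    refine Set.eq_empty_of_forall_notMem fun ω hω => ?_
    have hu := Metric.uniformContinuousOn_iff.1
      ((isCompact_Icc (a := (0 : ℝ≥0)) (b := t)).uniformContinuousOn_of_continuous
        (hc ω).continuousOn) (ε / 2) (by positivity)
    obtain ⟨η, hη, hu⟩ := hu
    obtain ⟨m, hm⟩ := exists_nat_one_div_lt hη
    have := Set.mem_iInter.1 hω m
    simp only [E, Set.mem_iUnion, Set.mem_ofPred_eq] at this
    obtain ⟨i, j, hij, h'⟩ := this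
    have := hu _ ⟨zero_le, min_le_right (d i) t⟩ _ ⟨zero_le, min_le_right (d j) t⟩
      (hij.trans hm)
    rw [Real.dist_eq] at this
    linarith
  rw [h0, measure_empty] at ht
  obtain ⟨m, hm⟩ := (ht.eventually_le_const hδ).exists
  have hη : (0 : ℝ≥0) < 1 / (2 * ((m : ℝ≥0) + 1)) := by positivity
  refine ⟨1 / (2 * ((m : ℝ≥0) + 1)), hη, le_trans (measure_mono_ae ?_) hm⟩
  filter_upwards [h] with ω hω
  rintro ⟨p, hp, q, hq, hpq, hqp, hε'⟩
  rw [hω, hω] at hε'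
  have hdist : dist p q < 1 / ((m : ℝ) + 1) := by
    rw [NNReal.dist_eq]
    have h1 : (p : ℝ) ≤ q + 1 / (2 * ((m : ℝ) + 1)) := by exact_mod_cast hpq
    have h2 : (q : ℝ) ≤ p + 1 / (2 * ((m : ℝ) + 1)) := by exact_mod_cast hqp
    have h3 : 1 / (2 * ((m : ℝ) + 1)) < 1 / ((m : ℝ) + 1) := by
      have : (0 : ℝ) < (m : ℝ) + 1 := by positivity
      exact one_div_lt_one_div_of_lt this (by linarith)
    rw [abs_lt]; constructor <;> linarith
  have ho : IsOpen {x : ℝ≥0 × ℝ≥0 | dist (min x.1 t) (min x.2 t) < 1 / ((m : ℝ) + 1) ∧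
      ε / 2 < |X' (min x.1 t) ω - X' (min x.2 t) ω|} := by
    have h1 : Continuous fun x : ℝ≥0 × ℝ≥0 => min x.1 t := continuous_fst.min continuous_const
    have h2 : Continuous fun x : ℝ≥0 × ℝ≥0 => min x.2 t := continuous_snd.min continuous_const
    exact (isOpen_lt (h1.dist h2) continuous_const).inter
      (isOpen_lt continuous_const (((hc ω).comp h1).sub ((hc ω).comp h2)).abs)
  obtain ⟨⟨i, j⟩, hij⟩ := (hd.prodMap hd).exists_mem_open ho
    ⟨(p, q), by rw [Set.mem_ofPred_eq, min_eq_left hp, min_eq_left hq]; exact ⟨hdist, by linarith⟩⟩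
  exact Set.mem_iUnion₂.2 ⟨i, j, Set.mem_iUnion.2 ⟨hij.1, hij.2⟩⟩

lemma tendstoUCP_iff {Z : ℕ → ℝ≥0 → Ω → ℝ} :
    TendstoUCP μ Z X ↔
      ∀ t ε, 0 < ε → Tendsto (fun n => μ (exceed (Z n - X) t ε)) atTop (𝓝 0) := Iff.rfl

lemma TendstoUCP.exists_le {Z : ℕ → ℝ≥0 → Ω → ℝ} (h : TendstoUCP μ Z X) (t : ℝ≥0) {ε : ℝ}
    (hε : 0 < ε) {δ : ℝ≥0∞} (hδ : 0 < δ) : ∀ᶠ n in atTop, μ (exceed (Z n - X) t ε) ≤ δ :=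
  (tendstoUCP_iff.1 h t ε hε).eventually_le_const hδ

lemma TendstoUCP.of_le {Z : ℕ → ℝ≥0 → Ω → ℝ}
    (h : ∀ t ε, 0 < ε → ∀ δ : ℝ≥0∞, 0 < δ → ∀ᶠ n in atTop, μ (exceed (Z n - X) t ε) ≤ δ) :
    TendstoUCP μ Z X :=
  tendstoUCP_iff.2 fun t ε hε => ENNReal.tendsto_nhds_zero.2 fun δ hδ => h t ε hε δ hδ

lemma TendstoUCP.congr {Z Z' : ℕ → ℝ≥0 → Ω → ℝ} (h : TendstoUCP μ Z X)
    (hZ : ∀ n, Indist μ (Z n) (Z' n)) (hX : Indist μ X Y) : TendstoUCP μ Z' Y :=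
  tendstoUCP_iff.2 fun t ε hε => (tendstoUCP_iff.1 h t ε hε).congr fun n =>
    measure_exceed_congr ((hZ n).sub hX) t ε

lemma TendstoUCP.add {Z Z' : ℕ → ℝ≥0 → Ω → ℝ} (h : TendstoUCP μ Z X) (h' : TendstoUCP μ Z' Y) :
    TendstoUCP μ (fun n => Z n + Z' n) (X + Y) := by
  refine TendstoUCP.of_le fun t ε hε δ hδ => ?_
  filter_upwards [h.exists_le t (half_pos hε) (ENNReal.half_pos hδ.ne'),
    h'.exists_le t (half_pos hε) (ENNReal.half_pos hδ.ne')] with n h1 h2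
  rw [add_sub_add_comm, ← add_halves ε, ← ENNReal.add_halves δ]
  exact (measure_exceed_add_le _ _ t _ _).trans (add_le_add h1 h2)

lemma TendstoUCP.smul {Z : ℕ → ℝ≥0 → Ω → ℝ} (c : ℝ) (h : TendstoUCP μ Z X) :
    TendstoUCP μ (fun n => c • Z n) (c • X) := by
  refine TendstoUCP.of_le fun t ε hε δ hδ => ?_
  have hc : 0 < |c| + 1 := by positivity
  filter_upwards [h.exists_le t (div_pos hε hc) hδ] with n h1
  refine (measure_mono ?_).trans h1
  rintro ω ⟨s, hs, h⟩
  refine ⟨s, hs, (div_le_iff₀ hc).2 (h.trans ?_)⟩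
  rw [← smul_sub, Pi.smul_apply, Pi.smul_apply, smul_eq_mul, abs_mul, mul_comm]
  gcongr
  linarith

lemma TendstoUCP.neg {Z : ℕ → ℝ≥0 → Ω → ℝ} (h : TendstoUCP μ Z X) :
    TendstoUCP μ (fun n => -Z n) (-X) := by
  simpa using h.smul (-1)

lemma TendstoUCP.sub {Z Z' : ℕ → ℝ≥0 → Ω → ℝ} (h : TendstoUCP μ Z X) (h' : TendstoUCP μ Z' Y) :
    TendstoUCP μ (fun n => Z n - Z' n) (X - Y) := by
  simpa only [sub_eq_add_neg] using h.add h'.neg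

lemma TendstoUCP.const (X : ℝ≥0 → Ω → ℝ) : TendstoUCP μ (fun _ => X) X :=
  TendstoUCP.of_le fun t ε hε δ _ => by
    have : exceed (X - X) t ε = ∅ := by
      refine Set.eq_empty_of_forall_notMem fun ω ⟨s, _, h⟩ => ?_
      simp at h; linarith
    exact Eventually.of_forall fun _ => by rw [this]; simp

lemma indist_of_exceed_null (h : ∀ t ε, 0 < ε → μ (exceed (X - Y) t ε) = 0) : Indist μ X Y := by
  have h' : ∀ᵐ ω ∂μ, ∀ m n : ℕ, ω ∉ exceed (X - Y) m (1 / ((n : ℝ) + 1)) := by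
    rw [ae_all_iff]; intro m; rw [ae_all_iff]; intro n
    exact measure_eq_zero_iff_ae_notMem.1 (h m _ (by positivity))
  filter_upwards [h'] with ω hω t
  by_contra hne
  obtain ⟨n, hn⟩ := exists_nat_one_div_lt (abs_pos.2 (sub_ne_zero.2 hne))
  obtain ⟨m, hm⟩ := exists_nat_ge t
  exact hω m n ⟨t, hm, hn.le⟩

lemma TendstoUCP.unique {Z : ℕ → ℝ≥0 → Ω → ℝ} (h : TendstoUCP μ Z X) (h' : TendstoUCP μ Z Y) :
    Indist μ X Y := by
  have h0 := h'.sub h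
  refine indist_of_exceed_null fun t ε hε => ?_
  have := tendstoUCP_iff.1 h0 t ε hε
  have e : ∀ n, Z n - Z n - (Y - X) = X - Y := fun n => by abel
  simp only [e] at this
  exact tendsto_nhds_unique tendsto_const_nhds this

/-- Step processes along partitions with vanishing mesh approximate a continuous process. -/
lemma IsContAdapted.tendstoUCP_stepProcess [IsFiniteMeasure μ] [ContainsNullSets 𝓕 μ]
    (hX : IsContAdapted 𝓕 μ X) {π : ℕ → ℕ → ℝ≥0} (hπ : IsPartitionSeq π) :
    TendstoUCP μ (fun n => stepProcess (π n) X) X := by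
  refine TendstoUCP.of_le fun t ε hε δ hδ => ?_
  obtain ⟨η, hη, h⟩ := hX.exists_modulus t hε hδ
  filter_upwards [hπ.mesh η hη] with n hn
  refine (measure_mono ?_).trans h
  rintro ω ⟨s, hs, h⟩
  have h1 := leftPoint_le (hπ.isPartition n) s
  exact ⟨_, h1.trans hs, s, hs, h1.trans (by simp), le_leftPoint_add (hπ.isPartition n) hn s, h⟩

end Ucp

/-! ### Completeness of ucp convergence -/

section Completeness

variable {Ω : Type*} {mΩ : MeasurableSpace Ω} {𝓕 : Filtration ℝ≥0 mΩ} {μ : Measure Ω}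
  {X Y : ℝ≥0 → Ω → ℝ}

/-- Borel–Cantelli for the running suprema of a sequence of processes. -/
lemma ae_eventually_lt_of_measure_exceed_le {W : ℕ → ℝ≥0 → Ω → ℝ}
    (h : ∀ j : ℕ, μ (exceed (W j) j ((1 / 2) ^ j)) ≤ (1 / 2) ^ j) :
    ∀ᵐ ω ∂μ, ∀ᶠ j : ℕ in atTop, ∀ s ≤ (j : ℝ≥0), |W j s ω| < (1 / 2) ^ j := by
  have hs : ∑' j : ℕ, μ (exceed (W j) j ((1 / 2) ^ j)) ≠ ⊤ := by
    refine ne_top_of_le_ne_top ?_ (ENNReal.tsum_le_tsum h)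
    rw [ENNReal.tsum_geometric]
    simp
  have := measure_setOfPred_frequently_eq_zero (p := fun j ω => ω ∈ exceed (W j) j ((1 / 2) ^ j)) hs
  filter_upwards [measure_eq_zero_iff_ae_notMem.1 this] with ω hω
  filter_upwards [not_frequently.1 hω] with j hj s hs
  by_contra hc
  exact hj ⟨s, hs, not_lt.1 hc⟩

/-- Along a subsequence, ucp convergence is almost sure convergence at all times. -/
lemma TendstoUCP.exists_subseq {Z : ℕ → ℝ≥0 → Ω → ℝ} (h : TendstoUCP μ Z X) :
    ∃ φ : ℕ → ℕ, StrictMono φ ∧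
      ∀ᵐ ω ∂μ, ∀ t, Tendsto (fun j => Z (φ j) t ω) atTop (𝓝 (X t ω)) := by
  obtain ⟨φ, hφ, hp⟩ := extraction_forall_of_eventually
    (P := fun j n => μ (exceed (Z n - X) j ((1 / 2) ^ j)) ≤ (1 / 2) ^ j)
    fun j => h.exists_le j (by positivity) (by simp [ENNReal.pow_pos])
  refine ⟨φ, hφ, ?_⟩
  filter_upwards [ae_eventually_lt_of_measure_exceed_le hp] with ω hω t
  rw [tendsto_iff_dist_tendsto_zero]
  refine squeeze_zero' (Eventually.of_forall fun _ => dist_nonneg) ?_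
    (tendsto_pow_atTop_nhds_zero_of_lt_one (r := (1 / 2 : ℝ)) (by norm_num) (by norm_num))
  obtain ⟨m, hm⟩ := exists_nat_ge t
  filter_upwards [hω, eventually_ge_atTop m] with j hj hmj
  exact (hj t (hm.trans (by exact_mod_cast hmj))).le

/-- Continuous adapted processes are complete for ucp convergence. -/
theorem exists_tendstoUCP [ContainsNullSets 𝓕 μ] {Z : ℕ → ℝ≥0 → Ω → ℝ}
    (hZ : ∀ n, IsContAdapted 𝓕 μ (Z n))
    (h : ∀ t ε, 0 < ε → ∀ δ : ℝ≥0∞, 0 < δ →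
      ∃ N, ∀ n ≥ N, ∀ m ≥ N, μ (exceed (Z n - Z m) t ε) ≤ δ) :
    ∃ X, StronglyAdapted 𝓕 X ∧ (∀ ω, Continuous fun t => X t ω) ∧ TendstoUCP μ Z X := by
  obtain ⟨φ, hφ, hp⟩ := extraction_forall_of_eventually
    (P := fun j n => ∀ m ≥ n, μ (exceed (Z n - Z m) j ((1 / 2) ^ j)) ≤ (1 / 2) ^ j) fun j => by
      obtain ⟨N, hN⟩ := h j ((1 / 2) ^ j) (by positivity) ((1 / 2) ^ j) (by simp [ENNReal.pow_pos])
      filter_upwards [eventually_ge_atTop N] with n hn m hm using hN n hn m (hn.trans hm)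
  -- Consecutive members of a fast subsequence are eventually `(1 / 2) ^ j`-close on `[0, j]`.
  let W : ℕ → ℝ≥0 → Ω → ℝ := fun j => Z (φ j) - Z (φ (j + 1))
  have hW : ∀ j : ℕ, μ (exceed (W j) j ((1 / 2) ^ j)) ≤ (1 / 2) ^ j :=
    fun j => hp j _ (hφ.monotone j.le_succ)
  obtain ⟨G, hG, hG1, hGp⟩ := exists_initial_event (𝓕 := 𝓕)
    ((ae_eventually_lt_of_measure_exceed_le hW).and (ae_all_iff.2 fun n => (hZ n).continuous))
  have key : ∀ ω (J : ℕ), (∀ j ≥ J, ∀ s ≤ (j : ℝ≥0), |W j s ω| < (1 / 2) ^ j) →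
      ∀ j ≥ J, ∀ s ≤ (j : ℝ≥0), ∀ m, |Z (φ j) s ω - Z (φ (j + m)) s ω| ≤ 2 * (1 / 2) ^ j := by
    intro ω J hJ j hj s hs m
    have : |Z (φ j) s ω - Z (φ (j + m)) s ω| ≤ 2 * (1 / 2) ^ j - 2 * (1 / 2) ^ (j + m) := by
      induction m with
      | zero => simp
      | succ m ih =>
        have h1 := (hJ (j + m) (by omega) s (hs.trans (by norm_cast; omega))).le
        have h2 := abs_sub_le (Z (φ j) s ω) (Z (φ (j + m)) s ω) (Z (φ (j + (m + 1))) s ω)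
        have h3 : |Z (φ (j + m)) s ω - Z (φ (j + (m + 1))) s ω| ≤ (1 / 2) ^ (j + m) := h1
        have h4 : (1 / 2 : ℝ) ^ (j + (m + 1)) = (1 / 2) ^ (j + m) / 2 := by
          rw [← add_assoc, pow_succ]; ring
        rw [h4]; linarith
    have h5 : (0 : ℝ) < (1 / 2) ^ (j + m) := by positivity
    linarith
  have hex : ∀ ω ∈ G, ∃ J : ℕ, ∀ j ≥ J, ∀ s ≤ (j : ℝ≥0), |W j s ω| < (1 / 2) ^ j :=
    fun ω hω => eventually_atTop.1 (hGp ω hω).1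
  have hlim : ∀ ω ∈ G, ∀ t, ∃ x, Tendsto (fun j => Z (φ j) t ω) atTop (𝓝 x) := by
    intro ω hω t
    obtain ⟨J, hJ⟩ := hex ω hω
    obtain ⟨m, hm⟩ := exists_nat_ge t
    refine cauchySeq_tendsto_of_complete (Metric.cauchySeq_iff'.2 fun ε hε => ?_)
    obtain ⟨p, hp⟩ := exists_pow_lt_of_lt_one (half_pos hε) (show (1 / 2 : ℝ) < 1 by norm_num)
    refine ⟨max (max J m) p, fun n hn => ?_⟩
    have h1 := key ω J hJ (max (max J m) p) (by simp) t (hm.trans (by norm_cast; simp))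
      (n - max (max J m) p)
    rw [Nat.add_sub_cancel' hn] at h1
    rw [dist_comm, Real.dist_eq]
    have h2 : (1 / 2 : ℝ) ^ (max (max J m) p) ≤ (1 / 2) ^ p :=
      pow_le_pow_of_le_one (by norm_num) (by norm_num) (le_max_right _ _)
    linarith
  classical
  let X : ℝ≥0 → Ω → ℝ := fun t ω => if h : ω ∈ G then (hlim ω h t).choose else 0
  have hX : ∀ ω ∈ G, ∀ t, Tendsto (fun j => Z (φ j) t ω) atTop (𝓝 (X t ω)) := by
    intro ω hω t
    simp only [X, hω, dif_pos]
    exact (hlim ω hω t).choose_spec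
  have hX0 : ∀ ω ∉ G, ∀ t, X t ω = 0 := fun ω hω t => by simp [X, hω]
  have hbd : ∀ ω ∈ G, ∀ J : ℕ, (∀ j ≥ J, ∀ s ≤ (j : ℝ≥0), |W j s ω| < (1 / 2) ^ j) →
      ∀ j ≥ J, ∀ s ≤ (j : ℝ≥0), |Z (φ j) s ω - X s ω| ≤ 2 * (1 / 2) ^ j := by
    intro ω hω J hJ j hj s hs
    refine le_of_tendsto ((tendsto_const_nhds.sub
      ((tendsto_add_atTop_iff_nat j).2 (hX ω hω s))).abs) (Eventually.of_forall fun m => ?_)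
    simpa [add_comm] using key ω J hJ j hj s hs m
  refine ⟨X, fun t => ?_, fun ω => ?_, ?_⟩
  · refine stronglyMeasurable_of_tendsto (m := 𝓕 t) atTop
      (f := fun j => G.indicator (Z (φ j) t))
      (fun j => stronglyAdapted_indicator hG (hZ (φ j)).adapted t) (tendsto_pi_nhds.2 fun ω => ?_)
    by_cases hω : ω ∈ G
    · simpa [hω] using hX ω hω t
    · simp [hω, hX0 ω hω t]
  · by_cases hω : ω ∈ G
    · obtain ⟨J, hJ⟩ := hex ω hω
      refine continuous_iff_continuousAt.2 fun t =>
        continuousAt_of_locally_uniform_approx_of_continuousAt fun u hu => ?_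
      obtain ⟨ε, hε, hu⟩ := Metric.mem_uniformity_dist.1 hu
      obtain ⟨p, hp⟩ := exists_pow_lt_of_lt_one (half_pos hε) (show (1 / 2 : ℝ) < 1 by norm_num)
      obtain ⟨m, hm⟩ := exists_nat_gt t
      let j := max (max J m) p
      have h2 : (1 / 2 : ℝ) ^ j ≤ (1 / 2) ^ p :=
        pow_le_pow_of_le_one (by norm_num) (by norm_num) (le_max_right _ _)
      refine ⟨Set.Iio m, Iio_mem_nhds hm, fun s => Z (φ j) s ω,
        ((hGp ω hω).2 (φ j)).continuousAt, fun s hs => hu ?_⟩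
      have h3 := hbd ω hω J hJ j (by simp [j]) s (hs.le.trans (by norm_cast; simp [j]))
      rw [dist_comm, Real.dist_eq]
      linarith
    · simpa [hX0 ω hω] using continuous_const
  · refine TendstoUCP.of_le fun t ε hε δ hδ => ?_
    obtain ⟨N, hN⟩ := h t (ε / 2) (half_pos hε) (δ / 2) (ENNReal.half_pos hδ.ne')
    have hsub : ∀ j : ℕ, t ≤ j → 2 * (1 / 2 : ℝ) ^ j < ε / 2 →
        μ (exceed (Z (φ j) - X) t (ε / 2)) ≤ 2 * (1 / 2) ^ j := by
      intro j htj hj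
      have h1 : μ (exceed (Z (φ j) - X) t (ε / 2)) ≤
          μ (⋃ i : ℕ, exceed (W (j + i)) (j + i : ℕ) ((1 / 2) ^ (j + i))) := by
        refine measure_mono_ae ?_
        filter_upwards [hG1] with ω hω
        rintro ⟨s, hs, hsε⟩
        change ω ∈ ⋃ i : ℕ, exceed (W (j + i)) (j + i : ℕ) ((1 / 2) ^ (j + i))
        by_contra hc
        simp only [Set.mem_iUnion, not_exists] at hc
        have := hbd ω hω j (fun i hi s hs => ?_) j le_rfl s (hs.trans htj)
        · simp only [Pi.sub_apply] at hsε; linarith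
        · have := hc (i - j)
          rw [Nat.add_sub_cancel' hi] at this
          by_contra hcc
          exact this ⟨s, hs, not_lt.1 hcc⟩
      refine h1.trans ((measure_iUnion_le _).trans ((ENNReal.tsum_le_tsum fun i => hW _).trans ?_))
      simp_rw [pow_add]
      rw [ENNReal.tsum_mul_left, ENNReal.tsum_geometric, mul_comm]
      simp
    have ht1 : Tendsto (fun j : ℕ => 2 * (1 / 2 : ℝ) ^ j) atTop (𝓝 (2 * 0)) :=
      (tendsto_pow_atTop_nhds_zero_of_lt_one (by norm_num) (by norm_num)).const_mul 2
    have ht2 : Tendsto (fun j : ℕ => 2 * (1 / 2 : ℝ≥0∞) ^ j) atTop (𝓝 (2 * 0)) :=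
      ENNReal.Tendsto.const_mul (ENNReal.tendsto_pow_atTop_nhds_zero_of_lt_one (by simp))
        (Or.inr (by simp))
    rw [mul_zero] at ht1 ht2
    obtain ⟨q, hq⟩ := exists_nat_ge t
    obtain ⟨j, hj1, hj2, hj3, hj4⟩ := ((ht1.eventually_lt_const (half_pos hε)).and
      ((ht2.eventually_le_const (ENNReal.half_pos hδ.ne')).and
        ((eventually_ge_atTop q).and (eventually_ge_atTop N)))).exists
    filter_upwards [eventually_ge_atTop N] with n hn
    have e : Z n - X = (Z n - Z (φ j)) + (Z (φ j) - X) := by abel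
    rw [e, ← add_halves ε, ← ENNReal.add_halves δ]
    exact (measure_exceed_add_le _ _ t _ _).trans (add_le_add
      (hN n hn _ (hj4.trans (hφ.id_le j)))
      ((hsub j (hq.trans (by exact_mod_cast hj3)) hj1).trans hj2))

end Completeness

/-! ### Good integrators -/

section GoodIntegrator

variable {Ω : Type*} {mΩ : MeasurableSpace Ω} {𝓕 : Filtration ℝ≥0 mΩ} {μ : Measure Ω}
  {H K X Y I : ℝ≥0 → Ω → ℝ}

/-- `X` is a good integrator if elementary integrals against `X` are uniformly small, up to small
probability, when the integrand is uniformly small up to small probability. -/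
def IsGoodIntegrator (𝓕 : Filtration ℝ≥0 mΩ) (μ : Measure Ω) (X : ℝ≥0 → Ω → ℝ) : Prop :=
  ∀ (t : ℝ≥0) (ε : ℝ), 0 < ε → ∀ δ : ℝ≥0∞, 0 < δ → ∃ η : ℝ, 0 < η ∧
    ∀ π, IsPartition π → ∀ H, StronglyAdapted 𝓕 H →
      μ (exceed (leftSum π H X) t ε) ≤ δ + μ (exceed H t η)

/-- `I` is the ucp limit of the left-point Riemann sums of `H` against `X`. -/
def IsRiemannLimit (μ : Measure Ω) (H X I : ℝ≥0 → Ω → ℝ) : Prop :=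
  ∀ π, IsPartitionSeq π → TendstoUCP μ (fun n => leftSum (π n) H X) I

lemma indist_leftSum {H' X' : ℝ≥0 → Ω → ℝ} (hH : Indist μ H H') (hX : Indist μ X X')
    (π : ℕ → ℝ≥0) : Indist μ (leftSum π H X) (leftSum π H' X') := by
  filter_upwards [hH, hX] with ω h1 h2 t using leftSum_congr_path h1 h2

lemma IsGoodIntegrator.congr (hX : IsGoodIntegrator 𝓕 μ X) (h : Indist μ X Y) :
    IsGoodIntegrator 𝓕 μ Y := by
  intro t ε hε δ hδ
  obtain ⟨η, hη, hX⟩ := hX t ε hε δ hδ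
  refine ⟨η, hη, fun π hπ H hH => ?_⟩
  rw [← measure_exceed_congr (indist_leftSum (Indist.refl H) h π)]
  exact hX π hπ H hH

/-- It suffices to test with integrands that are bounded everywhere: truncating an integrand at the
level `η` changes the integral only on the event that the integrand exceeds `η`. -/
lemma IsGoodIntegrator.of_bounded
    (h : ∀ (t : ℝ≥0) (ε : ℝ), 0 < ε → ∀ δ : ℝ≥0∞, 0 < δ → ∃ η : ℝ, 0 < η ∧
      ∀ π, IsPartition π → ∀ H, StronglyAdapted 𝓕 H → (∀ s ω, |H s ω| ≤ η) →
        μ (exceed (leftSum π H X) t ε) ≤ δ) : IsGoodIntegrator 𝓕 μ X := by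
  intro t ε hε δ hδ
  obtain ⟨η, hη, h⟩ := h t ε hε δ hδ
  refine ⟨η, hη, fun π hπ H hH => ?_⟩
  let H' : ℝ≥0 → Ω → ℝ := fun s ω => if |H s ω| < η then H s ω else 0
  have hH' : StronglyAdapted 𝓕 H' := fun s =>
    (hH s).ite ((hH s).norm.measurableSet_lt stronglyMeasurable_const) stronglyMeasurable_const
  have hb : ∀ s ω, |H' s ω| ≤ η := fun s ω => by
    simp only [H']
    split_ifs with h1
    · exact h1.le
    · simpa using hη.le
  have hsub : exceed (leftSum π H X) t ε ⊆ exceed (leftSum π H' X) t ε ∪ exceed H t η := by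
    rintro ω ⟨s, hs, h⟩
    by_contra hc
    simp only [Set.mem_union, not_or] at hc
    refine hc.1 ⟨s, hs, ?_⟩
    have : leftSum π H' X s ω = leftSum π H X s ω := by
      obtain ⟨n, hn⟩ := hπ.exists_ge s
      rw [leftSum_eq_sum hπ hn, leftSum_eq_sum hπ hn]
      refine Finset.sum_congr rfl fun k _ => ?_
      rcases le_total s (π k) with hk | hk
      · simp [increment_eq_zero hπ hk]
      · have : |H (π k) ω| < η := by
          by_contra hcc
          exact hc.2 ⟨π k, hk.trans hs, not_lt.1 hcc⟩
        simp only [H', this, if_true]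
    rwa [this]
  refine (measure_mono hsub).trans ((measure_union_le _ _).trans ?_)
  gcongr
  exact h π hπ H' hH' hb

lemma IsGoodIntegrator.exists_bounded (hX : IsGoodIntegrator 𝓕 μ X) (t : ℝ≥0) {ε : ℝ} (hε : 0 < ε)
    {δ : ℝ≥0∞} (hδ : 0 < δ) : ∃ η : ℝ, 0 < η ∧
      ∀ π, IsPartition π → ∀ H, StronglyAdapted 𝓕 H → (∀ s ω, |H s ω| ≤ η) →
        μ (exceed (leftSum π H X) t ε) ≤ δ := by
  obtain ⟨η, hη, h⟩ := hX t ε hε δ hδ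
  refine ⟨η / 2, half_pos hη, fun π hπ H hH hb => ?_⟩
  have : exceed H t η = ∅ := by
    refine Set.eq_empty_of_forall_notMem fun ω ⟨s, _, h⟩ => ?_
    linarith [hb s ω]
  simpa [this] using h π hπ H hH

lemma IsGoodIntegrator.add (hX : IsGoodIntegrator 𝓕 μ X) (hY : IsGoodIntegrator 𝓕 μ Y) :
    IsGoodIntegrator 𝓕 μ (X + Y) := by
  refine IsGoodIntegrator.of_bounded fun t ε hε δ hδ => ?_
  have hδ' : 0 < δ / 2 := ENNReal.half_pos hδ.ne'
  obtain ⟨η, hη, hX⟩ := hX.exists_bounded t (half_pos hε) hδ'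
  obtain ⟨η', hη', hY⟩ := hY.exists_bounded t (half_pos hε) hδ'
  refine ⟨min η η', lt_min hη hη', fun π hπ H hH hb => ?_⟩
  rw [← add_halves ε, leftSum_add_right hπ, ← ENNReal.add_halves δ]
  exact (measure_exceed_add_le _ _ t _ _).trans (add_le_add
    (hX π hπ H hH fun s ω => (hb s ω).trans (min_le_left _ _))
    (hY π hπ H hH fun s ω => (hb s ω).trans (min_le_right _ _)))

/-- Being a good integrator is a local property. -/
lemma IsGoodIntegrator.of_local
    (h : ∀ (t : ℝ≥0) (δ : ℝ≥0∞), 0 < δ → ∃ X', IsGoodIntegrator 𝓕 μ X' ∧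
      μ {ω | ∃ s ≤ t, X s ω ≠ X' s ω} ≤ δ) : IsGoodIntegrator 𝓕 μ X := by
  intro t ε hε δ hδ
  have hδ' : 0 < δ / 2 := ENNReal.half_pos hδ.ne'
  obtain ⟨X', hX', hμ⟩ := h t (δ / 2) hδ'
  obtain ⟨η, hη, hX'⟩ := hX' t ε hε (δ / 2) hδ'
  refine ⟨η, hη, fun π hπ H hH => ?_⟩
  have hsub : exceed (leftSum π H X) t ε ⊆
      {ω | ∃ s ≤ t, X s ω ≠ X' s ω} ∪ exceed (leftSum π H X') t ε := by
    rintro ω ⟨s, hs, hω⟩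
    by_contra hc
    simp only [Set.mem_union, not_or, Set.mem_ofPred_eq, not_exists, not_and, not_not] at hc
    refine hc.2 ⟨s, hs, ?_⟩
    have : leftSum π H X' s ω = leftSum π H X s ω := by
      unfold leftSum
      refine tsum_congr fun k => ?_
      rw [hc.1 _ ((min_le_right _ _).trans hs), hc.1 _ ((min_le_right _ _).trans hs)]
    rwa [this]
  refine (measure_mono hsub).trans ((measure_union_le _ _).trans ?_)
  calc _ ≤ δ / 2 + (δ / 2 + μ (exceed H t η)) := add_le_add hμ (hX' π hπ H hH)
    _ = _ := by rw [← add_assoc, ENNReal.add_halves]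

lemma exceed_mul_subset (X Y : ℝ≥0 → Ω → ℝ) (t : ℝ≥0) (a b : ℝ) :
    exceed (X * Y) t (a * b) ⊆ exceed X t a ∪ exceed Y t b := by
  rintro ω ⟨s, hs, h⟩
  by_contra hc
  simp only [exceed, Set.mem_union, Set.mem_ofPred_eq, not_or, not_exists, not_and, not_le] at hc
  have h1 := hc.1 s hs
  have h2 := hc.2 s hs
  rw [Pi.mul_apply, Pi.mul_apply, abs_mul] at h
  have := mul_lt_mul'' h1 h2 (abs_nonneg _) (abs_nonneg _)
  linarith

lemma measure_exceed_mul_le (X Y : ℝ≥0 → Ω → ℝ) (t : ℝ≥0) (a b : ℝ) :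
    μ (exceed (X * Y) t (a * b)) ≤ μ (exceed X t a) + μ (exceed Y t b) :=
  (measure_mono (exceed_mul_subset X Y t a b)).trans (measure_union_le _ _)

lemma exceed_stepProcess_subset {π : ℕ → ℝ≥0} (hπ : IsPartition π) (t : ℝ≥0) (a : ℝ) :
    exceed (stepProcess π H) t a ⊆ exceed H t a :=
  fun _ ⟨s, hs, h⟩ => ⟨_, (leftPoint_le hπ s).trans hs, h⟩

/-- Riemann sums along two families of fine partitions are close to each other. -/
lemma IsGoodIntegrator.leftSum_close [IsFiniteMeasure μ] [ContainsNullSets 𝓕 μ]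
    (hX : IsGoodIntegrator 𝓕 μ X) (hH : IsContAdapted 𝓕 μ H) {π ρ : ℕ → ℕ → ℝ≥0}
    (hπ : IsPartitionSeq π) (hρ : IsPartitionSeq ρ) (t : ℝ≥0) {ε : ℝ} (hε : 0 < ε) {δ : ℝ≥0∞}
    (hδ : 0 < δ) :
    ∃ N, ∀ n ≥ N, ∀ m ≥ N, μ (exceed (leftSum (π n) H X - leftSum (ρ m) H X) t ε) ≤ δ := by
  have hδ' : 0 < δ / 2 := ENNReal.half_pos hδ.ne'
  obtain ⟨η, hη, hX⟩ := hX t ε hε (δ / 2) hδ'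
  obtain ⟨N, hN⟩ := eventually_atTop.1 (((hH.tendstoUCP_stepProcess hπ).exists_le t (half_pos hη)
    (ENNReal.half_pos hδ'.ne')).and ((hH.tendstoUCP_stepProcess hρ).exists_le t (half_pos hη)
    (ENNReal.half_pos hδ'.ne')))
  refine ⟨N, fun n hn m hm => ?_⟩
  obtain ⟨σ, hσ, h1, h2⟩ := exists_common_refinement (Ω := Ω) (hπ.isPartition n) (hρ.isPartition m)
  rw [h1, h2, ← leftSum_sub_left hσ]
  refine (hX σ hσ (_ - _) fun s => (stronglyAdapted_stepProcess (hπ.isPartition n) hH.adapted s).sub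
    (stronglyAdapted_stepProcess (hρ.isPartition m) hH.adapted s)).trans ?_
  have e : stepProcess (π n) H - stepProcess (ρ m) H =
    (stepProcess (π n) H - H) - (stepProcess (ρ m) H - H) := by abel
  rw [e]
  nth_rw 2 [← ENNReal.add_halves δ]
  gcongr
  rw [← add_halves η]
  refine (measure_exceed_sub_le _ _ t _ _).trans ?_
  rw [← ENNReal.add_halves (δ / 2)]
  exact add_le_add (hN n hn).1 (hN m hm).2

/-- A continuous adapted process can be integrated against a good integrator. -/
theorem IsGoodIntegrator.exists_integral [IsFiniteMeasure μ] [ContainsNullSets 𝓕 μ]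
    (hX : IsGoodIntegrator 𝓕 μ X) (hXc : IsContAdapted 𝓕 μ X) (hH : IsContAdapted 𝓕 μ H) :
    ∃ I, StronglyAdapted 𝓕 I ∧ (∀ ω, Continuous fun t => I t ω) ∧ IsRiemannLimit μ H X I := by
  obtain ⟨I, hI, hIc, h⟩ := exists_tendstoUCP (𝓕 := 𝓕) (μ := μ)
    (Z := fun n => leftSum (dyadic n) H X)
    (fun n => ⟨stronglyAdapted_leftSum (isPartitionSeq_dyadic.isPartition n) hH.adapted hXc.adapted,
      by filter_upwards [hXc.continuous] with ω hω using
        continuous_leftSum (isPartitionSeq_dyadic.isPartition n) hω⟩)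
    fun t ε hε δ hδ => hX.leftSum_close hH isPartitionSeq_dyadic isPartitionSeq_dyadic t hε hδ
  refine ⟨I, hI, hIc, fun π hπ => TendstoUCP.of_le fun t ε hε δ hδ => ?_⟩
  have hδ' : 0 < δ / 2 := ENNReal.half_pos hδ.ne'
  obtain ⟨N, hN⟩ := hX.leftSum_close hH hπ isPartitionSeq_dyadic t (half_pos hε) hδ'
  obtain ⟨m, hm, hm'⟩ := ((eventually_ge_atTop N).and (h.exists_le t (half_pos hε) hδ')).exists
  filter_upwards [eventually_ge_atTop N] with n hn
  have e : leftSum (π n) H X - I =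
    (leftSum (π n) H X - leftSum (dyadic m) H X) + (leftSum (dyadic m) H X - I) := by abel
  rw [e, ← add_halves ε, ← ENNReal.add_halves δ]
  exact (measure_exceed_add_le _ _ t _ _).trans (add_le_add (hN n hn m hm) hm')

namespace IsRiemannLimit

lemma congr {H' X' I' : ℝ≥0 → Ω → ℝ} (h : IsRiemannLimit μ H X I) (hH : Indist μ H H')
    (hX : Indist μ X X') (hI : Indist μ I I') : IsRiemannLimit μ H' X' I' :=
  fun π hπ => (h π hπ).congr (fun _ => indist_leftSum hH hX _) hI

lemma unique {I' : ℝ≥0 → Ω → ℝ} (h : IsRiemannLimit μ H X I) (h' : IsRiemannLimit μ H X I') :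
    Indist μ I I' :=
  (h _ isPartitionSeq_dyadic).unique (h' _ isPartitionSeq_dyadic)

lemma add_left {I' : ℝ≥0 → Ω → ℝ} (h : IsRiemannLimit μ H X I) (h' : IsRiemannLimit μ K X I') :
    IsRiemannLimit μ (H + K) X (I + I') := fun π hπ => by
  simpa only [leftSum_add_left (hπ.isPartition _)] using (h π hπ).add (h' π hπ)

lemma add_right {I' : ℝ≥0 → Ω → ℝ} (h : IsRiemannLimit μ H X I) (h' : IsRiemannLimit μ H Y I') :
    IsRiemannLimit μ H (X + Y) (I + I') := fun π hπ => by
  simpa only [leftSum_add_right (hπ.isPartition _)] using (h π hπ).add (h' π hπ)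

lemma leftSum_smul_left (π : ℕ → ℝ≥0) (c : ℝ) : leftSum π (c • H) X = c • leftSum π H X := by
  funext t ω
  simp only [leftSum, Pi.smul_apply, smul_eq_mul, ← tsum_mul_left]
  exact tsum_congr fun _ => by ring

lemma smul_left (c : ℝ) (h : IsRiemannLimit μ H X I) : IsRiemannLimit μ (c • H) X (c • I) :=
  fun π hπ => by simpa only [leftSum_smul_left] using (h π hπ).smul c

lemma one (X : ℝ≥0 → Ω → ℝ) : IsRiemannLimit μ 1 X (fun t ω => X t ω - X 0 ω) := fun π hπ => by
  have : ∀ n, leftSum (π n) 1 X = fun t ω => X t ω - X 0 ω :=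
    fun n => by funext t ω; exact leftSum_one (hπ.isPartition n)
  simp only [this]
  exact TendstoUCP.const _

lemma null_zero (h : IsRiemannLimit μ H X I) : ∀ᵐ ω ∂μ, I 0 ω = 0 := by
  obtain ⟨φ, _, h⟩ := (h _ isPartitionSeq_dyadic).exists_subseq
  filter_upwards [h] with ω hω
  refine tendsto_nhds_unique (hω 0) ?_
  simp [leftSum_zero_time (isPartitionSeq_dyadic.isPartition _)]

end IsRiemannLimit

/-- Riemann sums along a fixed partition depend continuously on the integrator. -/
lemma TendstoUCP.leftSum_right [IsFiniteMeasure μ] [ContainsNullSets 𝓕 μ] {π : ℕ → ℝ≥0}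
    (hπ : IsPartition π) (hH : IsContAdapted 𝓕 μ H) {Z : ℕ → ℝ≥0 → Ω → ℝ}
    (h : TendstoUCP μ Z X) : TendstoUCP μ (fun m => leftSum π H (Z m)) (leftSum π H X) := by
  refine TendstoUCP.of_le fun t ε hε δ hδ => ?_
  obtain ⟨K, hK, hKμ⟩ := hH.exists_bound t (ENNReal.half_pos hδ.ne')
  obtain ⟨n, hn⟩ := hπ.exists_ge t
  have hc : 0 < ε / (2 * (n + 1) * K) := by positivity
  filter_upwards [h.exists_le t hc (ENNReal.half_pos hδ.ne')] with m hm
  rw [← ENNReal.add_halves δ]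
  refine le_trans ((measure_mono ?_).trans (measure_union_le _ _)) (add_le_add hKμ hm)
  rintro ω ⟨s, hs, hω⟩
  by_contra hcon
  simp only [exceed, Set.mem_union, Set.mem_ofPred_eq, not_or, not_exists, not_and, not_le] at hcon
  rw [← leftSum_sub_right hπ, leftSum_eq_sum hπ (hs.trans hn)] at hω
  have hterm : ∀ k ∈ Finset.range n, |H (π k) ω * increment π (Z m - X) s ω k| ≤
      K * (2 * (ε / (2 * (n + 1) * K))) := by
    intro k _
    rcases le_total s (π k) with hk | hk
    · rw [increment_eq_zero hπ hk, mul_zero, abs_zero]; positivity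
    · rw [abs_mul]
      refine mul_le_mul (hcon.1 _ (hk.trans hs)).le ?_ (abs_nonneg _) hK.le
      have h1 := hcon.2 _ ((min_le_right (π (k + 1)) s).trans hs)
      have h2 := hcon.2 _ ((min_le_right (π k) s).trans hs)
      have h3 := abs_sub ((Z m - X) (min (π (k + 1)) s) ω) ((Z m - X) (min (π k) s) ω)
      rw [increment]
      linarith
  have h4 := (Finset.abs_sum_le_sum_abs _ _).trans (Finset.sum_le_sum hterm)
  have h5 : ∑ _k ∈ Finset.range n, K * (2 * (ε / (2 * (n + 1) * K))) = n * (ε / (n + 1)) := by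
    rw [Finset.sum_const, Finset.card_range, nsmul_eq_mul]
    field_simp
  have h6 : n * (ε / (n + 1)) < ε := by
    rw [← mul_div_assoc, div_lt_iff₀ (by positivity)]
    linarith
  linarith

/-- Associativity of the integral: Riemann sums against `∫ H dX` have the same limit as the Riemann
sums of the product integrand against `X`. -/
theorem IsGoodIntegrator.assoc [IsFiniteMeasure μ] [ContainsNullSets 𝓕 μ]
    (hX : IsGoodIntegrator 𝓕 μ X) (hH : IsContAdapted 𝓕 μ H) (hK : IsContAdapted 𝓕 μ K)
    (hI : IsRiemannLimit μ H X I) {π : ℕ → ℕ → ℝ≥0} (hπ : IsPartitionSeq π) :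
    TendstoUCP μ (fun n => leftSum (π n) K I - leftSum (π n) (K * H) X) 0 := by
  refine TendstoUCP.of_le fun t ε hε δ hδ => ?_
  have hδ1 : 0 < δ / 2 := ENNReal.half_pos hδ.ne'
  have hδ2 : 0 < δ / 2 / 2 := ENNReal.half_pos hδ1.ne'
  have hδ3 : 0 < δ / 2 / 2 / 2 := ENNReal.half_pos hδ2.ne'
  have hδ4 : 0 < δ / 2 / 2 / 2 / 2 := ENNReal.half_pos hδ3.ne'
  obtain ⟨η, hη, hX⟩ := hX t (ε / 2) (half_pos hε) (δ / 2 / 2) hδ2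
  obtain ⟨C, hC, hCμ⟩ := hK.exists_bound t hδ3
  have hη' : 0 < η / C / 2 := by positivity
  have hH1 := (hH.tendstoUCP_stepProcess hπ).exists_le t hη' hδ4
  have hH2 := (hH.tendstoUCP_stepProcess isPartitionSeq_dyadic).exists_le t hη' hδ4
  filter_upwards [hH1] with n hn
  have hP := hπ.isPartition n
  obtain ⟨m, hm, hm'⟩ := (hH2.and (((hI _ isPartitionSeq_dyadic).leftSum_right (𝓕 := 𝓕)
    hP hK).exists_le t (half_pos hε) hδ1)).exists
  have hD := isPartitionSeq_dyadic.isPartition m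
  obtain ⟨σ, hσ, h1, h2⟩ := exists_common_refinement (Ω := Ω) hP hD
  have e1 : leftSum (π n) K (leftSum (dyadic m) H X) - leftSum (π n) (K * H) X =
      leftSum σ (stepProcess (π n) K * (stepProcess (dyadic m) H - stepProcess (π n) H)) X := by
    rw [h1, h2, leftSum_leftSum hσ, h1, ← leftSum_sub_left hσ, mul_sub]
    rfl
  have e2 : leftSum (π n) K I - leftSum (π n) (K * H) X - 0 =
      (leftSum (π n) K (leftSum (dyadic m) H X) - leftSum (π n) (K * H) X) -
      (leftSum (π n) K (leftSum (dyadic m) H X) - leftSum (π n) K I) := by abel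
  have e3 : stepProcess (dyadic m) H - stepProcess (π n) H =
      (stepProcess (dyadic m) H - H) - (stepProcess (π n) H - H) := by abel
  rw [e2, ← add_halves ε, ← ENNReal.add_halves δ]
  refine (measure_exceed_sub_le _ _ t _ _).trans (add_le_add ?_ hm')
  rw [e1]
  refine (hX σ hσ (_ * (_ - _)) fun s => (stronglyAdapted_stepProcess hP hK.adapted s).mul
    ((stronglyAdapted_stepProcess hD hH.adapted s).sub
      (stronglyAdapted_stepProcess hP hH.adapted s))).trans ?_
  rw [← ENNReal.add_halves (δ / 2)]
  refine add_le_add (by rw [ENNReal.add_halves]) ?_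
  have e4 : η = C * (η / C / 2 + η / C / 2) := by field_simp; norm_num
  rw [e4, e3]
  refine (measure_exceed_mul_le _ _ t _ _).trans ?_
  rw [← ENNReal.add_halves (δ / 2 / 2)]
  refine add_le_add ((measure_mono (exceed_stepProcess_subset hP t C)).trans hCμ) ?_
  refine (measure_exceed_sub_le _ _ t _ _).trans ?_
  rw [← ENNReal.add_halves (δ / 2 / 2 / 2)]
  exact add_le_add hm hn

end GoodIntegrator

/-! ### Processes of finite variation as integrators -/

section FiniteVariation

variable {Ω : Type*} {mΩ : MeasurableSpace Ω} {𝓕 : Filtration ℝ≥0 mΩ} {μ : Measure Ω}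
  {H A : ℝ≥0 → Ω → ℝ}

lemma abs_leftSum_le_of_bounded {π : ℕ → ℝ≥0} (hπ : IsPartition π) {η : ℝ} {ω : Ω}
    (hb : ∀ s, |H s ω| ≤ η) (hA : LocallyBoundedVariationOn (fun t => A t ω) Set.univ)
    {s t : ℝ≥0} (hst : s ≤ t) :
    |leftSum π H A s ω| ≤ η * (eVariationOn (fun t => A t ω) (Set.Icc 0 t)).toReal := by
  have hη : 0 ≤ η := (abs_nonneg _).trans (hb 0)
  obtain ⟨n, hn⟩ := hπ.exists_ge s
  have hfin : eVariationOn (fun t => A t ω) (Set.Icc 0 t) ≠ ⊤ := by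
    have := hA 0 t trivial trivial
    rwa [Set.univ_inter] at this
  have hv : ∑ k ∈ Finset.range n, |increment π A s ω k| ≤
      (eVariationOn (fun t => A t ω) (Set.Icc 0 t)).toReal := by
    have := eVariationOn.sum_le (f := fun t => A t ω) (s := Set.Icc 0 t) (n := n)
      (u := fun k => min (π k) s)
      (fun i j hij => min_le_min_right _ (hπ.mono hij)) (fun i => ⟨zero_le, (min_le_right _ _).trans hst⟩)
    have h2 := ENNReal.toReal_mono hfin this
    rw [ENNReal.toReal_sum fun _ _ => edist_ne_top _ _] at h2
    refine le_trans (le_of_eq (Finset.sum_congr rfl fun k _ => ?_)) h2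
    rw [edist_dist, ENNReal.toReal_ofReal dist_nonneg, Real.dist_eq, increment]
  rw [leftSum_eq_sum hπ hn]
  calc _ ≤ ∑ k ∈ Finset.range n, |H (π k) ω * increment π A s ω k| := Finset.abs_sum_le_sum_abs _ _
    _ ≤ ∑ k ∈ Finset.range n, η * |increment π A s ω k| :=
        Finset.sum_le_sum fun k _ => by rw [abs_mul]; gcongr; exact hb _
    _ ≤ _ := by rw [← Finset.mul_sum]; gcongr

/-- Continuous adapted processes of finite variation are good integrators. -/
theorem isGoodIntegrator_of_finiteVariation [IsFiniteMeasure μ] [ContainsNullSets 𝓕 μ]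
    (hA : IsContAdapted 𝓕 μ A)
    (hv : ∀ᵐ ω ∂μ, LocallyBoundedVariationOn (fun t => A t ω) Set.univ) :
    IsGoodIntegrator 𝓕 μ A := by
  obtain ⟨A', hA', hc, hAA'⟩ := hA.exists_version
  refine IsGoodIntegrator.congr (X := A') ?_ hAA'.symm
  refine IsGoodIntegrator.of_bounded fun t ε hε δ hδ => ?_
  -- The running supremum of an elementary integral is measurable, the variation of `A` need not be,
  -- so the uniform bound is obtained by contradiction from almost sure convergence.
  by_contra! hcon
  choose π hπ H hH hb hμ using fun n : ℕ => hcon ((1 / 2) ^ n) (by positivity)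
  have ht : Tendsto (fun n => μ (exceed (leftSum (π n) (H n) A') t ε)) atTop (𝓝 (μ ∅)) := by
    refine tendsto_measure_of_ae_tendsto_indicator_of_isFiniteMeasure atTop MeasurableSet.empty
      (fun n => 𝓕.le t _ (measurableSet_exceed (stronglyAdapted_leftSum (hπ n) (hH n) hA')
        (fun ω => continuous_leftSum (hπ n) (hc ω)) t ε)) ?_
    filter_upwards [hv, hAA'] with ω hω hωA
    have hA1 : LocallyBoundedVariationOn (fun t => A' t ω) Set.univ := by
      simpa only [hωA] using hω
    let V := (eVariationOn (fun t => A' t ω) (Set.Icc 0 t)).toReal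
    have hlim : Tendsto (fun n : ℕ => (1 / 2 : ℝ) ^ n * V) atTop (𝓝 (0 * V)) :=
      (tendsto_pow_atTop_nhds_zero_of_lt_one (by norm_num) (by norm_num)).mul_const V
    rw [zero_mul] at hlim
    filter_upwards [hlim.eventually_lt_const hε] with n hn
    simp only [Set.mem_empty_iff_false, iff_false]
    rintro ⟨s, hs, h⟩
    exact absurd (abs_leftSum_le_of_bounded (hπ n) (fun s => hb n s ω) hA1 hs) (not_le.2 (hn.trans_le h))
  rw [measure_empty] at ht
  obtain ⟨n, hn⟩ := (ht.eventually_le_const hδ).exists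
  exact absurd hn (not_le.2 (hμ n))

end FiniteVariation

/-! ### Hitting times and optional stopping -/

section Stopping

variable {Ω : Type*} {mΩ : MeasurableSpace Ω} {𝓕 : Filtration ℝ≥0 mΩ} {μ : Measure Ω}
  {X Z M : ℝ≥0 → Ω → ℝ}

/-- The first time at which `|X|` reaches the level `a`. -/
def hittingTime (X : ℝ≥0 → Ω → ℝ) (a : ℝ) : Ω → WithTop ℝ≥0 := hittingAfter X {x | a ≤ |x|} 0

lemma hittingTime_le_iff {ω : Ω} (hc : Continuous fun t => X t ω) {a : ℝ} {t : ℝ≥0} :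
    hittingTime X a ω ≤ t ↔ ω ∈ exceed X t a := by
  constructor
  · intro h
    have hne : ∃ j, 0 ≤ j ∧ X j ω ∈ {x : ℝ | a ≤ |x|} := by
      by_contra hcon
      rw [hittingTime, hittingAfter, if_neg hcon] at h
      exact absurd (top_le_iff.1 h) WithTop.coe_ne_top
    rw [hittingTime, hittingAfter, if_pos hne, WithTop.coe_le_coe] at h
    have hcl : IsClosed {i : ℝ≥0 | 0 ≤ i ∧ X i ω ∈ {x : ℝ | a ≤ |x|}} :=
      (isClosed_le continuous_const continuous_id).inter
        (isClosed_le continuous_const (continuous_abs.comp hc))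
    have := hcl.csInf_mem hne (OrderBot.bddBelow _)
    exact ⟨_, h, this.2⟩
  · rintro ⟨s, hs, h⟩
    exact (hittingAfter_le_of_mem (zero_le : 0 ≤ s) h).trans (by exact_mod_cast hs)

lemma isStoppingTime_hittingTime (hX : StronglyAdapted 𝓕 X) (hc : ∀ ω, Continuous fun t => X t ω)
    (a : ℝ) : IsStoppingTime 𝓕 (hittingTime X a) := fun t => by
  have : {ω | hittingTime X a ω ≤ t} = exceed X t a := by
    ext ω; exact hittingTime_le_iff (hc ω)
  rw [this]
  exact measurableSet_exceed hX hc t a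

lemma isLocalizingSequence_hittingTime (hX : StronglyAdapted 𝓕 X)
    (hc : ∀ ω, Continuous fun t => X t ω) :
    IsLocalizingSequence 𝓕 (fun n : ℕ => hittingTime X n) μ where
  isStoppingTime n := isStoppingTime_hittingTime hX hc n
  tendsto_top := ae_of_all _ fun ω => (WithTop.tendsto_nhds_top_iff _).2 fun t => by
    obtain ⟨s, hs, hmax⟩ := (isCompact_Icc (a := (0 : ℝ≥0)) (b := t)).exists_isMaxOn
      ⟨0, by simp⟩ (continuous_abs.comp (hc ω)).continuousOn
    obtain ⟨m, hm⟩ := exists_nat_gt |X s ω|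
    filter_upwards [eventually_ge_atTop m] with n hn
    by_contra hcon
    obtain ⟨u, hu, h⟩ := (hittingTime_le_iff (hc ω)).1 (not_lt.1 hcon)
    have h1 : |X u ω| ≤ |X s ω| := hmax ⟨zero_le, hu⟩
    have h2 : (m : ℝ) ≤ n := by exact_mod_cast hn
    linarith
  mono := ae_of_all _ fun ω m n hmn =>
    hittingAfter_anti X 0 (fun x (hx : (n : ℝ) ≤ |x|) => le_trans (by exact_mod_cast hmn) hx) ω

/-- A continuous path started at `0` and dominated by `Z` is bounded by `a` up to and including the
time when `Z` reaches `a`. -/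
lemma abs_le_of_le_hittingTime {ω : Ω} (hc : Continuous fun t => X t ω) (h0 : X 0 ω = 0)
    (hXZ : ∀ s, |X s ω| ≤ |Z s ω|) {a : ℝ} (ha : 0 ≤ a) {t : ℝ≥0} (ht : t ≤ hittingTime Z a ω) :
    |X t ω| ≤ a := by
  have hlt : ∀ s < t, |X s ω| ≤ a := by
    intro s hs
    by_contra hcon
    have : hittingTime Z a ω ≤ s :=
      hittingAfter_le_of_mem (zero_le : 0 ≤ s) (((not_le.1 hcon).le.trans (hXZ s)) : a ≤ |Z s ω|)
    exact absurd (ht.trans this) (not_le.2 (by exact_mod_cast hs))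
  rcases eq_or_ne t 0 with rfl | h
  · simpa [h0] using ha
  · have hcl : IsClosed {s | |X s ω| ≤ a} := isClosed_le (continuous_abs.comp hc) continuous_const
    have hne : (Set.Iio t).Nonempty := ⟨0, pos_iff_ne_zero.2 h⟩
    have : t ∈ closure (Set.Iio t) := by rw [closure_Iio' hne]; exact Set.mem_Iic.2 le_rfl
    exact hcl.closure_subset_iff.2 (fun s hs => hlt s hs) this

lemma martingale_of_setIntegral_eq [IsFiniteMeasure μ] (hX : StronglyAdapted 𝓕 X)
    (hi : ∀ t, Integrable (X t) μ)
    (h : ∀ s t, s ≤ t → ∀ F, MeasurableSet[𝓕 s] F → ∫ ω in F, X s ω ∂μ = ∫ ω in F, X t ω ∂μ) :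
    Martingale X 𝓕 μ := by
  refine martingale_iff.2 ⟨?_, submartingale_of_setIntegral_le hX hi fun s t hst F hF => (h s t hst F hF).le⟩
  have := (submartingale_of_setIntegral_le (f := -X) (fun t => (hX t).neg) (fun t => (hi t).neg)
    fun s t hst F hF => by simp [integral_neg, h s t hst F hF] : Submartingale (-X) 𝓕 μ).neg
  simpa using this

/-- Optional sampling at a bounded stopping time for a continuous martingale: the stopping time is
approximated from above by stopping times with values in a countable set. -/
lemma integrable_and_integral_sampled_eq [IsFiniteMeasure μ] (hM : Martingale M 𝓕 μ)
    (hc : ∀ ω, Continuous fun t => M t ω) {ρ : Ω → ℝ≥0} {t : ℝ≥0}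
    (hρ : IsStoppingTime 𝓕 fun ω => (ρ ω : WithTop ℝ≥0)) (hρt : ∀ ω, ρ ω ≤ t) :
    Integrable (fun ω => M (ρ ω) ω) μ ∧ ∫ ω, M (ρ ω) ω ∂μ = ∫ ω, M t ω ∂μ := by
  let ρn : ℕ → Ω → ℝ≥0 := fun n ω => min t ((⌊ρ ω * 2 ^ n⌋₊ + 1 : ℕ) / 2 ^ n)
  have hst : ∀ n, IsStoppingTime 𝓕 fun ω => (ρn n ω : WithTop ℝ≥0) := by
    intro n u
    rcases le_total t u with htu | hut
    · have : {ω | (ρn n ω : WithTop ℝ≥0) ≤ u} = Set.univ :=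
        Set.eq_univ_of_forall fun ω => WithTop.coe_le_coe.2 ((min_le_left _ _).trans htu)
      rw [this]; exact MeasurableSet.univ
    · rcases hut.eq_or_lt with rfl | hut
      · have : {ω | (ρn n ω : WithTop ℝ≥0) ≤ u} = Set.univ :=
          Set.eq_univ_of_forall fun ω => WithTop.coe_le_coe.2 (min_le_left _ _)
        rw [this]; exact MeasurableSet.univ
      have hv : ((⌊u * 2 ^ n⌋₊ : ℝ≥0) / 2 ^ n) ≤ u := by
        rw [div_le_iff₀ (by positivity)]; exact Nat.floor_le zero_le
      have : {ω | (ρn n ω : WithTop ℝ≥0) ≤ u} =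
          {ω | (ρ ω : WithTop ℝ≥0) < ((⌊u * 2 ^ n⌋₊ : ℝ≥0) / 2 ^ n : ℝ≥0)} := by
        ext ω
        simp only [Set.mem_ofPred_eq, WithTop.coe_le_coe, WithTop.coe_lt_coe, ρn]
        rw [min_le_iff, or_iff_right (not_le.2 hut), div_le_iff₀ (by positivity),
          lt_div_iff₀ (by positivity), ← Nat.le_floor_iff zero_le, Nat.succ_le_iff,
          Nat.floor_lt zero_le]
      rw [this]
      exact hρ.measurableSet_lt_le hv
  have hcount : ∀ n, (Set.range fun ω => (ρn n ω : WithTop ℝ≥0)).Countable := fun n =>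
    (Set.countable_range fun k : ℕ => ((min t ((k + 1 : ℕ) / 2 ^ n) : ℝ≥0) : WithTop ℝ≥0)).mono
      (by rintro _ ⟨ω, rfl⟩; exact ⟨⌊ρ ω * 2 ^ n⌋₊, rfl⟩)
  have hle : ∀ n ω, (ρn n ω : WithTop ℝ≥0) ≤ t := fun n ω => WithTop.coe_le_coe.2 (min_le_left _ _)
  have hsamp : ∀ n, (fun ω => M (ρn n ω) ω) =ᵐ[μ] μ[M t | (hst n).measurableSpace] := fun n =>
    hM.stoppedValue_ae_eq_condExp_of_le_const_of_countable_range (hst n) (hle n) (hcount n)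
  have hui := (hM.integrable t).uniformIntegrable_condExp
    (ℱ := fun n => (hst n).measurableSpace) fun n => (hst n).measurableSpace_le
  have hui' : UniformIntegrable (fun n ω => M (ρn n ω) ω) 1 μ :=
    hui.ae_eq fun n => (hsamp n).symm
  have hlim : ∀ ω, Tendsto (fun n => ρn n ω) atTop (𝓝 (ρ ω)) := by
    intro ω
    have h1 : Tendsto (fun n : ℕ => ρ ω + (1 / 2 : ℝ≥0) ^ n) atTop (𝓝 (ρ ω + 0)) :=
      tendsto_const_nhds.add (NNReal.tendsto_pow_atTop_nhds_zero_of_lt_one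
        (by rw [← NNReal.coe_lt_coe]; norm_num))
    rw [add_zero] at h1
    refine tendsto_of_tendsto_of_tendsto_of_le_of_le tendsto_const_nhds h1 (fun n => ?_) fun n => ?_
    · refine le_min (hρt ω) ((le_div_iff₀ (by positivity)).2 ?_)
      exact_mod_cast (Nat.lt_floor_add_one (ρ ω * 2 ^ n)).le
    · refine (min_le_right _ _).trans ?_
      rw [Nat.cast_succ, add_div, div_pow, one_pow]
      gcongr
      exact (div_le_iff₀ (by positivity)).2 (Nat.floor_le zero_le)
  have hlimM : ∀ᵐ ω ∂μ, Tendsto (fun n => M (ρn n ω) ω) atTop (𝓝 (M (ρ ω) ω)) :=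
    ae_of_all _ fun ω => ((hc ω).tendsto _).comp (hlim ω)
  have hmem : MemLp (fun ω => M (ρ ω) ω) 1 μ := hui'.memLp_of_ae_tendsto hlimM
  have hint := memLp_one_iff_integrable.1 hmem
  refine ⟨hint, ?_⟩
  have h1 := tendsto_Lp_finite_of_tendsto_ae le_rfl ENNReal.one_ne_top hui'.1 hmem hui'.2.1 hlimM
  have h2 := tendsto_integral_of_L1' _ hmem.1
    (Eventually.of_forall fun n => memLp_one_iff_integrable.1 (hui'.memLp n)) h1
  have h3 : ∀ n, ∫ ω, M (ρn n ω) ω ∂μ = ∫ ω, M t ω ∂μ := fun n => by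
    rw [integral_congr_ae (hsamp n), integral_condExp]
  simp only [h3] at h2
  exact tendsto_nhds_unique h2 tendsto_const_nhds

lemma coe_untopA {a : WithTop ℝ≥0} (ha : a ≠ ⊤) : ((a.untopA : ℝ≥0) : WithTop ℝ≥0) = a := by
  rw [WithTop.untopA_eq_untop ha, WithTop.coe_untop]

/-- Optional stopping: a continuous martingale stopped at a stopping time is a martingale. -/
theorem martingale_stoppedProcess [IsFiniteMeasure μ] (hM : Martingale M 𝓕 μ)
    (hc : ∀ ω, Continuous fun t => M t ω) {τ : Ω → WithTop ℝ≥0} (hτ : IsStoppingTime 𝓕 τ) :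
    Martingale (stoppedProcess M τ) 𝓕 μ := by
  have hcoe : ∀ (t : ℝ≥0) ω, (((min (t : WithTop ℝ≥0) (τ ω)).untopA : ℝ≥0) : WithTop ℝ≥0) =
      min (t : WithTop ℝ≥0) (τ ω) := fun t ω =>
    coe_untopA (ne_top_of_le_ne_top WithTop.coe_ne_top (min_le_left _ _))
  have hle : ∀ (t : ℝ≥0) ω, (min (t : WithTop ℝ≥0) (τ ω)).untopA ≤ t := fun t ω => by
    rw [← WithTop.coe_le_coe, hcoe]; exact min_le_left _ _
  have hst : ∀ t : ℝ≥0, IsStoppingTime 𝓕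
      fun ω => (((min (t : WithTop ℝ≥0) (τ ω)).untopA : ℝ≥0) : WithTop ℝ≥0) := fun t => by
    simp only [hcoe]
    exact (isStoppingTime_const 𝓕 t).min hτ
  have hint : ∀ t, Integrable (stoppedProcess M τ t) μ := fun t =>
    (integrable_and_integral_sampled_eq hM hc (hst t) (hle t)).1
  refine martingale_of_setIntegral_eq (IsStronglyProgressive.stronglyAdapted_stoppedProcess
    (StronglyAdapted.isStronglyProgressive_of_continuous hM.stronglyAdapted hc) hτ) hint fun s t hs F hF => ?_
  classical
  -- For `F ∈ 𝓕 s`, the time equal to `κ` on `F` and to `t` off `F` is a stopping time; sampling `M`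
  -- there gives the martingale property on `F`.
  let κ : Ω → ℝ≥0 := fun ω => max s (min (t : WithTop ℝ≥0) (τ ω)).untopA
  have hκ : IsStoppingTime 𝓕 fun ω => (κ ω : WithTop ℝ≥0) := by
    simp only [κ, WithTop.coe_max]
    exact (isStoppingTime_const 𝓕 s).max (hst t)
  have hκt : ∀ ω, κ ω ≤ t := fun ω => max_le hs (hle t ω)
  let ρ : Ω → ℝ≥0 := F.piecewise κ fun _ => t
  have hρ : IsStoppingTime 𝓕 fun ω => (ρ ω : WithTop ℝ≥0) := by
    have := IsStoppingTime.piecewise_of_le (s := F) (i := s) hκ (isStoppingTime_const 𝓕 t)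
      (fun ω => by exact_mod_cast le_max_left _ _) (fun ω => by exact_mod_cast hs) hF
    convert this using 1
    ext1 ω
    by_cases hω : ω ∈ F <;> simp [ρ, Set.piecewise, hω] <;> rfl
  have hρt : ∀ ω, ρ ω ≤ t := fun ω => by
    by_cases hω : ω ∈ F
    · simpa [ρ, hω] using hκt ω
    · simp [ρ, hω]
  have hFm := 𝓕.le s _ hF
  obtain ⟨hi1, he1⟩ := integrable_and_integral_sampled_eq hM hc hρ hρt
  have hκi := (integrable_and_integral_sampled_eq hM hc hκ hκt).1
  have h1 : ∫ ω in F, M (κ ω) ω ∂μ = ∫ ω in F, M t ω ∂μ := by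
    rw [← integral_add_compl hFm hi1, ← integral_add_compl hFm (hM.integrable t)] at he1
    have e1 : ∫ ω in F, M (ρ ω) ω ∂μ = ∫ ω in F, M (κ ω) ω ∂μ :=
      setIntegral_congr_fun hFm fun ω hω => by simp [ρ, hω]
    have e2 : ∫ ω in Fᶜ, M (ρ ω) ω ∂μ = ∫ ω in Fᶜ, M t ω ∂μ :=
      setIntegral_congr_fun hFm.compl fun ω hω => by
        simp [ρ, Set.piecewise_eq_of_notMem _ _ _ hω]
    rw [e1, e2] at he1
    linarith
  have h2 : ∫ ω in F, (stoppedProcess M τ t ω - stoppedProcess M τ s ω) ∂μ =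
      ∫ ω in F, (M (κ ω) ω - M s ω) ∂μ := by
    refine setIntegral_congr_fun hFm fun ω _ => ?_
    simp only [stoppedProcess, κ]
    rcases le_total (τ ω) s with h | h
    · have h' : τ ω ≤ t := h.trans (by exact_mod_cast hs)
      have hne : τ ω ≠ ⊤ := ne_top_of_le_ne_top WithTop.coe_ne_top h
      rw [min_eq_right h, min_eq_right h']
      have : (τ ω).untopA ≤ s := by rwa [← WithTop.coe_le_coe, coe_untopA hne]
      rw [max_eq_left this, sub_self, sub_self]
    · have : s ≤ (min (t : WithTop ℝ≥0) (τ ω)).untopA := by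
        rw [← WithTop.coe_le_coe, hcoe]; exact le_min (by exact_mod_cast hs) h
      rw [max_eq_right this, min_eq_left h]
      rfl
  rw [integral_sub (hint t).integrableOn (hint s).integrableOn,
    integral_sub hκi.integrableOn (hM.integrable s).integrableOn, h1,
    hM.setIntegral_eq hs hF, sub_self] at h2
  linarith

end Stopping

/-! ### Integrals against continuous local martingales -/

section StoppedProcess

variable {Ω : Type*} {X H Z : ℝ≥0 → Ω → ℝ} {τ : Ω → WithTop ℝ≥0} {ω : Ω} {t : ℝ≥0}

lemma stoppedProcess_of_top (h : τ ω = ⊤) : stoppedProcess X τ t ω = X t ω := by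
  simp only [stoppedProcess, h, min_eq_left le_top]
  rfl

lemma stoppedProcess_of_coe {r : ℝ≥0} (h : τ ω = (r : WithTop ℝ≥0)) :
    stoppedProcess X τ t ω = X (min t r) ω := by
  simp only [stoppedProcess, h, ← WithTop.coe_min]
  rfl

lemma exists_stoppedProcess_eq (τ : Ω → WithTop ℝ≥0) (t : ℝ≥0) (ω : Ω) :
    ∃ s ≤ t, (s : WithTop ℝ≥0) ≤ τ ω ∧ ∀ X : ℝ≥0 → Ω → ℝ, stoppedProcess X τ t ω = X s ω := by
  rcases eq_or_ne (τ ω) ⊤ with h | h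
  · exact ⟨t, le_rfl, h ▸ le_top, fun X => stoppedProcess_of_top h⟩
  · obtain ⟨r, hr⟩ := WithTop.ne_top_iff_exists.1 h
    exact ⟨min t r, min_le_left _ _, hr ▸ WithTop.coe_le_coe.2 (min_le_right _ _),
      fun X => stoppedProcess_of_coe hr.symm⟩

lemma leftSum_stoppedProcess (π : ℕ → ℝ≥0) (H X : ℝ≥0 → Ω → ℝ) (τ : Ω → WithTop ℝ≥0) :
    leftSum π H (stoppedProcess X τ) = stoppedProcess (leftSum π H X) τ := by
  funext t ω
  rcases eq_or_ne (τ ω) ⊤ with h | h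
  · rw [stoppedProcess_of_top h]
    exact leftSum_congr_path (fun _ => rfl) fun s => stoppedProcess_of_top h
  · obtain ⟨r, hr⟩ := WithTop.ne_top_iff_exists.1 h
    rw [stoppedProcess_of_coe hr.symm, leftSum_stopped]
    exact leftSum_congr_path (fun _ => rfl) fun s => stoppedProcess_of_coe hr.symm

lemma continuous_stoppedProcess (hX : Continuous fun t => X t ω) :
    Continuous fun t => stoppedProcess X τ t ω := by
  rcases eq_or_ne (τ ω) ⊤ with h | h
  · simpa only [stoppedProcess_of_top h] using hX
  · obtain ⟨r, hr⟩ := WithTop.ne_top_iff_exists.1 h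
    simp only [stoppedProcess_of_coe hr.symm]
    exact hX.comp (continuous_id.min continuous_const)

end StoppedProcess

section MartingaleTransform

variable {Ω : Type*} {mΩ : MeasurableSpace Ω} {𝓕 : Filtration ℝ≥0 mΩ} {μ : Measure Ω}
  [IsFiniteMeasure μ] {H M : ℝ≥0 → Ω → ℝ} {π : ℕ → ℝ≥0} {C K : ℝ}

/-- The increments of a martingale are orthogonal to the past. -/
lemma integral_mul_increment_eq_zero (hM : Martingale M 𝓕 μ) {a b : ℝ≥0} (hab : a ≤ b) {ξ : Ω → ℝ}
    (hξ : StronglyMeasurable[𝓕 a] ξ) (hC : ∀ ω, |ξ ω| ≤ C) :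
    ∫ ω, ξ ω * (M b ω - M a ω) ∂μ = 0 := by
  have hi : Integrable (M b - M a) μ := (hM.integrable b).sub (hM.integrable a)
  have hi' : Integrable (ξ * (M b - M a)) μ :=
    hi.bdd_mul (hξ.mono (𝓕.le a)).aestronglyMeasurable (ae_of_all _ hC)
  have h0 : μ[M b - M a | 𝓕 a] =ᵐ[μ] 0 := by
    filter_upwards [condExp_sub (hM.integrable b) (hM.integrable a) (𝓕 a), hM.condExp_ae_eq hab,
      hM.condExp_ae_eq le_rfl] with ω h1 h2 h3
    rw [h1, Pi.sub_apply, h2, h3, sub_self, Pi.zero_apply]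
  have h1 : μ[ξ * (M b - M a) | 𝓕 a] =ᵐ[μ] 0 := by
    filter_upwards [condExp_mul_of_stronglyMeasurable_left hξ hi' hi, h0] with ω h1 h2
    rw [h1, Pi.mul_apply, h2, Pi.zero_apply, mul_zero]
  have h2 := integral_condExp (μ := μ) (f := ξ * (M b - M a)) (𝓕.le a)
  rw [integral_congr_ae h1] at h2
  simpa using h2.symm

lemma abs_leftSum_le (hπ : IsPartition π) (hK : ∀ t ω, |M t ω| ≤ K) (hC : ∀ t ω, |H t ω| ≤ C)
    (t : ℝ≥0) : ∃ B, ∀ ω, |leftSum π H M t ω| ≤ B := by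
  obtain ⟨n, hn⟩ := hπ.exists_ge t
  refine ⟨∑ _k ∈ Finset.range n, C * (K + K), fun ω => ?_⟩
  rw [leftSum_eq_sum hπ hn]
  refine (Finset.abs_sum_le_sum_abs _ _).trans (Finset.sum_le_sum fun k _ => ?_)
  rw [abs_mul]
  exact mul_le_mul (hC _ _) ((abs_sub _ _).trans (add_le_add (hK _ _) (hK _ _))) (abs_nonneg _)
    ((abs_nonneg _).trans (hC 0 ω))

lemma integrable_of_abs_le {f : Ω → ℝ} (hf : StronglyMeasurable f) {B : ℝ} (hB : ∀ ω, |f ω| ≤ B) :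
    Integrable f μ :=
  Integrable.of_bound hf.aestronglyMeasurable B (ae_of_all _ hB)

/-- The martingale transform: Riemann sums of bounded integrands against a bounded martingale are
martingales. -/
lemma martingale_leftSum (hπ : IsPartition π) (hM : Martingale M 𝓕 μ) (hK : ∀ t ω, |M t ω| ≤ K)
    (hH : StronglyAdapted 𝓕 H) (hC : ∀ t ω, |H t ω| ≤ C) : Martingale (leftSum π H M) 𝓕 μ := by
  have had := stronglyAdapted_leftSum hπ hH hM.stronglyAdapted
  have hint : ∀ t, Integrable (leftSum π H M t) μ := fun t => by
    obtain ⟨B, hB⟩ := abs_leftSum_le hπ hK hC t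
    exact integrable_of_abs_le ((had t).mono (𝓕.le t)) hB
  refine martingale_of_setIntegral_eq had hint fun s t hst F hF => ?_
  obtain ⟨n, hn⟩ := hπ.exists_ge t
  have hFm := 𝓕.le s _ hF
  rw [← sub_eq_zero, ← integral_sub (hint s).integrableOn (hint t).integrableOn]
  have hinc : ∀ (u : ℝ≥0) k, Integrable (fun ω => H (π k) ω * increment π M u ω k) μ := fun u k =>
    ((hM.integrable _).sub (hM.integrable _)).bdd_mul ((hH _).mono (𝓕.le _)).aestronglyMeasurable
      (ae_of_all _ (hC _))
  have e : ∀ ω, leftSum π H M s ω - leftSum π H M t ω = ∑ k ∈ Finset.range n,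
      (H (π k) ω * increment π M s ω k - H (π k) ω * increment π M t ω k) := fun ω => by
    rw [leftSum_eq_sum hπ hn, leftSum_eq_sum hπ (hst.trans hn), ← Finset.sum_sub_distrib]
  simp only [e]
  have hinc' : ∀ k, Integrable (fun ω => H (π k) ω * increment π M s ω k -
      H (π k) ω * increment π M t ω k) μ := fun k => (hinc s k).sub (hinc t k)
  rw [integral_finsetSum _ fun k _ => (hinc' k).integrableOn]
  refine Finset.sum_eq_zero fun k _ => ?_
  rw [← integral_indicator hFm]
  have hb : ∀ ω, |F.indicator (fun ω => -H (π k) ω) ω| ≤ C := fun ω => by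
    by_cases hω : ω ∈ F
    · simpa [hω] using hC (π k) ω
    · simpa [hω] using (abs_nonneg _).trans (hC 0 ω)
  -- In each case the difference is an increment of `M` times a variable known at its left end.
  rcases le_total (π (k + 1)) s with h1 | h1
  · have h2 := (hπ.mono k.le_succ).trans h1
    refine (integral_congr_ae (ae_of_all _ fun ω => ?_)).trans (integral_zero _ _)
    simp [increment, min_eq_left h1, min_eq_left h2, min_eq_left (h1.trans hst),
      min_eq_left (h2.trans hst)]
  rcases le_total (π k) s with h2 | h2
  · have hm : StronglyMeasurable[𝓕 s] (F.indicator fun ω => -H (π k) ω) :=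
      (((hH _).mono (𝓕.mono h2)).neg).indicator hF
    rw [← integral_mul_increment_eq_zero hM (le_min h1 hst) hm hb]
    refine integral_congr_ae (ae_of_all _ fun ω => ?_)
    by_cases hω : ω ∈ F
    · simp only [hω, Set.indicator_of_mem, increment, min_eq_right h1, min_eq_left h2,
        min_eq_left (h2.trans hst)]
      ring
    · simp [hω]
  rcases le_total t (π k) with h3 | h3
  · refine (integral_congr_ae (ae_of_all _ fun ω => ?_)).trans (integral_zero _ _)
    simp [increment_eq_zero hπ h2, increment_eq_zero hπ h3]
  · have hm : StronglyMeasurable[𝓕 (π k)] (F.indicator fun ω => -H (π k) ω) :=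
      (hH _).neg.indicator (𝓕.mono h2 _ hF)
    rw [← integral_mul_increment_eq_zero hM (le_min (hπ.mono k.le_succ) h3) hm hb]
    refine integral_congr_ae (ae_of_all _ fun ω => ?_)
    by_cases hω : ω ∈ F
    · simp only [Set.indicator_of_mem hω, increment_eq_zero hπ h2]
      simp only [increment, min_eq_left h3]
      ring
    · simp [hω]

/-- Second moment of an elementary integral against a bounded martingale: by orthogonality of the
increments it does not depend on the partition. -/
lemma integral_leftSum_sq_le (hπ : IsPartition π) (hM : Martingale M 𝓕 μ)
    (hK : ∀ t ω, |M t ω| ≤ K) (hH : StronglyAdapted 𝓕 H) (hC : ∀ t ω, |H t ω| ≤ C) (t : ℝ≥0) :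
    ∫ ω, leftSum π H M t ω ^ 2 ∂μ ≤ C ^ 2 * (μ.real Set.univ * K ^ 2) := by
  obtain ⟨N, hN⟩ := hπ.exists_ge t
  have hMm : ∀ u, StronglyMeasurable (M u) := fun u => (hM.stronglyAdapted u).mono (𝓕.le u)
  have hsq : ∀ u, Integrable (fun ω => M u ω ^ 2) μ := fun u =>
    integrable_of_abs_le ((hMm u).pow 2) (B := K ^ 2) fun ω => by
      rw [abs_pow]; exact pow_le_pow_left₀ (abs_nonneg _) (hK u ω) 2
  let S : ℕ → Ω → ℝ := fun n ω => ∑ k ∈ Finset.range n, H (π k) ω * increment π M t ω k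
  have hSb : ∀ n, ∃ B, ∀ ω, |S n ω| ≤ B := fun n => by
    refine ⟨∑ _k ∈ Finset.range n, C * (K + K), fun ω => ?_⟩
    refine (Finset.abs_sum_le_sum_abs _ _).trans (Finset.sum_le_sum fun k _ => ?_)
    rw [abs_mul]
    exact mul_le_mul (hC _ _) ((abs_sub _ _).trans (add_le_add (hK _ _) (hK _ _))) (abs_nonneg _)
      ((abs_nonneg _).trans (hC 0 ω))
  have hSm : ∀ n, StronglyMeasurable[𝓕 (π n)] (S n) := fun n => by
    refine Finset.stronglyMeasurable_fun_sum _ fun k hk => ?_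
    have hk := Finset.mem_range.1 hk
    exact ((hH _).mono (𝓕.mono (hπ.mono hk.le))).mul
      (((hM.stronglyAdapted _).mono (𝓕.mono ((min_le_left _ _).trans (hπ.mono (Nat.succ_le_of_lt hk))))).sub
        ((hM.stronglyAdapted _).mono (𝓕.mono ((min_le_left _ _).trans (hπ.mono hk.le)))))
  have key : ∀ n, ∫ ω, S n ω ^ 2 ∂μ ≤
      C ^ 2 * (∫ ω, M (min (π n) t) ω ^ 2 ∂μ - ∫ ω, M (min (π 0) t) ω ^ 2 ∂μ) := by
    intro n
    induction n with
    | zero => simp [S]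
    | succ n ih =>
      rcases le_total t (π n) with h | h
      · have e : S (n + 1) = S n := by
          funext ω; simp [S, Finset.sum_range_succ, increment_eq_zero hπ h]
        rw [e, min_eq_right (h.trans (hπ.mono n.le_succ))]
        rwa [min_eq_right h] at ih
      · let a := π n
        let b := min (π (n + 1)) t
        have hab : a ≤ b := le_min (hπ.mono n.le_succ) h
        have hinc : ∀ ω, increment π M t ω n = M b ω - M a ω := fun ω => by
          simp [increment, a, b, min_eq_left h]
        obtain ⟨B, hB⟩ := hSb n
        have hbd : ∀ ω, |M b ω - M a ω| ≤ K + K := fun ω =>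
          (abs_sub _ _).trans (add_le_add (hK _ _) (hK _ _))
        have z1 : ∫ ω, (S n ω * H a ω) * (M b ω - M a ω) ∂μ = 0 :=
          integral_mul_increment_eq_zero hM hab ((hSm n).mul (hH a)) (C := B * C) fun ω => by
            rw [abs_mul]; exact mul_le_mul (hB ω) (hC _ _) (abs_nonneg _) ((abs_nonneg _).trans (hB ω))
        have z2 : ∫ ω, M a ω * (M b ω - M a ω) ∂μ = 0 :=
          integral_mul_increment_eq_zero hM hab (hM.stronglyAdapted a) (hK a)
        have hSm' : StronglyMeasurable (S n) := (hSm n).mono (𝓕.le _)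
        have hHm' : StronglyMeasurable (H a) := (hH a).mono (𝓕.le _)
        have i1 : Integrable (fun ω => S n ω ^ 2) μ :=
          integrable_of_abs_le (hSm'.pow 2) (B := B ^ 2) fun ω => by
            rw [abs_pow]; exact pow_le_pow_left₀ (abs_nonneg _) (hB ω) 2
        have i2 : Integrable (fun ω => (S n ω * H a ω) * (M b ω - M a ω)) μ :=
          ((hM.integrable b).sub (hM.integrable a)).bdd_mul (c := B * C)
            (hSm'.mul hHm').aestronglyMeasurable (ae_of_all _ fun ω => by
              rw [Real.norm_eq_abs, abs_mul]
              exact mul_le_mul (hB ω) (hC _ _) (abs_nonneg _) ((abs_nonneg _).trans (hB ω)))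
        have i3 : Integrable (fun ω => (M b ω - M a ω) ^ 2) μ :=
          integrable_of_abs_le (((hMm b).sub (hMm a)).pow 2) (B := (K + K) ^ 2) fun ω => by
            rw [abs_pow]; exact pow_le_pow_left₀ (abs_nonneg _) (hbd ω) 2
        have i4 : Integrable (fun ω => H a ω ^ 2 * (M b ω - M a ω) ^ 2) μ :=
          i3.bdd_mul (c := C ^ 2) (hHm'.pow 2).aestronglyMeasurable (ae_of_all _ fun ω => by
            rw [Real.norm_eq_abs, abs_pow]; exact pow_le_pow_left₀ (abs_nonneg _) (hC _ ω) 2)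
        have i5 : Integrable (fun ω => M a ω * (M b ω - M a ω)) μ :=
          ((hM.integrable b).sub (hM.integrable a)).bdd_mul (c := K)
            (hMm a).aestronglyMeasurable (ae_of_all _ (hK a))
        have e1 : ∫ ω, S (n + 1) ω ^ 2 ∂μ =
            ∫ ω, S n ω ^ 2 ∂μ + ∫ ω, H a ω ^ 2 * (M b ω - M a ω) ^ 2 ∂μ := by
          have : ∀ ω, S (n + 1) ω ^ 2 = S n ω ^ 2 + 2 * ((S n ω * H a ω) * (M b ω - M a ω)) +
              H a ω ^ 2 * (M b ω - M a ω) ^ 2 := fun ω => by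
            simp only [S, Finset.sum_range_succ, hinc]
            ring
          have i12 : Integrable
              (fun ω => S n ω ^ 2 + 2 * ((S n ω * H a ω) * (M b ω - M a ω))) μ :=
            i1.add (i2.const_mul 2)
          simp only [this]
          rw [integral_add i12 i4, integral_add i1 (i2.const_mul 2),
            integral_const_mul, z1]
          ring
        have e2 : ∫ ω, (M b ω - M a ω) ^ 2 ∂μ = ∫ ω, M b ω ^ 2 ∂μ - ∫ ω, M a ω ^ 2 ∂μ := by
          have : ∀ ω, (M b ω - M a ω) ^ 2 =
              M b ω ^ 2 - M a ω ^ 2 - 2 * (M a ω * (M b ω - M a ω)) := fun ω => by ring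
          have i12 : Integrable (fun ω => M b ω ^ 2 - M a ω ^ 2) μ := (hsq b).sub (hsq a)
          simp only [this]
          rw [integral_sub i12 (i5.const_mul 2), integral_sub (hsq b) (hsq a),
            integral_const_mul, z2]
          ring
        have e3 : ∫ ω, H a ω ^ 2 * (M b ω - M a ω) ^ 2 ∂μ ≤
            C ^ 2 * ∫ ω, (M b ω - M a ω) ^ 2 ∂μ := by
          rw [← integral_const_mul]
          refine integral_mono i4 (i3.const_mul _) fun ω => ?_
          have : H a ω ^ 2 ≤ C ^ 2 := by
            rw [← sq_abs]; exact pow_le_pow_left₀ (abs_nonneg _) (hC _ ω) 2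
          exact mul_le_mul_of_nonneg_right this (sq_nonneg _)
        rw [min_eq_left h] at ih
        change _ ≤ C ^ 2 * (∫ ω, M b ω ^ 2 ∂μ - _)
        rw [e1]
        rw [e2] at e3
        linarith
  have h1 := key N
  have h2 : ∀ ω, leftSum π H M t ω = S N ω := fun ω => leftSum_eq_sum hπ hN
  simp only [h2]
  refine h1.trans (mul_le_mul_of_nonneg_left ?_ (sq_nonneg C))
  have h3 : 0 ≤ ∫ ω, M (min (π 0) t) ω ^ 2 ∂μ := integral_nonneg fun ω => sq_nonneg _
  have h4 : ∫ ω, M (min (π N) t) ω ^ 2 ∂μ ≤ ∫ _, K ^ 2 ∂μ :=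
    integral_mono (hsq _) (integrable_const _) fun ω => by
      simp only; rw [← sq_abs]; exact pow_le_pow_left₀ (abs_nonneg _) (hK _ ω) 2
  rw [integral_const, smul_eq_mul] at h4
  linarith

lemma exists_pos_ofReal_le {δ : ℝ≥0∞} (hδ : 0 < δ) : ∃ d : ℝ, 0 < d ∧ ENNReal.ofReal d ≤ δ := by
  obtain ⟨r, hr, hr'⟩ := ENNReal.lt_iff_exists_nnreal_btwn.1 hδ
  exact ⟨r, by exact_mod_cast hr, by simpa using hr'.le⟩

/-- Bounded continuous martingales are good integrators: stop the elementary integral when it reaches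
the level in question and apply Chebyshev's inequality. -/
theorem isGoodIntegrator_of_bounded_martingale (hM : Martingale M 𝓕 μ)
    (hc : ∀ ω, Continuous fun t => M t ω) (hK : ∀ t ω, |M t ω| ≤ K) : IsGoodIntegrator 𝓕 μ M := by
  refine IsGoodIntegrator.of_bounded fun t ε hε δ hδ => ?_
  obtain ⟨d, hd, hdδ⟩ := exists_pos_ofReal_le hδ
  let B := μ.real Set.univ * K ^ 2 + 1
  have hB : 0 < B := by positivity
  refine ⟨√(d * ε ^ 2 / B), by positivity, fun π hπ H hH hb => ?_⟩
  have hY := stronglyAdapted_leftSum hπ hH hM.stronglyAdapted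
  have hYc : ∀ ω, Continuous fun t => leftSum π H M t ω := fun ω => continuous_leftSum hπ (hc ω)
  let τ := hittingTime (leftSum π H M) ε
  have hτ : IsStoppingTime 𝓕 τ := isStoppingTime_hittingTime hY hYc ε
  have hMτ := martingale_stoppedProcess hM hc hτ
  have hKτ : ∀ s ω, |(stoppedProcess M τ s ω)| ≤ K := fun s ω => hK _ _
  have h2 := integral_leftSum_sq_le hπ hMτ hKτ hH hb t
  obtain ⟨B', hB'⟩ := abs_leftSum_le hπ hKτ hb t
  have hm := ((stronglyAdapted_leftSum hπ hH hMτ.stronglyAdapted t).mono (𝓕.le t)).pow 2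
  have hi : Integrable (fun ω => leftSum π H (stoppedProcess M τ) t ω ^ 2) μ :=
    integrable_of_abs_le hm (B := B' ^ 2) fun ω => by
      rw [abs_pow]; exact pow_le_pow_left₀ (abs_nonneg _) (hB' ω) 2
  have h3 := mul_meas_ge_le_integral_of_nonneg (ae_of_all _ fun ω => sq_nonneg _) hi (ε ^ 2)
  have hsub : exceed (leftSum π H M) t ε ⊆
      {ω | ε ^ 2 ≤ leftSum π H (stoppedProcess M τ) t ω ^ 2} := by
    intro ω hω
    have h4 : τ ω ≤ t := (hittingTime_le_iff (hYc ω)).2 hω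
    obtain ⟨r, hr⟩ := WithTop.ne_top_iff_exists.1 (ne_top_of_le_ne_top WithTop.coe_ne_top h4)
    have hrt : r ≤ t := by rw [← hr] at h4; exact WithTop.coe_le_coe.1 h4
    obtain ⟨s, hs, hsε⟩ := (hittingTime_le_iff (t := r) (hYc ω)).1 hr.symm.le
    have hsr : s = r := by
      refine le_antisymm hs ?_
      have : τ ω ≤ s := (hittingTime_le_iff (hYc ω)).2 ⟨s, le_rfl, hsε⟩
      rw [← hr] at this
      exact WithTop.coe_le_coe.1 this
    rw [Set.mem_ofPred_eq, leftSum_stoppedProcess, stoppedProcess_of_coe hr.symm, min_eq_right hrt,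
      ← sq_abs (leftSum π H M r ω)]
    rw [hsr] at hsε
    exact pow_le_pow_left₀ hε.le hsε 2
  refine (measure_mono hsub).trans (le_trans ?_ hdδ)
  rw [← ENNReal.ofReal_toReal (measure_ne_top μ _)]
  refine ENNReal.ofReal_le_ofReal ?_
  have h5 : ε ^ 2 * μ.real {ω | ε ^ 2 ≤ leftSum π H (stoppedProcess M τ) t ω ^ 2} ≤ ε ^ 2 * d := by
    refine h3.trans (h2.trans ?_)
    rw [Real.sq_sqrt (by positivity)]
    have h6 : d * ε ^ 2 / B * (μ.real Set.univ * K ^ 2) ≤ d * ε ^ 2 / B * B :=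
      mul_le_mul_of_nonneg_left (by simp [B]) (by positivity)
    rw [div_mul_cancel₀ _ hB.ne'] at h6
    linarith
  exact le_of_mul_le_mul_left h5 (by positivity)

/-- A limit in probability of martingales with bounded second moments is a martingale. -/
lemma martingale_of_tendsto {Z : ℕ → ℝ≥0 → Ω → ℝ} {X : ℝ≥0 → Ω → ℝ}
    (hZ : ∀ n, Martingale (Z n) 𝓕 μ) (hZb : ∀ n t, ∃ B, ∀ ω, |Z n t ω| ≤ B)
    (hZ2 : ∀ n t, ∫ ω, Z n t ω ^ 2 ∂μ ≤ C) (hX : StronglyAdapted 𝓕 X) (hK : ∀ t ω, |X t ω| ≤ K)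
    (h : ∀ t ε, 0 < ε → Tendsto (fun n => μ {ω | ε ≤ |Z n t ω - X t ω|}) atTop (𝓝 0)) :
    Martingale X 𝓕 μ := by
  have hXm : ∀ t, StronglyMeasurable (X t) := fun t => (hX t).mono (𝓕.le t)
  have hXi : ∀ t, Integrable (X t) μ := fun t => integrable_of_abs_le (hXm t) (hK t)
  have hZm : ∀ n t, StronglyMeasurable (Z n t) := fun n t => ((hZ n).stronglyAdapted t).mono (𝓕.le t)
  have hC : 0 ≤ C := (integral_nonneg fun ω => sq_nonneg _).trans (hZ2 0 0)
  let D := 2 * C + 2 * (μ.real Set.univ * K ^ 2) + 1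
  have hD : 0 < D := by positivity
  have hL1 : ∀ t, Tendsto (fun n => ∫ ω, |Z n t ω - X t ω| ∂μ) atTop (𝓝 0) := by
    intro t
    rw [Metric.tendsto_atTop]
    intro r hr
    -- `|x| ≤ ε + α x² + 1_{|x| ≥ ε} / (4 α)` with `ε` and `α` small.
    let ε := r / (4 * (μ.real Set.univ + 1))
    have hε : 0 < ε := by positivity
    let α := r / (4 * D)
    have hα : 0 < α := by positivity
    have ht : Tendsto (fun n => μ.real {ω | ε ≤ |Z n t ω - X t ω|}) atTop (𝓝 0) := by
      have := (ENNReal.tendsto_toReal ENNReal.zero_ne_top).comp (h t ε hε)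
      rwa [ENNReal.toReal_zero] at this
    obtain ⟨N, hN⟩ := eventually_atTop.1 (ht.eventually_lt_const (show 0 < α * r by positivity))
    refine ⟨N, fun n hn => ?_⟩
    obtain ⟨B, hB⟩ := hZb n t
    have hdm := (hZm n t).sub (hXm t)
    have iZ2 : Integrable (fun ω => Z n t ω ^ 2) μ :=
      integrable_of_abs_le ((hZm n t).pow 2) (B := B ^ 2) fun ω => by
        rw [abs_pow]; exact pow_le_pow_left₀ (abs_nonneg _) (hB ω) 2
    have iX2 : Integrable (fun ω => X t ω ^ 2) μ :=
      integrable_of_abs_le ((hXm t).pow 2) (B := K ^ 2) fun ω => by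
        rw [abs_pow]; exact pow_le_pow_left₀ (abs_nonneg _) (hK t ω) 2
    have hs : MeasurableSet {ω | ε ≤ |Z n t ω - X t ω|} :=
      measurableSet_le measurable_const hdm.measurable.norm
    have i3 : Integrable ({ω | ε ≤ |Z n t ω - X t ω|}.indicator fun _ => 1 / (4 * α)) μ :=
      (integrable_const _).indicator hs
    have hpt : ∀ ω, |Z n t ω - X t ω| ≤ ε + α * (2 * Z n t ω ^ 2 + 2 * X t ω ^ 2) +
        {ω | ε ≤ |Z n t ω - X t ω|}.indicator (fun _ => 1 / (4 * α)) ω := by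
      intro ω
      have h1 : (Z n t ω - X t ω) ^ 2 ≤ 2 * Z n t ω ^ 2 + 2 * X t ω ^ 2 := by
        nlinarith [sq_nonneg (Z n t ω + X t ω)]
      have h2 := mul_le_mul_of_nonneg_left h1 hα.le
      by_cases hω : ω ∈ {ω | ε ≤ |Z n t ω - X t ω|}
      · rw [Set.indicator_of_mem hω]
        have h3 : |Z n t ω - X t ω| ≤ α * (Z n t ω - X t ω) ^ 2 + 1 / (4 * α) := by
          rw [← sq_abs (Z n t ω - X t ω)]
          have : 0 ≤ α * (|Z n t ω - X t ω| - 1 / (2 * α)) ^ 2 := by positivity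
          have e : α * (|Z n t ω - X t ω| - 1 / (2 * α)) ^ 2 =
            α * |Z n t ω - X t ω| ^ 2 + 1 / (4 * α) - |Z n t ω - X t ω| := by field_simp; ring
          linarith
        linarith
      · rw [Set.indicator_of_notMem hω]
        have h3 : |Z n t ω - X t ω| < ε := not_le.1 hω
        have h4 : 0 ≤ α * (Z n t ω - X t ω) ^ 2 := by positivity
        linarith
    have h5 : ∫ ω, |Z n t ω - X t ω| ∂μ ≤ μ.real Set.univ * ε + α * D + α * r * (1 / (4 * α)) := by
      have i12 : Integrable (fun ω => α * (2 * Z n t ω ^ 2 + 2 * X t ω ^ 2)) μ :=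
        ((iZ2.const_mul 2).add (iX2.const_mul 2)).const_mul α
      have i123 : Integrable (fun ω => ε + α * (2 * Z n t ω ^ 2 + 2 * X t ω ^ 2)) μ :=
        (integrable_const ε).add i12
      refine (integral_mono (((hZ n).integrable t).sub (hXi t)).abs (i123.add i3) hpt).trans ?_
      simp only [Pi.add_apply]
      rw [integral_add i123 i3, integral_add (integrable_const ε) i12,
        integral_const_mul, integral_add (iZ2.const_mul 2) (iX2.const_mul 2), integral_const_mul,
        integral_const_mul, integral_indicator_const _ hs, integral_const, smul_eq_mul, smul_eq_mul]
      have h6 : ∫ ω, X t ω ^ 2 ∂μ ≤ μ.real Set.univ * K ^ 2 := by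
        refine (integral_mono iX2 (integrable_const (K ^ 2)) fun ω => ?_).trans ?_
        · simp only; rw [← sq_abs]; exact pow_le_pow_left₀ (abs_nonneg _) (hK t ω) 2
        · rw [integral_const, smul_eq_mul]
      have h7 := hZ2 n t
      have h8 : α * (2 * ∫ ω, Z n t ω ^ 2 ∂μ + 2 * ∫ ω, X t ω ^ 2 ∂μ) ≤ α * D :=
        mul_le_mul_of_nonneg_left (by simp only [D]; linarith) hα.le
      have h9 := mul_le_mul_of_nonneg_right (hN n hn).le (show 0 ≤ 1 / (4 * α) by positivity)
      linarith
    have h10 : μ.real Set.univ * ε ≤ r / 4 := by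
      have : (μ.real Set.univ + 1) * ε = r / 4 := by simp only [ε]; field_simp
      linarith
    have h11 : α * D = r / 4 := by simp only [α]; field_simp
    have h12 : α * r * (1 / (4 * α)) = r / 4 := by field_simp
    rw [Real.dist_eq, sub_zero, abs_of_nonneg (integral_nonneg fun ω => abs_nonneg _)]
    linarith
  have hconv : ∀ t F, MeasurableSet F → Tendsto (fun n => ∫ ω in F, Z n t ω ∂μ) atTop
      (𝓝 (∫ ω in F, X t ω ∂μ)) := by
    intro t F hF
    rw [tendsto_iff_dist_tendsto_zero]
    refine squeeze_zero (fun _ => dist_nonneg) (fun n => ?_) (hL1 t)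
    rw [Real.dist_eq, ← integral_sub ((hZ n).integrable t).integrableOn (hXi t).integrableOn]
    refine (abs_integral_le_integral_abs).trans ?_
    exact setIntegral_le_integral (((hZ n).integrable t).sub (hXi t)).abs
      (ae_of_all _ fun ω => abs_nonneg _)
  refine martingale_of_setIntegral_eq hX hXi fun s t hst F hF => ?_
  refine tendsto_nhds_unique (hconv s F (𝓕.le s _ hF)) ?_
  simp only [fun n => (hZ n).setIntegral_eq hst hF]
  exact hconv t F (𝓕.le s _ hF)

end MartingaleTransform

/-! ### Continuous local martingales -/

section LocalMartingale

variable {Ω : Type*} {mΩ : MeasurableSpace Ω} {𝓕 : Filtration ℝ≥0 mΩ} {μ : Measure Ω}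
  {H L L' I Z : ℝ≥0 → Ω → ℝ}

/-- A local martingale null at `0` all of whose paths are continuous. Since the paths start at `0`,
the indicator of `{0 < τ}` that `Locally` puts on the initial value plays no role. -/
structure IsCLM (𝓕 : Filtration ℝ≥0 mΩ) (μ : Measure Ω) (L : ℝ≥0 → Ω → ℝ) : Prop where
  adapted : StronglyAdapted 𝓕 L
  continuous : ∀ ω, Continuous fun t => L t ω
  zero : ∀ ω, L 0 ω = 0
  exists_localizing : ∃ τ : ℕ → Ω → WithTop ℝ≥0, IsLocalizingSequence 𝓕 τ μ ∧
    ∀ n, Martingale (stoppedProcess L (τ n)) 𝓕 μ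

lemma stoppedProcess_indicator_eq (h0 : ∀ ω, L 0 ω = 0) (τ : Ω → WithTop ℝ≥0) :
    stoppedProcess (fun i => {ω | ⊥ < τ ω}.indicator (L i)) τ = stoppedProcess L τ := by
  funext t ω
  obtain ⟨s, _, hs, h⟩ := exists_stoppedProcess_eq τ t ω
  rw [h, h]
  by_cases hω : ω ∈ {ω | ⊥ < τ ω}
  · rw [Set.indicator_of_mem hω]
  · have h1 : τ ω = ⊥ := not_bot_lt_iff.1 hω
    rw [Set.indicator_of_notMem hω]
    rw [h1, ← WithTop.coe_bot, WithTop.coe_le_coe] at hs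
    rw [le_bot_iff.1 hs]
    exact (h0 ω).symm

lemma IsCLM.isContLocalMartingale (h : IsCLM 𝓕 μ L) : IsContLocalMartingale 𝓕 μ L where
  adapted := h.adapted
  continuous := ae_of_all _ h.continuous
  locally_martingale := by
    obtain ⟨τ, hτ, hM⟩ := h.exists_localizing
    exact ⟨τ, hτ, fun n => by rw [stoppedProcess_indicator_eq h.zero]; exact hM n⟩

lemma IsCLM.isContAdapted (h : IsCLM 𝓕 μ L) : IsContAdapted 𝓕 μ L :=
  h.isContLocalMartingale.toIsContAdapted

lemma IsContLocalMartingale.exists_isCLM [ContainsNullSets 𝓕 μ] (h : IsContLocalMartingale 𝓕 μ L)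
    (h0 : ∀ᵐ ω ∂μ, L 0 ω = 0) : ∃ L', IsCLM 𝓕 μ L' ∧ Indist μ L L' := by
  obtain ⟨G, hG, hG1, hGp⟩ := exists_initial_event (𝓕 := 𝓕) (h.continuous.and h0)
  have h0' : ∀ ω, G.indicator (L 0) ω = 0 := fun ω => by
    by_cases hω : ω ∈ G
    · simpa [hω] using (hGp ω hω).2
    · simp [hω]
  refine ⟨fun t => G.indicator (L t), ⟨stronglyAdapted_indicator hG h.adapted, fun ω => ?_, h0', ?_⟩,
    indist_indicator hG1 L⟩
  · by_cases hω : ω ∈ G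
    · simpa [hω] using (hGp ω hω).1
    · simpa [hω] using continuous_const
  · obtain ⟨τ, hτ, hM⟩ := h.locally_martingale
    refine ⟨τ, hτ, fun n => ?_⟩
    have e : stoppedProcess (fun t => G.indicator (L t)) (τ n) = fun t => G.indicator
        (stoppedProcess (fun i => {ω | ⊥ < τ n ω}.indicator (L i)) (τ n) t) := by
      rw [← stoppedProcess_indicator_eq h0', ← stoppedProcess_indicator_comm']
      congr 1
      funext t
      rw [Set.indicator_indicator, Set.indicator_indicator, Set.inter_comm]
    refine (hM n).congr ?_ fun t => ?_
    · rw [e]; exact stronglyAdapted_indicator hG (hM n).stronglyAdapted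
    · rw [e]
      filter_upwards [hG1] with ω hω using (Set.indicator_of_mem hω _).symm

/-- Localization to bounded martingales by the hitting times of a dominating process. -/
lemma IsCLM.exists_bounded [IsFiniteMeasure μ] (h : IsCLM 𝓕 μ L) (hZ : StronglyAdapted 𝓕 Z)
    (hZc : ∀ ω, Continuous fun t => Z t ω) (hLZ : ∀ t ω, |L t ω| ≤ |Z t ω|) :
    ∃ ρ : ℕ → Ω → WithTop ℝ≥0, IsLocalizingSequence 𝓕 ρ μ ∧
      (∀ n ω, ρ n ω ≤ hittingTime Z n ω) ∧ (∀ n, Martingale (stoppedProcess L (ρ n)) 𝓕 μ) ∧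
      ∀ (n : ℕ) t ω, |(stoppedProcess L (ρ n) t ω)| ≤ n := by
  obtain ⟨τ, hτ, hM⟩ := h.exists_localizing
  have hσ := isLocalizingSequence_hittingTime (μ := μ) hZ hZc
  refine ⟨min (fun n => hittingTime Z n) τ, hσ.min hτ, fun n ω => min_le_left _ _, fun n => ?_,
    fun n t ω => ?_⟩
  · have : stoppedProcess L ((min (fun n : ℕ => hittingTime Z n) τ) n) =
        stoppedProcess (stoppedProcess L (τ n)) (hittingTime Z n) := by
      rw [stoppedProcess_stoppedProcess]; rfl
    rw [this]
    exact martingale_stoppedProcess (hM n) (fun ω => continuous_stoppedProcess (h.continuous ω))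
      (hσ.isStoppingTime n)
  · obtain ⟨s, _, hs, e⟩ := exists_stoppedProcess_eq ((min (fun n : ℕ => hittingTime Z n) τ) n) t ω
    rw [e]
    exact abs_le_of_le_hittingTime (h.continuous ω) (h.zero ω) (fun s => hLZ s ω) n.cast_nonneg
      (hs.trans (min_le_left _ _))

lemma IsLocalizingSequence.tendsto_measure_lt [IsFiniteMeasure μ] {ρ : ℕ → Ω → WithTop ℝ≥0}
    (hρ : IsLocalizingSequence 𝓕 ρ μ) (t : ℝ≥0) :
    Tendsto (fun n => μ {ω | ρ n ω < t}) atTop (𝓝 0) := by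
  rw [← measure_empty (μ := μ)]
  refine tendsto_measure_of_ae_tendsto_indicator_of_isFiniteMeasure atTop MeasurableSet.empty
    (fun n => 𝓕.le t _ ((hρ.isStoppingTime n).measurableSet_lt t)) ?_
  filter_upwards [hρ.tendsto_top] with ω hω
  filter_upwards [(WithTop.tendsto_nhds_top_iff _).1 hω t] with n hn
  simp only [Set.mem_empty_iff_false, iff_false]
  exact fun h => absurd hn (not_lt.2 (le_of_lt h))

theorem IsCLM.isGoodIntegrator [IsFiniteMeasure μ] (h : IsCLM 𝓕 μ L) : IsGoodIntegrator 𝓕 μ L := by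
  refine IsGoodIntegrator.of_local fun t δ hδ => ?_
  obtain ⟨ρ, hρ, _, hM, hb⟩ := h.exists_bounded h.adapted h.continuous fun _ _ => le_rfl
  obtain ⟨n, hn⟩ := ((IsLocalizingSequence.tendsto_measure_lt hρ t).eventually_le_const hδ).exists
  refine ⟨stoppedProcess L (ρ n), isGoodIntegrator_of_bounded_martingale (hM n)
    (fun ω => continuous_stoppedProcess (h.continuous ω)) (hb n), (measure_mono ?_).trans hn⟩
  rintro ω ⟨s, hs, hne⟩
  by_contra hcon
  have hle : (t : WithTop ℝ≥0) ≤ ρ n ω := not_lt.1 hcon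
  refine hne ?_
  rw [stoppedProcess_eq_of_le (le_trans (WithTop.coe_le_coe.2 hs) hle)]

lemma IsCLM.add [IsFiniteMeasure μ] (h : IsCLM 𝓕 μ L) (h' : IsCLM 𝓕 μ L') : IsCLM 𝓕 μ (L + L') where
  adapted t := (h.adapted t).add (h'.adapted t)
  continuous ω := (h.continuous ω).add (h'.continuous ω)
  zero ω := by simp [h.zero, h'.zero]
  exists_localizing := by
    obtain ⟨τ, hτ, hM⟩ := h.exists_localizing
    obtain ⟨τ', hτ', hM'⟩ := h'.exists_localizing
    refine ⟨min τ τ', hτ.min hτ', fun n => ?_⟩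
    have e : stoppedProcess (L + L') ((min τ τ') n) =
        stoppedProcess (stoppedProcess L (τ n)) (τ' n) +
          stoppedProcess (stoppedProcess L' (τ' n)) (τ n) := by
      rw [stoppedProcess_stoppedProcess, stoppedProcess_stoppedProcess, inf_comm (τ' n)]
      rfl
    rw [e]
    exact (martingale_stoppedProcess (hM n) (fun ω => continuous_stoppedProcess (h.continuous ω))
      (hτ'.isStoppingTime n)).add (martingale_stoppedProcess (hM' n)
        (fun ω => continuous_stoppedProcess (h'.continuous ω)) (hτ.isStoppingTime n))

lemma IsCLM.smul (c : ℝ) (h : IsCLM 𝓕 μ L) : IsCLM 𝓕 μ (c • L) where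
  adapted t := (h.adapted t).const_smul c
  continuous ω := (h.continuous ω).const_smul c
  zero ω := by simp [h.zero]
  exists_localizing := by
    obtain ⟨τ, hτ, hM⟩ := h.exists_localizing
    exact ⟨τ, hτ, fun n => (hM n).smul c⟩

lemma IsCLM.zero_process [IsFiniteMeasure μ] : IsCLM 𝓕 μ 0 where
  adapted _ := stronglyMeasurable_const
  continuous _ := continuous_const
  zero _ := rfl
  exists_localizing := ⟨_, isLocalizingSequence_const_top 𝓕 μ, fun _ => martingale_zero _ _ _⟩

/-- A continuous martingale minus its initial value. -/
lemma isCLM_of_martingale [IsFiniteMeasure μ] (hM : Martingale L 𝓕 μ)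
    (hc : ∀ ω, Continuous fun t => L t ω) : IsCLM 𝓕 μ (fun t ω => L t ω - L 0 ω) where
  adapted t := (hM.stronglyAdapted t).sub ((hM.stronglyAdapted 0).mono (𝓕.mono zero_le))
  continuous ω := (hc ω).sub continuous_const
  zero ω := sub_self _
  exists_localizing := by
    refine ⟨_, isLocalizingSequence_const_top 𝓕 μ, fun _ => ?_⟩
    rw [stoppedProcess_const_top]
    have : Martingale (fun _ => L 0) 𝓕 μ :=
      martingale_const_fun 𝓕 μ (hM.stronglyMeasurable 0) (hM.integrable 0)
    exact hM.sub this

/-- The integral of a continuous adapted process against a continuous local martingale is a local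
martingale: up to a hitting time, integrand and integrator are bounded, and the Riemann sums are
martingales bounded in `L²`. -/
theorem IsCLM.integral [IsFiniteMeasure μ] (hL : IsCLM 𝓕 μ L) (hH : StronglyAdapted 𝓕 H)
    (hHc : ∀ ω, Continuous fun t => H t ω) (hI : StronglyAdapted 𝓕 I)
    (hIc : ∀ ω, Continuous fun t => I t ω) (hI0 : ∀ ω, I 0 ω = 0) (h : IsRiemannLimit μ H L I) :
    IsCLM 𝓕 μ I := by
  refine ⟨hI, hIc, hI0, ?_⟩
  let Z : ℝ≥0 → Ω → ℝ := fun t ω => |L t ω| + |H t ω| + |I t ω|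
  have hZ : StronglyAdapted 𝓕 Z := fun t => ((hL.adapted t).norm.add (hH t).norm).add (hI t).norm
  have hZc : ∀ ω, Continuous fun t => Z t ω := fun ω =>
    ((hL.continuous ω).abs.add (hHc ω).abs).add (hIc ω).abs
  have hZabs : ∀ t ω, |Z t ω| = Z t ω := fun t ω => abs_of_nonneg (by positivity)
  have hLZ : ∀ t ω, |L t ω| ≤ |Z t ω| := fun t ω => by
    rw [hZabs]; simp only [Z]; linarith [abs_nonneg (H t ω), abs_nonneg (I t ω)]
  have hHZ : ∀ t ω, |H t ω| ≤ |Z t ω| := fun t ω => by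
    rw [hZabs]; simp only [Z]; linarith [abs_nonneg (L t ω), abs_nonneg (I t ω)]
  have hIZ : ∀ t ω, |I t ω| ≤ |Z t ω| := fun t ω => by
    rw [hZabs]; simp only [Z]; linarith [abs_nonneg (L t ω), abs_nonneg (H t ω)]
  obtain ⟨ρ, hρ, hρZ, hM, hb⟩ := hL.exists_bounded hZ hZc hLZ
  refine ⟨ρ, hρ, fun n => ?_⟩
  -- Before `ρ n` the integrand is bounded by `n`, so clamping it does not change the sums.
  let H' : ℝ≥0 → Ω → ℝ := fun t ω => max (-(n : ℝ)) (min n (H t ω))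
  have hH' : StronglyAdapted 𝓕 H' := fun t =>
    (continuous_const.max (continuous_const.min continuous_id)).comp_stronglyMeasurable (hH t)
  have hH'b : ∀ t ω, |H' t ω| ≤ n := fun t ω => by
    have : (0 : ℝ) ≤ n := n.cast_nonneg
    exact abs_le.2 ⟨le_max_left _ _, max_le (by linarith) (min_le_left _ _)⟩
  have hP := fun m => isPartitionSeq_dyadic.isPartition m
  have hsum : ∀ m, stoppedProcess (leftSum (dyadic m) H L) (ρ n) =
      leftSum (dyadic m) H' (stoppedProcess L (ρ n)) := by
    intro m
    rw [← leftSum_stoppedProcess]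
    funext t ω
    unfold leftSum
    refine tsum_congr fun k => ?_
    rcases lt_or_ge (dyadic m k : WithTop ℝ≥0) (ρ n ω) with hk | hk
    · have h1 : |H (dyadic m k) ω| ≤ n := by
        by_contra hcon
        have h2 : hittingTime Z n ω ≤ dyadic m k := hittingAfter_le_of_mem
          (zero_le : 0 ≤ dyadic m k)
          (((not_le.1 hcon).le.trans (hHZ _ _)) : (n : ℝ) ≤ |Z (dyadic m k) ω|)
        exact absurd ((hρZ n ω).trans h2) (not_le.2 hk)
      have h2 : H' (dyadic m k) ω = H (dyadic m k) ω := by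
        simp only [H']
        rw [min_eq_right (abs_le.1 h1).2, max_eq_right (abs_le.1 h1).1]
      rw [h2]
    · obtain ⟨r, hr⟩ := WithTop.ne_top_iff_exists.1 (ne_top_of_le_ne_top WithTop.coe_ne_top hk)
      rw [← hr] at hk
      have hk' : r ≤ dyadic m k := WithTop.coe_le_coe.1 hk
      have hk2 : r ≤ dyadic m (k + 1) := hk'.trans ((hP m).mono k.le_succ)
      rw [stoppedProcess_of_coe hr.symm, stoppedProcess_of_coe hr.symm]
      have e1 : min (min (dyadic m (k + 1)) t) r = min t r := by
        rw [min_right_comm, min_eq_right hk2, min_comm]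
      have e2 : min (min (dyadic m k) t) r = min t r := by
        rw [min_right_comm, min_eq_right hk', min_comm]
      rw [e1, e2, sub_self, mul_zero, mul_zero]
  have hIstop : ∀ t ω, |(stoppedProcess I (ρ n) t ω)| ≤ n := fun t ω => by
    obtain ⟨s, _, hs, e⟩ := exists_stoppedProcess_eq (ρ n) t ω
    rw [e]
    exact abs_le_of_le_hittingTime (hIc ω) (hI0 ω) (fun s => hIZ s ω) n.cast_nonneg
      (hs.trans (hρZ n ω))
  refine martingale_of_tendsto (Z := fun m => stoppedProcess (leftSum (dyadic m) H L) (ρ n))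
    (C := (n : ℝ) ^ 2 * (μ.real Set.univ * (n : ℝ) ^ 2)) (K := n) (fun m => ?_) (fun m t => ?_)
    (fun m t => ?_) (IsStronglyProgressive.stronglyAdapted_stoppedProcess
      (StronglyAdapted.isStronglyProgressive_of_continuous hI hIc) (hρ.isStoppingTime n)) hIstop fun t ε hε => ?_
  · rw [hsum]; exact martingale_leftSum (hP m) (hM n) (hb n) hH' hH'b
  · rw [hsum]; exact abs_leftSum_le (hP m) (hb n) hH'b t
  · rw [hsum]; exact integral_leftSum_sq_le (hP m) (hM n) (hb n) hH' hH'b t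
  · refine tendsto_of_tendsto_of_tendsto_of_le_of_le tendsto_const_nhds
      (tendstoUCP_iff.1 (h _ isPartitionSeq_dyadic) t ε hε) (fun _ => zero_le)
      fun m => measure_mono fun ω hω => ?_
    obtain ⟨s, hs, _, e⟩ := exists_stoppedProcess_eq (ρ n) t ω
    rw [Set.mem_ofPred_eq, e, e] at hω
    exact ⟨s, hs, hω⟩

lemma IsCLM.eq_zero_of_nonneg [IsFiniteMeasure μ] (hL : IsCLM 𝓕 μ L)
    (h : ∀ᵐ ω ∂μ, ∀ t, 0 ≤ L t ω) : Indist μ L 0 := by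
  obtain ⟨ρ, hρ, hM⟩ := hL.exists_localizing
  have h1 : ∀ (t : ℝ≥0) n, ∀ᵐ ω ∂μ, stoppedProcess L (ρ n) t ω = 0 := by
    intro t n
    have hnn : 0 ≤ᵐ[μ] stoppedProcess L (ρ n) t := by
      filter_upwards [h] with ω hω using hω _
    have hz : ∫ ω, stoppedProcess L (ρ n) t ω ∂μ = 0 := by
      have := (hM n).setIntegral_eq (zero_le : 0 ≤ t) MeasurableSet.univ
      rw [setIntegral_univ, setIntegral_univ] at this
      rw [← this]
      refine (integral_congr_ae (ae_of_all _ fun ω => ?_)).trans (integral_zero _ _)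
      obtain ⟨s, hs, _, e⟩ := exists_stoppedProcess_eq (ρ n) 0 ω
      rw [e, le_zero_iff.1 hs]
      exact hL.zero ω
    exact (integral_eq_zero_iff_of_nonneg_ae hnn ((hM n).integrable t)).1 hz
  let d := TopologicalSpace.denseSeq ℝ≥0
  have h2 : ∀ᵐ ω ∂μ, ∀ i n, stoppedProcess L (ρ n) (d i) ω = 0 :=
    ae_all_iff.2 fun i => ae_all_iff.2 fun n => h1 (d i) n
  filter_upwards [h2, hρ.tendsto_top] with ω hω htop t
  have h3 : (fun t => L t ω) = fun _ => (0 : ℝ) := by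
    refine Continuous.ext_on (TopologicalSpace.denseRange_denseSeq ℝ≥0) (hL.continuous ω)
      continuous_const ?_
    rintro _ ⟨i, rfl⟩
    obtain ⟨n, hn⟩ := ((WithTop.tendsto_nhds_top_iff _).1 htop (d i)).exists
    have := hω i n
    rwa [stoppedProcess_eq_of_le hn.le] at this
  exact congrFun h3 t

/-- The sums of squared increments of a continuous path of finite variation tend to `0`. -/
lemma tendsto_covSum_zero_of_finiteVariation {A : ℝ≥0 → Ω → ℝ} {ω : Ω}
    {Y : ℝ≥0 → Ω → ℝ} (hc : Continuous fun t => Y t ω)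
    (hA : LocallyBoundedVariationOn (fun t => A t ω) Set.univ) {π : ℕ → ℕ → ℝ≥0}
    (hπ : IsPartitionSeq π) (t : ℝ≥0) :
    Tendsto (fun n => covSum (π n) Y A t ω) atTop (𝓝 0) := by
  let V := (eVariationOn (fun t => A t ω) (Set.Icc 0 t)).toReal
  have hV : 0 ≤ V := ENNReal.toReal_nonneg
  rw [Metric.tendsto_atTop]
  intro ε hε
  obtain ⟨η, hη, hu⟩ := Metric.uniformContinuousOn_iff.1
    ((isCompact_Icc (a := (0 : ℝ≥0)) (b := t)).uniformContinuousOn_of_continuous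
      hc.continuousOn) (ε / (V + 1)) (by positivity)
  have hη' : (0 : ℝ≥0) < ⟨η / 2, (half_pos hη).le⟩ := half_pos hη
  obtain ⟨N, hN⟩ := eventually_atTop.1 (hπ.mesh _ hη')
  refine ⟨N, fun n hn => ?_⟩
  have hP := hπ.isPartition n
  -- View the increments of `Y` as an integrand that is constant in time on each interval.
  obtain ⟨m, hm⟩ := hP.exists_ge t
  have hinc : ∀ k, |increment (π n) Y t ω k| ≤ ε / (V + 1) := by
    intro k
    have h1 := hu (min (π n (k + 1)) t) ⟨zero_le, min_le_right _ _⟩ (min (π n k) t)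
      ⟨zero_le, min_le_right _ _⟩ (by
        rw [NNReal.dist_eq]
        have h2 : (π n (k + 1) : ℝ) ≤ π n k + η / 2 := NNReal.coe_le_coe.2 (hN n hn k)
        have h3 : (π n k : ℝ) ≤ π n (k + 1) := NNReal.coe_le_coe.2 (hP.mono k.le_succ)
        rw [NNReal.coe_min, NNReal.coe_min, abs_lt]
        constructor <;> rcases min_cases (π n (k + 1) : ℝ) t with h | h <;>
          rcases min_cases (π n k : ℝ) t with h' | h' <;> linarith)
    rw [Real.dist_eq] at h1
    exact h1.le
  have hv : ∑ k ∈ Finset.range m, |increment (π n) A t ω k| ≤ V := by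
    have hfin : eVariationOn (fun t => A t ω) (Set.Icc 0 t) ≠ ⊤ := by
      have := hA 0 t trivial trivial
      rwa [Set.univ_inter] at this
    have := eVariationOn.sum_le (f := fun t => A t ω) (s := Set.Icc 0 t) (n := m)
      (u := fun k => min (π n k) t)
      (fun i j hij => min_le_min_right _ (hP.mono hij)) (fun i => ⟨zero_le, min_le_right _ _⟩)
    have h2 := ENNReal.toReal_mono hfin this
    rw [ENNReal.toReal_sum fun _ _ => edist_ne_top _ _] at h2
    refine le_trans (le_of_eq (Finset.sum_congr rfl fun k _ => ?_)) h2
    rw [edist_dist, ENNReal.toReal_ofReal dist_nonneg, Real.dist_eq, increment]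
  rw [Real.dist_eq, sub_zero, covSum_eq_weighted, weightedCovSum_eq_sum hP hm]
  calc |∑ k ∈ Finset.range m, (1 : ℝ≥0 → Ω → ℝ) (π n k) ω *
        (increment (π n) Y t ω k * increment (π n) A t ω k)|
      ≤ ∑ k ∈ Finset.range m, |(1 : ℝ≥0 → Ω → ℝ) (π n k) ω *
        (increment (π n) Y t ω k * increment (π n) A t ω k)| := Finset.abs_sum_le_sum_abs _ _
    _ ≤ ∑ k ∈ Finset.range m, ε / (V + 1) * |increment (π n) A t ω k| :=
        Finset.sum_le_sum fun k _ => by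
          rw [Pi.one_apply, Pi.one_apply, one_mul, abs_mul]
          exact mul_le_mul_of_nonneg_right (hinc k) (abs_nonneg _)
    _ ≤ ε / (V + 1) * V := by rw [← Finset.mul_sum]; gcongr
    _ < ε := by rw [div_mul_eq_mul_div, div_lt_iff₀ (by positivity)]; linarith

/-- A continuous local martingale of finite variation vanishes: its square is twice the integral
against itself, a nonnegative local martingale. -/
theorem IsCLM.eq_zero_of_finiteVariation [IsFiniteMeasure μ] [ContainsNullSets 𝓕 μ]
    (hL : IsCLM 𝓕 μ L) (hv : ∀ᵐ ω ∂μ, LocallyBoundedVariationOn (fun t => L t ω) Set.univ) :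
    Indist μ L 0 := by
  obtain ⟨I, hI, hIc, h⟩ := hL.isGoodIntegrator.exists_integral hL.isContAdapted hL.isContAdapted
  obtain ⟨φ, hφ, hlim⟩ := (h _ isPartitionSeq_dyadic).exists_subseq
  have hsq : ∀ᵐ ω ∂μ, ∀ t, L t ω ^ 2 = 2 * I t ω := by
    filter_upwards [hv, hlim] with ω hω hlim t
    have h1 := (tendsto_covSum_zero_of_finiteVariation (Y := L) (hL.continuous ω) hω
      isPartitionSeq_dyadic t).comp hφ.tendsto_atTop
    have h2 : Tendsto (fun j => L t ω ^ 2 - 2 * leftSum (dyadic (φ j)) L L t ω) atTop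
        (𝓝 (L t ω ^ 2 - 2 * I t ω)) := tendsto_const_nhds.sub ((hlim t).const_mul 2)
    have h3 := tendsto_nhds_unique h1 (h2.congr fun j => by
      simp only [Function.comp, covSum_eq (isPartitionSeq_dyadic.isPartition _), hL.zero]
      ring)
    linarith
  have hI0 : IsCLM 𝓕 μ (fun t ω => I t ω - I 0 ω) := by
    have hI0' := h.null_zero
    refine hL.integral hL.adapted hL.continuous
      (fun t => (hI t).sub ((hI 0).mono (𝓕.mono zero_le)))
      (fun ω => (hIc ω).sub continuous_const) (fun ω => sub_self _)
      (h.congr (Indist.refl _) (Indist.refl _) ?_)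
    filter_upwards [hI0'] with ω hω t
    rw [hω, sub_zero]
  have hz := hI0.eq_zero_of_nonneg (by
    filter_upwards [hsq, h.null_zero] with ω hω h0 t
    have := sq_nonneg (L t ω)
    rw [h0]
    linarith [hω t])
  filter_upwards [hz, hsq, h.null_zero] with ω h1 h2 h3 t
  have h4 := h1 t
  rw [h3] at h4
  have h5 : L t ω ^ 2 = 0 := by
    rw [h2 t]
    simp only [Pi.zero_apply] at h4
    linarith
  simpa using h5

end LocalMartingale

/-! ### Continuous semimartingales -/

section FiniteVariation

lemma BoundedVariationOn.add_real {α : Type*} [LinearOrder α] {f g : α → ℝ} {s : Set α}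
    (hf : BoundedVariationOn f s) (hg : BoundedVariationOn g s) :
    BoundedVariationOn (fun x => f x + g x) s := by
  refine ne_top_of_le_ne_top (ENNReal.add_ne_top.2 ⟨hf, hg⟩) (iSup_le ?_)
  rintro ⟨n, u, hu, hus⟩
  calc _ ≤ ∑ i ∈ Finset.range n, (edist (f (u (i + 1))) (f (u i)) + edist (g (u (i + 1))) (g (u i))) :=
        Finset.sum_le_sum fun i _ => edist_add_add_le _ _ _ _
    _ ≤ _ := by
        rw [Finset.sum_add_distrib]
        exact add_le_add (eVariationOn.sum_le hu hus) (eVariationOn.sum_le hu hus)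

lemma LocallyBoundedVariationOn.add_real {α : Type*} [LinearOrder α] {f g : α → ℝ} {s : Set α}
    (hf : LocallyBoundedVariationOn f s) (hg : LocallyBoundedVariationOn g s) :
    LocallyBoundedVariationOn (fun x => f x + g x) s :=
  fun a b ha hb => BoundedVariationOn.add_real (hf a b ha hb) (hg a b ha hb)

/-- A path whose increments are dominated on compacts by multiples of those of a monotone path has
finite variation. -/
lemma locallyBoundedVariationOn_of_abs_sub_le {f v : ℝ≥0 → ℝ} (hv : Monotone v)
    (h : ∀ b, ∃ C : ℝ, 0 ≤ C ∧ ∀ s t, s ≤ t → t ≤ b → |f t - f s| ≤ C * (v t - v s)) :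
    LocallyBoundedVariationOn f Set.univ := by
  intro a b _ _
  obtain ⟨C, hC, h⟩ := h b
  have h1 : MonotoneOn (fun t => f t + C * v t) (Set.univ ∩ Set.Icc a b) := by
    intro s _ t ht hst
    have := (abs_le.1 (h s t hst ht.2.2)).1
    simp only
    linarith
  have h2 : MonotoneOn (fun t => C * v t) (Set.univ ∩ Set.Icc a b) :=
    fun s _ t _ hst => mul_le_mul_of_nonneg_left (hv hst) hC
  have hb : ∀ {g : ℝ≥0 → ℝ}, MonotoneOn g (Set.univ ∩ Set.Icc a b) →
      BoundedVariationOn g (Set.univ ∩ Set.Icc a b) := by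
    intro g hg
    refine hg.boundedVariationOn (C := max |g a| |g b|) fun x hx => ?_
    have hab := hx.2.1.trans hx.2.2
    exact abs_le_max_abs_abs (hg ⟨trivial, le_rfl, hab⟩ hx hx.2.1)
      (hg hx ⟨trivial, hab, le_rfl⟩ hx.2.2)
  have h3 : AntitoneOn (fun t => -(C * v t)) (Set.univ ∩ Set.Icc a b) :=
    fun s hs t ht hst => neg_le_neg (h2 hs ht hst)
  have h4 : BoundedVariationOn (fun t => -(C * v t)) (Set.univ ∩ Set.Icc a b) := by
    have := (hb h2)
    refine ne_top_of_le_ne_top this (iSup_le ?_)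
    rintro ⟨n, u, hu, hus⟩
    refine le_trans (le_of_eq (Finset.sum_congr rfl fun i _ => ?_))
      (eVariationOn.sum_le (f := fun t => C * v t) hu hus)
    simp only
    rw [edist_neg_neg]
  have := BoundedVariationOn.add_real (hb h1) h4
  simpa using this

variable {Ω : Type*} {mΩ : MeasurableSpace Ω} {𝓕 : Filtration ℝ≥0 mΩ} {μ : Measure Ω}
  {A B H I X Y L : ℝ≥0 → Ω → ℝ}

/-- Continuous adapted process of finite variation on compacts. -/
structure IsFV (𝓕 : Filtration ℝ≥0 mΩ) (μ : Measure Ω) (A : ℝ≥0 → Ω → ℝ) : Prop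
    extends IsContAdapted 𝓕 μ A where
  finiteVariation : ∀ᵐ ω ∂μ, LocallyBoundedVariationOn (fun t => A t ω) Set.univ

lemma IsContAdapted.congr_of_adapted (hX : IsContAdapted 𝓕 μ X) (hY : StronglyAdapted 𝓕 Y)
    (h : Indist μ X Y) : IsContAdapted 𝓕 μ Y :=
  ⟨hY, by filter_upwards [hX.continuous, h] with ω h1 h2 using by simpa only [← h2] using h1⟩

namespace IsFV

lemma add (hA : IsFV 𝓕 μ A) (hB : IsFV 𝓕 μ B) : IsFV 𝓕 μ (A + B) :=
  ⟨hA.toIsContAdapted.add hB.toIsContAdapted, by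
    filter_upwards [hA.finiteVariation, hB.finiteVariation] with ω h1 h2 using
      LocallyBoundedVariationOn.add_real h1 h2⟩

lemma of_constTime {ξ : Ω → ℝ} (hξ : StronglyMeasurable[𝓕 0] ξ) : IsFV 𝓕 μ fun _ => ξ :=
  ⟨⟨fun _ => hξ.mono (𝓕.mono zero_le), ae_of_all _ fun _ => continuous_const⟩,
    ae_of_all _ fun _ => (monotone_const.monotoneOn _).locallyBoundedVariationOn⟩

lemma smul (c : ℝ) (hA : IsFV 𝓕 μ A) : IsFV 𝓕 μ (c • A) :=
  ⟨hA.toIsContAdapted.smul c, by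
    filter_upwards [hA.finiteVariation] with ω h using
      (monotone_const.monotoneOn Set.univ).locallyBoundedVariationOn.mul (f := fun _ => c) h⟩

lemma neg (hA : IsFV 𝓕 μ A) : IsFV 𝓕 μ (-A) := by
  simpa using hA.smul (-1)

lemma sub (hA : IsFV 𝓕 μ A) (hB : IsFV 𝓕 μ B) : IsFV 𝓕 μ (A - B) := by
  simpa only [sub_eq_add_neg] using hA.add hB.neg

lemma congr (hA : IsFV 𝓕 μ A) (hB : StronglyAdapted 𝓕 B) (h : Indist μ A B) : IsFV 𝓕 μ B :=
  ⟨hA.toIsContAdapted.congr_of_adapted hB h, by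
    filter_upwards [hA.finiteVariation, h] with ω h1 h2 using by simpa only [← h2] using h1⟩

end IsFV

/-- Increments of a Riemann sum against a path of finite variation are dominated by the increments
of the variation. -/
lemma abs_leftSum_sub_le {π : ℕ → ℝ≥0} (hπ : IsPartition π) {ω : Ω} {C : ℝ} {v : ℝ≥0 → ℝ}
    (hv : ∀ s t, s ≤ t → |A t ω - A s ω| ≤ v t - v s) {s t : ℝ≥0} (hst : s ≤ t)
    (hC : ∀ u ≤ t, |H u ω| ≤ C) :
    |leftSum π H A t ω - leftSum π H A s ω| ≤ C * (v t - v s) := by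
  obtain ⟨n, hn⟩ := hπ.exists_ge t
  have hC0 : 0 ≤ C := (abs_nonneg _).trans (hC 0 zero_le)
  rw [leftSum_eq_sum hπ hn, leftSum_eq_sum hπ (hst.trans hn), ← Finset.sum_sub_distrib]
  let c : ℕ → ℝ≥0 := fun k => max (min (π k) t) s
  have hc : Monotone c := fun i j hij => max_le_max_right _ (min_le_min_right _ (hπ.mono hij))
  have hinc : ∀ k, increment π A t ω k - increment π A s ω k = A (c (k + 1)) ω - A (c k) ω := by
    have : ∀ u, A (min u t) ω - A (min u s) ω = A (max (min u t) s) ω - A s ω := by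
      intro u
      rcases le_total u s with h | h
      · rw [min_eq_left h, min_eq_left (h.trans hst), max_eq_right h, sub_self, sub_self]
      · rw [min_eq_right h, max_eq_left (le_min h hst)]
    intro k
    have h1 := this (π (k + 1))
    have h2 := this (π k)
    simp only [increment, c]
    linarith
  calc _ ≤ ∑ k ∈ Finset.range n, |H (π k) ω * increment π A t ω k - H (π k) ω *
        increment π A s ω k| := Finset.abs_sum_le_sum_abs _ _
    _ ≤ ∑ k ∈ Finset.range n, C * (v (c (k + 1)) - v (c k)) := by
        refine Finset.sum_le_sum fun k _ => ?_
        rcases le_total (π k) t with hk | hk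
        · rw [← mul_sub, abs_mul, hinc]
          exact mul_le_mul (hC _ hk) (hv _ _ (hc k.le_succ)) (abs_nonneg _) hC0
        · rw [increment_eq_zero hπ hk, increment_eq_zero hπ (hst.trans hk), sub_self, abs_zero]
          exact mul_nonneg hC0 ((abs_nonneg _).trans (hv _ _ (hc k.le_succ)))
    _ = _ := by
        rw [← Finset.mul_sum, Finset.sum_range_sub (fun k => v (c k))]
        simp only [c, min_eq_right hn, max_eq_left hst, hπ.zero]
        rw [min_eq_left zero_le, max_eq_right zero_le]

/-- Integrals against processes of finite variation have finite variation. -/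
lemma IsFV.integral (hA : IsFV 𝓕 μ A) (hH : IsContAdapted 𝓕 μ H) (hI : IsContAdapted 𝓕 μ I)
    (h : IsRiemannLimit μ H A I) : IsFV 𝓕 μ I := by
  refine ⟨hI, ?_⟩
  obtain ⟨φ, _, hlim⟩ := (h _ isPartitionSeq_dyadic).exists_subseq
  filter_upwards [hlim, hA.finiteVariation, hH.continuous] with ω hlim hv hc
  have habs : ∀ s t, s ≤ t → |A t ω - A s ω| ≤ variationOnFromTo (fun t => A t ω) Set.univ 0 t -
      variationOnFromTo (fun t => A t ω) Set.univ 0 s := fun s t hst =>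
    variationOnFromTo.abs_sub_le_sub_of_le hv trivial trivial trivial hst
  refine locallyBoundedVariationOn_of_abs_sub_le
    (v := variationOnFromTo (fun t => A t ω) Set.univ 0)
    (fun s t hst => variationOnFromTo.monotoneOn hv trivial trivial trivial hst) fun b => ?_
  obtain ⟨m, _, hm⟩ := (isCompact_Icc (a := (0 : ℝ≥0)) (b := b)).exists_isMaxOn
    ⟨0, by simp⟩ (continuous_abs.comp hc).continuousOn
  refine ⟨|H m ω|, abs_nonneg _, fun s t hst htb => ?_⟩
  refine le_of_tendsto ((hlim t).sub (hlim s)).abs (Eventually.of_forall fun j => ?_)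
  exact abs_leftSum_sub_le (isPartitionSeq_dyadic.isPartition _) habs hst
    fun u hu => hm ⟨zero_le, hu.trans htb⟩

end FiniteVariation

section Semimartingale

variable {Ω : Type*} {mΩ : MeasurableSpace Ω} {𝓕 : Filtration ℝ≥0 mΩ} {μ : Measure Ω}
  {A H I K X Y Z L : ℝ≥0 → Ω → ℝ}

lemma isLocalMartingalePart_of_indist (hX : IsContAdapted 𝓕 μ X) (hL : IsCLM 𝓕 μ L)
    (hA : IsFV 𝓕 μ A) (h : Indist μ X (L + A)) : IsLocalMartingalePart 𝓕 μ X L := by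
  have h1 : IsFV 𝓕 μ fun t ω => X t ω - X 0 ω - L t ω := by
    refine (hA.sub (IsFV.of_constTime (hA.adapted 0))).congr
      ((hX.sub hX.initial).sub hL.isContAdapted).adapted ?_
    filter_upwards [h] with ω hω t
    simp only [hω, Pi.sub_apply, Pi.add_apply, hL.zero]
    ring
  exact ⟨hL.isContLocalMartingale, ae_of_all _ hL.zero, h1.toIsContAdapted, h1.finiteVariation⟩

lemma IsLocalMartingalePart.exists_decomposition [ContainsNullSets 𝓕 μ]
    (h : IsLocalMartingalePart 𝓕 μ X L) (hX : IsContAdapted 𝓕 μ X) :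
    ∃ L' A, IsCLM 𝓕 μ L' ∧ IsFV 𝓕 μ A ∧ Indist μ L L' ∧ Indist μ X (L' + A) := by
  obtain ⟨L', hL', hLL'⟩ := h.localMartingale.exists_isCLM h.null_zero
  refine ⟨L', (fun t ω => X t ω - X 0 ω - L t ω) + fun _ => X 0, hL',
    IsFV.add ⟨h.contAdapted, h.finiteVariation⟩ (IsFV.of_constTime (hX.adapted 0)), hLL', ?_⟩
  filter_upwards [hLL'] with ω hω t
  simp only [Pi.add_apply, ← hω]
  ring

namespace IsContSemimartingale

lemma exists_decomposition [ContainsNullSets 𝓕 μ] (hX : IsContSemimartingale 𝓕 μ X) :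
    ∃ L A, IsCLM 𝓕 μ L ∧ IsFV 𝓕 μ A ∧ Indist μ X (L + A) := by
  obtain ⟨hX, L, hL⟩ := hX
  obtain ⟨L', A, h1, h2, _, h4⟩ := hL.exists_decomposition hX
  exact ⟨L', A, h1, h2, h4⟩

lemma of_indist (hX : IsContAdapted 𝓕 μ X) (hL : IsCLM 𝓕 μ L) (hA : IsFV 𝓕 μ A)
    (h : Indist μ X (L + A)) : IsContSemimartingale 𝓕 μ X :=
  ⟨hX, L, isLocalMartingalePart_of_indist hX hL hA h⟩

lemma of_isCLM (hL : IsCLM 𝓕 μ L) : IsContSemimartingale 𝓕 μ L :=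
  of_indist hL.isContAdapted hL (IsFV.of_constTime (ξ := 0) stronglyMeasurable_const)
    (ae_of_all _ fun ω t => (add_zero _).symm)

variable [IsFiniteMeasure μ]

lemma of_isFV (hA : IsFV 𝓕 μ A) : IsContSemimartingale 𝓕 μ A :=
  of_indist hA.toIsContAdapted IsCLM.zero_process hA (by rw [zero_add]; exact Indist.refl A)

lemma const (c : ℝ) : IsContSemimartingale 𝓕 μ fun _ _ => c :=
  of_isFV (IsFV.of_constTime stronglyMeasurable_const)

variable [ContainsNullSets 𝓕 μ]

lemma isGoodIntegrator (hX : IsContSemimartingale 𝓕 μ X) : IsGoodIntegrator 𝓕 μ X := by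
  obtain ⟨L, A, hL, hA, h⟩ := hX.exists_decomposition
  exact (hL.isGoodIntegrator.add
    (isGoodIntegrator_of_finiteVariation hA.toIsContAdapted hA.finiteVariation)).congr h.symm

omit [IsFiniteMeasure μ] in
lemma congr (hX : IsContSemimartingale 𝓕 μ X) (hY : StronglyAdapted 𝓕 Y) (h : Indist μ X Y) :
    IsContSemimartingale 𝓕 μ Y := by
  obtain ⟨L, A, hL, hA, h'⟩ := hX.exists_decomposition
  exact of_indist (hX.1.congr_of_adapted hY h) hL hA (h.symm.trans h')

lemma add (hX : IsContSemimartingale 𝓕 μ X) (hY : IsContSemimartingale 𝓕 μ Y) :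
    IsContSemimartingale 𝓕 μ (X + Y) := by
  obtain ⟨L, A, hL, hA, h⟩ := hX.exists_decomposition
  obtain ⟨L', A', hL', hA', h'⟩ := hY.exists_decomposition
  exact of_indist (hX.1.add hY.1) (hL.add hL') (hA.add hA') (by
    rw [add_add_add_comm]; exact h.add h')

omit [IsFiniteMeasure μ] in
lemma smul (c : ℝ) (hX : IsContSemimartingale 𝓕 μ X) : IsContSemimartingale 𝓕 μ (c • X) := by
  obtain ⟨L, A, hL, hA, h⟩ := hX.exists_decomposition
  exact of_indist (hX.1.smul c) (hL.smul c) (hA.smul c) (by rw [← smul_add]; exact h.smul c)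

lemma neg (hX : IsContSemimartingale 𝓕 μ X) : IsContSemimartingale 𝓕 μ (-X) := by
  simpa using hX.smul (-1)

lemma sub (hX : IsContSemimartingale 𝓕 μ X) (hY : IsContSemimartingale 𝓕 μ Y) :
    IsContSemimartingale 𝓕 μ (X - Y) := by
  simpa only [sub_eq_add_neg] using hX.add hY.neg

lemma sum {ι : Type*} {s : Finset ι} {X : ι → ℝ≥0 → Ω → ℝ}
    (h : ∀ i ∈ s, IsContSemimartingale 𝓕 μ (X i)) :
    IsContSemimartingale 𝓕 μ (∑ i ∈ s, X i) := by
  classical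
  induction s using Finset.induction_on with
  | empty => exact const 0
  | insert i s hi ih =>
    rw [Finset.sum_insert hi]
    exact (h i (by simp)).add (ih fun j hj => h j (by simp [hj]))

end IsContSemimartingale

variable [IsFiniteMeasure μ] [ContainsNullSets 𝓕 μ]

/-- The integral against a continuous local martingale, in an everywhere continuous version. -/
lemma IsCLM.exists_integral (hL : IsCLM 𝓕 μ L) (hH : IsContAdapted 𝓕 μ H) :
    ∃ V, IsCLM 𝓕 μ V ∧ IsRiemannLimit μ H L V := by
  obtain ⟨I, hI, hIc, h⟩ := hL.isGoodIntegrator.exists_integral hL.isContAdapted hH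
  obtain ⟨H', hH', hHc, hHH'⟩ := hH.exists_version
  have h' : IsRiemannLimit μ H L fun t ω => I t ω - I 0 ω := by
    refine h.congr (Indist.refl _) (Indist.refl _) ?_
    filter_upwards [h.null_zero] with ω hω t
    rw [hω, sub_zero]
  exact ⟨_, hL.integral hH' hHc (fun t => (hI t).sub ((hI 0).mono (𝓕.mono zero_le)))
    (fun ω => (hIc ω).sub continuous_const) (fun ω => sub_self _)
    (h'.congr hHH' (Indist.refl _) (Indist.refl _)), h'⟩

/-- The local martingale part of an integral is the integral against the local martingale part. -/
lemma IsLocalMartingalePart.integral (hL : IsLocalMartingalePart 𝓕 μ X L)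
    (hX : IsContAdapted 𝓕 μ X) (hH : IsContAdapted 𝓕 μ H) (hI : IsContAdapted 𝓕 μ I)
    (h : IsRiemannLimit μ H X I) {V : ℝ≥0 → Ω → ℝ} (hV : IsCLM 𝓕 μ V)
    (hLV : IsRiemannLimit μ H L V) : IsLocalMartingalePart 𝓕 μ I V := by
  obtain ⟨L', A, hL', hA, h1, h2⟩ := hL.exists_decomposition hX
  obtain ⟨J, hJ, hJc, hAJ⟩ := (isGoodIntegrator_of_finiteVariation hA.toIsContAdapted
    hA.finiteVariation).exists_integral hA.toIsContAdapted hH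
  have hJ' : IsFV 𝓕 μ J := hA.integral hH ⟨hJ, ae_of_all _ hJc⟩ hAJ
  refine isLocalMartingalePart_of_indist hI hV hJ' ?_
  exact (h.congr (Indist.refl _) h2 (Indist.refl _)).unique
    ((hLV.congr (Indist.refl _) h1 (Indist.refl _)).add_right hAJ)

lemma IsContSemimartingale.integral (hX : IsContSemimartingale 𝓕 μ X) (hH : IsContAdapted 𝓕 μ H)
    (hI : IsContAdapted 𝓕 μ I) (h : IsRiemannLimit μ H X I) : IsContSemimartingale 𝓕 μ I := by
  obtain ⟨hX, L, hL⟩ := hX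
  obtain ⟨L', A, hL', hA, h1, h2⟩ := hL.exists_decomposition hX
  obtain ⟨V, hV, hLV⟩ := hL'.exists_integral hH
  exact ⟨hI, V, hL.integral hX hH hI h hV (hLV.congr (Indist.refl _) h1.symm (Indist.refl _))⟩

lemma IsContSemimartingale.exists_integral (hX : IsContSemimartingale 𝓕 μ X)
    (hH : IsContAdapted 𝓕 μ H) : ∃ I, IsContSemimartingale 𝓕 μ I ∧ IsRiemannLimit μ H X I := by
  obtain ⟨I, hI, hIc, h⟩ := hX.isGoodIntegrator.exists_integral hX.1 hH
  exact ⟨I, hX.integral hH ⟨hI, ae_of_all _ hIc⟩ h, h⟩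

end Semimartingale

/-! ### Quadratic covariation and Itô's formula -/

section Covariation

variable {Ω : Type*} {mΩ : MeasurableSpace Ω} {𝓕 : Filtration ℝ≥0 mΩ} {μ : Measure Ω}
  {A B C H I J K X Y Z : ℝ≥0 → Ω → ℝ}

/-- `B` is the ucp limit of the sums of products of increments of `X` and `Y`. -/
def IsCovLimit (μ : Measure Ω) (X Y B : ℝ≥0 → Ω → ℝ) : Prop :=
  ∀ π, IsPartitionSeq π → TendstoUCP μ (fun n => covSum (π n) X Y) B

lemma covSum_comm (π : ℕ → ℝ≥0) (X Y : ℝ≥0 → Ω → ℝ) : covSum π X Y = covSum π Y X := by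
  funext t ω
  exact tsum_congr fun _ => mul_comm _ _

lemma covSum_add_left {π : ℕ → ℝ≥0} (hπ : IsPartition π) :
    covSum π (X + Y) Z = covSum π X Z + covSum π Y Z := by
  funext t ω
  obtain ⟨n, hn⟩ := hπ.exists_ge t
  simp only [covSum_eq_weighted, weightedCovSum_eq_sum hπ hn, Pi.add_apply, increment,
    ← Finset.sum_add_distrib]
  exact Finset.sum_congr rfl fun _ _ => by ring

lemma indist_covSum {X' Y' : ℝ≥0 → Ω → ℝ} (hX : Indist μ X X') (hY : Indist μ Y Y')
    (π : ℕ → ℝ≥0) : Indist μ (covSum π X Y) (covSum π X' Y') := by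
  filter_upwards [hX, hY] with ω h1 h2 t
  exact tsum_congr fun _ => by simp only [h1, h2]

namespace IsCovLimit

lemma congr {X' Y' B' : ℝ≥0 → Ω → ℝ} (h : IsCovLimit μ X Y B) (hX : Indist μ X X')
    (hY : Indist μ Y Y') (hB : Indist μ B B') : IsCovLimit μ X' Y' B' :=
  fun π hπ => (h π hπ).congr (fun _ => indist_covSum hX hY _) hB

lemma unique {B' : ℝ≥0 → Ω → ℝ} (h : IsCovLimit μ X Y B) (h' : IsCovLimit μ X Y B') :
    Indist μ B B' :=
  (h _ isPartitionSeq_dyadic).unique (h' _ isPartitionSeq_dyadic)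

lemma comm (h : IsCovLimit μ X Y B) : IsCovLimit μ Y X B := fun π hπ => by
  simpa only [covSum_comm (π _) Y X] using h π hπ

lemma add_left {B' : ℝ≥0 → Ω → ℝ} (h : IsCovLimit μ X Z B) (h' : IsCovLimit μ Y Z B') :
    IsCovLimit μ (X + Y) Z (B + B') := fun π hπ => by
  simpa only [covSum_add_left (hπ.isPartition _)] using (h π hπ).add (h' π hπ)

end IsCovLimit

/-- Integration by parts, as the definition of the covariation limit. -/
lemma isCovLimit_of_parts (hI : IsRiemannLimit μ X Y I) (hJ : IsRiemannLimit μ Y X J) :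
    IsCovLimit μ X Y fun t ω => X t ω * Y t ω - X 0 ω * Y 0 ω - I t ω - J t ω := by
  intro π hπ
  have e : (fun n => covSum (π n) X Y) = fun n =>
      (fun t ω => X t ω * Y t ω - X 0 ω * Y 0 ω) - leftSum (π n) X Y - leftSum (π n) Y X := by
    funext n t ω
    exact covSum_eq (hπ.isPartition n)
  rw [e]
  exact ((TendstoUCP.const _).sub (hI π hπ)).sub (hJ π hπ)

lemma covSum_self_mono {π : ℕ → ℝ≥0} (hπ : IsPartition π) {m : ℕ} {t : ℝ≥0} (h : π m ≤ t) (ω : Ω) :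
    covSum π X X (π m) ω ≤ covSum π X X t ω := by
  obtain ⟨n, hn⟩ := hπ.exists_ge t
  rw [covSum_eq_weighted, weightedCovSum_eq_sum hπ hn, weightedCovSum_eq_sum hπ (h.trans hn)]
  refine Finset.sum_le_sum fun k _ => ?_
  simp only [Pi.one_apply, one_mul]
  rcases le_or_gt m k with hk | hk
  · rw [increment_eq_zero hπ (hπ.mono hk), mul_zero]
    exact mul_self_nonneg _
  · have h1 : π (k + 1) ≤ π m := hπ.mono hk
    have h2 : π k ≤ π m := hπ.mono hk.le
    simp only [increment, min_eq_left h1, min_eq_left h2, min_eq_left (h1.trans h),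
      min_eq_left (h2.trans h)]
    exact le_rfl

lemma tendsto_dyadic_floor (s : ℝ≥0) :
    Tendsto (fun m : ℕ => dyadic m ⌊s * 2 ^ m⌋₊) atTop (𝓝 s) := by
  have := (tendsto_nat_floor_mul_div_atTop (R := ℝ) (a := s) s.2).comp
    (tendsto_pow_atTop_atTop_of_one_lt (r := (2 : ℝ)) (by norm_num))
  rw [← NNReal.tendsto_coe]
  refine this.congr fun m => ?_
  simp only [Function.comp, dyadic]
  push_cast
  congr 2

/-- The quadratic variation is nondecreasing: dyadic sums increase between dyadic times, and such
times are dense. -/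
lemma IsCovLimit.isFV_self (h : IsCovLimit μ X X B) (hB : IsContAdapted 𝓕 μ B) : IsFV 𝓕 μ B := by
  refine ⟨hB, ?_⟩
  obtain ⟨φ, hφ, hlim⟩ := (h _ isPartitionSeq_dyadic).exists_subseq
  filter_upwards [hlim, hB.continuous] with ω hlim hc
  have h1 : ∀ (m k : ℕ) t, dyadic m k ≤ t → B (dyadic m k) ω ≤ B t ω := by
    intro m k t ht
    refine le_of_tendsto_of_tendsto (hlim _) (hlim t) ?_
    filter_upwards [eventually_ge_atTop m] with j hj
    have hj' : m ≤ φ j := hj.trans (hφ.id_le j)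
    have e : dyadic m k = dyadic (φ j) (k * 2 ^ (φ j - m)) := by
      simp only [dyadic]
      rw [div_eq_div_iff (by positivity) (by positivity)]
      push_cast
      rw [mul_assoc, ← pow_add, Nat.sub_add_cancel hj']
    rw [e] at ht ⊢
    exact covSum_self_mono (isPartitionSeq_dyadic.isPartition _) ht ω
  have hmono : Monotone fun t => B t ω := by
    intro s t hst
    refine le_of_tendsto ((hc.tendsto s).comp (tendsto_dyadic_floor s))
      (Eventually.of_forall fun m => h1 _ _ _ (le_trans ?_ hst))
    simp only [dyadic]
    rw [div_le_iff₀ (by positivity)]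
    exact Nat.floor_le zero_le
  exact (hmono.monotoneOn _).locallyBoundedVariationOn

variable [IsFiniteMeasure μ] [ContainsNullSets 𝓕 μ]

lemma IsRiemannLimit.to_assoc (hI : IsRiemannLimit μ H X I) (hX : IsGoodIntegrator 𝓕 μ X)
    (hH : IsContAdapted 𝓕 μ H) (hK : IsContAdapted 𝓕 μ K) (hJ : IsRiemannLimit μ K I J) :
    IsRiemannLimit μ (K * H) X J :=
  fun π hπ => by simpa using (hJ π hπ).sub (hX.assoc hH hK hI hπ)

lemma exists_isCovLimit_self (hX : IsContSemimartingale 𝓕 μ X) :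
    ∃ B, IsFV 𝓕 μ B ∧ IsCovLimit μ X X B := by
  obtain ⟨I, hI, h⟩ := hX.exists_integral hX.1
  have hc := isCovLimit_of_parts h h
  refine ⟨_, hc.isFV_self (𝓕 := 𝓕) ?_, hc⟩
  exact (((hX.1.mul hX.1).sub (hX.1.initial.mul hX.1.initial)).sub hI.1).sub hI.1

lemma exists_isCovLimit (hX : IsContSemimartingale 𝓕 μ X) (hY : IsContSemimartingale 𝓕 μ Y) :
    ∃ B, IsFV 𝓕 μ B ∧ IsCovLimit μ X Y B := by
  obtain ⟨B, hB, h⟩ := exists_isCovLimit_self (hX.add hY)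
  obtain ⟨B1, hB1, h1⟩ := exists_isCovLimit_self hX
  obtain ⟨B2, hB2, h2⟩ := exists_isCovLimit_self hY
  refine ⟨(1 / 2 : ℝ) • (B - B1 - B2), ((hB.sub hB1).sub hB2).smul _, fun π hπ => ?_⟩
  have e : (fun n => covSum (π n) X Y) = fun n => (1 / 2 : ℝ) •
      (covSum (π n) (X + Y) (X + Y) - covSum (π n) X X - covSum (π n) Y Y) := by
    funext n
    have hP := hπ.isPartition n
    rw [covSum_add_left hP, covSum_comm _ X (X + Y), covSum_comm _ Y (X + Y), covSum_add_left hP,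
      covSum_add_left hP, covSum_comm _ Y X]
    module
  rw [e]
  exact (((h π hπ).sub (h1 π hπ)).sub (h2 π hπ)).smul _

omit [IsFiniteMeasure μ] in
/-- Integration by parts. -/
lemma IsCovLimit.parts (hB : IsCovLimit μ X Y B) (hI : IsRiemannLimit μ X Y I)
    (hJ : IsRiemannLimit μ Y X J) :
    Indist μ (X * Y) ((fun _ => X 0 * Y 0) + I + J + B) := by
  filter_upwards [hB.unique (isCovLimit_of_parts hI hJ)] with ω hω t
  simp only [Pi.add_apply, Pi.mul_apply, hω]
  ring

lemma IsContSemimartingale.mul (hX : IsContSemimartingale 𝓕 μ X)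
    (hY : IsContSemimartingale 𝓕 μ Y) : IsContSemimartingale 𝓕 μ (X * Y) := by
  obtain ⟨B, hB, h⟩ := exists_isCovLimit hX hY
  obtain ⟨I, hI, hI'⟩ := hY.exists_integral hX.1
  obtain ⟨J, hJ, hJ'⟩ := hX.exists_integral hY.1
  have h0 : IsContSemimartingale 𝓕 μ fun _ => X 0 * Y 0 :=
    of_isFV (IsFV.of_constTime ((hX.1.adapted 0).mul (hY.1.adapted 0)))
  exact (((h0.add hI).add hJ).add (of_isFV hB)).congr (hX.1.mul hY.1).adapted
    (h.parts hI' hJ').symm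

lemma leftSum_constTime_add (π : ℕ → ℝ≥0) (ξ : Ω → ℝ) :
    leftSum π H ((fun _ => ξ) + X) = leftSum π H X := by
  funext t ω
  exact tsum_congr fun _ => by simp

/-- Weighted sums of products of increments converge to the integral against the covariation. -/
lemma IsCovLimit.tendsto_weightedCovSum (hX : IsContSemimartingale 𝓕 μ X)
    (hY : IsContSemimartingale 𝓕 μ Y) (hB : IsCovLimit μ X Y B) (hH : IsContAdapted 𝓕 μ H)
    (hJ : IsRiemannLimit μ H B J) {π : ℕ → ℕ → ℝ≥0} (hπ : IsPartitionSeq π) :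
    TendstoUCP μ (fun n => weightedCovSum (π n) H X Y) J := by
  obtain ⟨I1, hI1, hI1'⟩ := hY.exists_integral hX.1
  obtain ⟨I2, hI2, hI2'⟩ := hX.exists_integral hY.1
  obtain ⟨J1, -, hJ1⟩ := hI1.exists_integral hH
  obtain ⟨J2, -, hJ2⟩ := hI2.exists_integral hH
  have h1 := hI1'.to_assoc hY.isGoodIntegrator hX.1 hH hJ1
  have h2 := hI2'.to_assoc hX.isGoodIntegrator hY.1 hH hJ2
  have h3 : IsRiemannLimit μ H (X * Y) (J1 + J2 + J) := by
    refine IsRiemannLimit.congr ?_ (Indist.refl _) (hB.parts hI1' hI2').symm (Indist.refl _)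
    intro π hπ
    simp only [add_assoc, leftSum_constTime_add]
    simpa only [add_assoc] using ((hJ1.add_right hJ2).add_right hJ) π hπ
  have h4 := ((h3 π hπ).sub (h1 π hπ)).sub (h2 π hπ)
  simp only [← weightedCovSum_eq (hπ.isPartition _)] at h4
  convert h4 using 1
  abel

lemma TendstoUCP.zero_mul {Z : ℕ → ℝ≥0 → Ω → ℝ} (h : TendstoUCP μ Z 0) (hY : IsContAdapted 𝓕 μ Y) :
    TendstoUCP μ (fun n => Z n * Y) 0 := by
  refine TendstoUCP.of_le fun t ε hε δ hδ => ?_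
  obtain ⟨C, hC, hCμ⟩ := hY.exists_bound t (ENNReal.half_pos hδ.ne')
  filter_upwards [h.exists_le t (div_pos hε hC) (ENNReal.half_pos hδ.ne')] with n hn
  rw [sub_zero] at hn ⊢
  rw [← div_mul_cancel₀ ε hC.ne', ← ENNReal.add_halves δ]
  exact (measure_exceed_mul_le _ _ t _ _).trans (add_le_add hn hCμ)

/-- Covariation commutes with integration (Kunita–Watanabe): the increments of `∫ H dX` differ from
those of its Riemann sums by a process tending to `0`, whose covariation sums tend to `0` by
summation by parts. -/
theorem IsCovLimit.integral (hX : IsContSemimartingale 𝓕 μ X) (hY : IsContSemimartingale 𝓕 μ Y)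
    (hB : IsCovLimit μ X Y B) (hH : IsContAdapted 𝓕 μ H) (hI : IsRiemannLimit μ H X I)
    (hIc : IsContAdapted 𝓕 μ I) (hJ : IsRiemannLimit μ H B J) : IsCovLimit μ I Y J := by
  intro π hπ
  let D : ℕ → ℝ≥0 → Ω → ℝ := fun n => I - leftSum (π n) H X
  have hD : TendstoUCP μ D 0 := by
    simpa [D] using (TendstoUCP.const I).sub (hI π hπ)
  have hDa : ∀ n, StronglyAdapted 𝓕 (D n) := fun n t => (hIc.adapted t).sub
    (stronglyAdapted_leftSum (hπ.isPartition n) hH.adapted hX.1.adapted t)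
  have h1 : TendstoUCP μ (fun n => leftSum (π n) (D n) Y) 0 := by
    refine TendstoUCP.of_le fun t ε hε δ hδ => ?_
    obtain ⟨η, hη, h⟩ := hY.isGoodIntegrator t ε hε (δ / 2) (ENNReal.half_pos hδ.ne')
    filter_upwards [hD.exists_le t hη (ENNReal.half_pos hδ.ne')] with n hn
    rw [sub_zero] at hn ⊢
    rw [← ENNReal.add_halves δ]
    exact (h _ (hπ.isPartition n) _ (hDa n)).trans (by gcongr)
  have h2 : TendstoUCP μ (fun n => leftSum (π n) Y (D n)) 0 := by
    have := hX.isGoodIntegrator.assoc hH hY.1 hI hπ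
    simpa only [D, leftSum_sub_right (hπ.isPartition _), leftSum_leftSum (hπ.isPartition _)]
      using this
  have h3 : TendstoUCP μ (fun n => covSum (π n) (D n) Y) 0 := by
    have := ((hD.zero_mul hY.1).sub h1).sub h2
    rw [sub_zero, sub_zero] at this
    refine this.congr (fun n => ?_) (Indist.refl _)
    filter_upwards [hI.null_zero] with ω hω t
    rw [covSum_eq (hπ.isPartition n)]
    simp only [D, Pi.sub_apply, Pi.mul_apply, hω, leftSum_zero_time (hπ.isPartition n)]
    ring
  have e : ∀ n, covSum (π n) I Y = weightedCovSum (π n) H X Y + covSum (π n) (D n) Y := by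
    intro n
    have hP := hπ.isPartition n
    have e1 : covSum (π n) (leftSum (π n) H X) Y = weightedCovSum (π n) H X Y := by
      funext t ω
      rw [covSum_eq_weighted]
      refine tsum_congr fun k => ?_
      rw [increment_leftSum hP, Pi.one_apply, Pi.one_apply, one_mul, mul_assoc]
    rw [← e1, ← covSum_add_left hP]
    congr 1
    simp only [D]
    abel
  simp only [e]
  simpa using (hB.tendsto_weightedCovSum hX hY hH hJ hπ).add h3

omit [IsFiniteMeasure μ] [ContainsNullSets 𝓕 μ] in
lemma IsCovLimit.eq_zero_of_isFV (hY : IsContAdapted 𝓕 μ Y) (hA : IsFV 𝓕 μ A)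
    (hB : IsCovLimit μ Y A B) : Indist μ B 0 := by
  obtain ⟨φ, hφ, hlim⟩ := (hB _ isPartitionSeq_dyadic).exists_subseq
  filter_upwards [hlim, hY.continuous, hA.finiteVariation] with ω h1 hc hv t
  exact tendsto_nhds_unique (h1 t) ((tendsto_covSum_zero_of_finiteVariation hc hv
    isPartitionSeq_dyadic t).comp hφ.tendsto_atTop)

lemma IsPartitionSeq.comp {π : ℕ → ℕ → ℝ≥0} (h : IsPartitionSeq π) {φ : ℕ → ℕ}
    (hφ : StrictMono φ) : IsPartitionSeq fun n => π (φ n) :=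
  ⟨fun _ => h.zero _, fun _ => h.mono _, fun _ => h.tendsto_atTop _,
    fun δ hδ => hφ.tendsto_atTop.eventually (h.mesh δ hδ)⟩

/-- Second order Taylor expansion on `(0, ∞)`, with a remainder uniform on compact sets. -/
def HasUniformTaylor (f f' f'' : ℝ → ℝ) : Prop :=
  ∀ a b : ℝ, 0 < a → ∀ ε > 0, ∃ δ > 0, ∀ x ∈ Set.Icc a b, ∀ y ∈ Set.Icc a b, |y - x| < δ →
    |f y - f x - f' x * (y - x) - 1 / 2 * (f'' x * (y - x) ^ 2)| ≤ ε * (y - x) ^ 2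

/-- Itô's formula for a positive semimartingale. -/
theorem ito_formula {f f' f'' : ℝ → ℝ} (hf : HasUniformTaylor f f' f'')
    (hX : IsContSemimartingale 𝓕 μ X) (hpos : ∀ᵐ ω ∂μ, ∀ t, 0 < X t ω)
    (hf' : IsContAdapted 𝓕 μ fun t ω => f' (X t ω))
    (hf'' : IsContAdapted 𝓕 μ fun t ω => f'' (X t ω)) (hB : IsCovLimit μ X X B)
    (hI : IsRiemannLimit μ (fun t ω => f' (X t ω)) X I)
    (hJ : IsRiemannLimit μ (fun t ω => f'' (X t ω)) B J) :
    ∀ᵐ ω ∂μ, ∀ t, f (X t ω) = f (X 0 ω) + I t ω + 1 / 2 * J t ω := by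
  obtain ⟨φ, hφ, h1⟩ := ((hI _ isPartitionSeq_dyadic).add ((hB.tendsto_weightedCovSum hX hX hf''
    hJ isPartitionSeq_dyadic).smul (1 / 2))).exists_subseq
  obtain ⟨ψ, hψ, h2⟩ := (hB _ (isPartitionSeq_dyadic.comp hφ)).exists_subseq
  have hπ := (isPartitionSeq_dyadic.comp hφ).comp hψ
  filter_upwards [h1, h2, hX.1.continuous, hpos] with ω h1 h2 hc hpos t
  let π : ℕ → ℕ → ℝ≥0 := fun n => dyadic (φ (ψ n))
  let E : ℕ → ℝ := fun n => f (X t ω) - f (X 0 ω) - (leftSum (π n) (fun t ω => f' (X t ω)) X t ω +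
    1 / 2 * weightedCovSum (π n) (fun t ω => f'' (X t ω)) X X t ω)
  have hE : Tendsto E atTop (𝓝 (f (X t ω) - f (X 0 ω) - (I t ω + 1 / 2 * J t ω))) :=
    tendsto_const_nhds.sub ((h1 t).comp hψ.tendsto_atTop)
  -- the range of the path up to time `t` lies in a compact subset of `(0, ∞)`
  obtain ⟨m, _, hm⟩ := (isCompact_Icc (a := (0 : ℝ≥0)) (b := t)).exists_isMinOn
    ⟨0, by simp⟩ hc.continuousOn
  obtain ⟨M, _, hM⟩ := (isCompact_Icc (a := (0 : ℝ≥0)) (b := t)).exists_isMaxOn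
    ⟨0, by simp⟩ hc.continuousOn
  have hmem : ∀ s ≤ t, X s ω ∈ Set.Icc (X m ω) (X M ω) := fun s hs =>
    ⟨hm ⟨zero_le, hs⟩, hM ⟨zero_le, hs⟩⟩
  have hbound : ∀ ε > 0, ∀ᶠ n in atTop, |E n| ≤ ε * covSum (π n) X X t ω := by
    intro ε hε
    obtain ⟨δ, hδ, hT⟩ := hf (X m ω) (X M ω) (hpos m) ε hε
    obtain ⟨η, hη, hu⟩ := Metric.uniformContinuousOn_iff.1
      ((isCompact_Icc (a := (0 : ℝ≥0)) (b := t)).uniformContinuousOn_of_continuous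
        hc.continuousOn) δ hδ
    have hη' : (0 : ℝ≥0) < ⟨η / 2, (half_pos hη).le⟩ := half_pos hη
    filter_upwards [hπ.mesh _ hη'] with n hn
    have hP : IsPartition (π n) := hπ.isPartition n
    obtain ⟨N, hN⟩ := hP.exists_ge t
    have hinc : ∀ k, |increment (π n) X t ω k| < δ := by
      intro k
      have h1 := hu (min (π n (k + 1)) t) ⟨zero_le, min_le_right _ _⟩ (min (π n k) t)
        ⟨zero_le, min_le_right _ _⟩ (by
          rw [NNReal.dist_eq]
          have h2 : (π n (k + 1) : ℝ) ≤ π n k + η / 2 := NNReal.coe_le_coe.2 (hn k)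
          have h3 : (π n k : ℝ) ≤ π n (k + 1) := NNReal.coe_le_coe.2 (hP.mono k.le_succ)
          rw [NNReal.coe_min, NNReal.coe_min, abs_lt]
          constructor <;> rcases min_cases (π n (k + 1) : ℝ) t with h | h <;>
            rcases min_cases (π n k : ℝ) t with h' | h' <;> linarith)
      rwa [Real.dist_eq] at h1
    have htel : f (X t ω) - f (X 0 ω) = ∑ k ∈ Finset.range N,
        (f (X (min (π n (k + 1)) t) ω) - f (X (min (π n k) t) ω)) := by
      rw [Finset.sum_range_sub (fun k => f (X (min (π n k) t) ω)), min_eq_right hN, hP.zero,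
        min_eq_left zero_le]
    have e : E n = ∑ k ∈ Finset.range N,
        (f (X (min (π n (k + 1)) t) ω) - f (X (min (π n k) t) ω) -
          f' (X (π n k) ω) * increment (π n) X t ω k -
          1 / 2 * (f'' (X (π n k) ω) * (increment (π n) X t ω k * increment (π n) X t ω k))) := by
      simp only [E]
      rw [htel, leftSum_eq_sum hP hN, weightedCovSum_eq_sum hP hN]
      simp only [Finset.sum_sub_distrib, Finset.mul_sum]
      ring
    rw [e, covSum_eq_weighted, weightedCovSum_eq_sum hP hN, Finset.mul_sum]
    refine (Finset.abs_sum_le_sum_abs _ _).trans (Finset.sum_le_sum fun k _ => ?_)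
    simp only [Pi.one_apply, one_mul]
    rcases le_total t (π n k) with hk | hk
    · simp [increment_eq_zero hP hk, min_eq_right hk, min_eq_right (hk.trans (hP.mono k.le_succ))]
    · have := hT _ (hmem _ hk) _ (hmem _ (min_le_right (π n (k + 1)) t)) (by
        have := hinc k
        rwa [increment, min_eq_left hk] at this)
      simp only [increment, min_eq_left hk]
      simpa only [sq] using this
  have hle : ∀ ε > 0, |f (X t ω) - f (X 0 ω) - (I t ω + 1 / 2 * J t ω)| ≤ ε * B t ω :=
    fun ε hε => le_of_tendsto_of_tendsto hE.abs ((h2 t).const_mul ε) (hbound ε hε)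
  have hz : Tendsto (fun ε : ℝ => ε * B t ω) (𝓝[>] 0) (𝓝 0) := by
    simpa using ((tendsto_id (α := ℝ) (x := 𝓝 0)).mul_const (B t ω)).mono_left nhdsWithin_le_nhds
  have h0 := ge_of_tendsto hz (eventually_mem_nhdsWithin.mono hle)
  have := abs_nonpos_iff.1 h0
  linarith

end Covariation

/-! ### The module of stochastic differentials -/

section Differentials

variable {Ω : Type*} {mΩ : MeasurableSpace Ω} (𝓕 : Filtration ℝ≥0 mΩ) (μ : Measure Ω)

/-- The algebra of continuous adapted processes. -/
def contAdapted : Subalgebra ℝ (ℝ≥0 → Ω → ℝ) where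
  carrier := {X | IsContAdapted 𝓕 μ X}
  mul_mem' := IsContAdapted.mul
  add_mem' := IsContAdapted.add
  algebraMap_mem' c := IsContAdapted.const c

/-- The ideal of processes indistinguishable from zero. -/
def nullProcesses : Ideal (contAdapted 𝓕 μ) where
  carrier := {X | Indist μ X.1 0}
  add_mem' {X Y} hX hY := by
    have := Indist.add hX hY
    rwa [add_zero] at this
  zero_mem' := Indist.refl _
  smul_mem' X Y hY := by
    have := (Indist.refl (μ := μ) X.1).mul hY
    rwa [mul_zero] at this

/-- The ring of continuous adapted processes up to indistinguishability. -/
def ProcessRing : Type _ := contAdapted 𝓕 μ ⧸ nullProcesses 𝓕 μ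

instance : CommRing (ProcessRing 𝓕 μ) :=
  inferInstanceAs (CommRing (contAdapted 𝓕 μ ⧸ nullProcesses 𝓕 μ))

instance : Algebra ℝ (ProcessRing 𝓕 μ) :=
  inferInstanceAs (Algebra ℝ (contAdapted 𝓕 μ ⧸ nullProcesses 𝓕 μ))

open Classical in
/-- The class of a continuous adapted process in the ring of processes up to indistinguishability;
zero if the process is not continuous and adapted. -/
def cls (H : ℝ≥0 → Ω → ℝ) : ProcessRing 𝓕 μ :=
  if h : IsContAdapted 𝓕 μ H then Ideal.Quotient.mk (nullProcesses 𝓕 μ) ⟨H, h⟩ else 0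

variable {𝓕 μ} {A B H I J K X Y Z : ℝ≥0 → Ω → ℝ}

lemma cls_eq (h : IsContAdapted 𝓕 μ H) :
    cls 𝓕 μ H = Ideal.Quotient.mk (nullProcesses 𝓕 μ) ⟨H, h⟩ := dif_pos h

lemma exists_cls_eq (a : ProcessRing 𝓕 μ) : ∃ H, IsContAdapted 𝓕 μ H ∧ cls 𝓕 μ H = a := by
  obtain ⟨⟨H, hH⟩, rfl⟩ := Ideal.Quotient.mk_surjective a
  exact ⟨H, hH, cls_eq hH⟩

lemma cls_eq_cls_iff (hH : IsContAdapted 𝓕 μ H) (hK : IsContAdapted 𝓕 μ K) :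
    cls 𝓕 μ H = cls 𝓕 μ K ↔ Indist μ H K := by
  rw [cls_eq hH, cls_eq hK]
  refine Ideal.Quotient.eq.trans ?_
  constructor <;> intro h <;> filter_upwards [h] with ω hω t
  · exact sub_eq_zero.1 (hω t)
  · exact sub_eq_zero.2 (hω t)

lemma cls_add (hH : IsContAdapted 𝓕 μ H) (hK : IsContAdapted 𝓕 μ K) :
    cls 𝓕 μ (H + K) = cls 𝓕 μ H + cls 𝓕 μ K := by
  rw [cls_eq hH, cls_eq hK, cls_eq (hH.add hK)]
  rfl

lemma cls_mul (hH : IsContAdapted 𝓕 μ H) (hK : IsContAdapted 𝓕 μ K) :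
    cls 𝓕 μ (H * K) = cls 𝓕 μ H * cls 𝓕 μ K := by
  rw [cls_eq hH, cls_eq hK, cls_eq (hH.mul hK)]
  rfl

lemma cls_const (c : ℝ) : cls 𝓕 μ (fun _ _ => c) = algebraMap ℝ (ProcessRing 𝓕 μ) c :=
  cls_eq (IsContAdapted.const c)

lemma cls_one : cls 𝓕 μ 1 = 1 := by
  rw [← map_one (algebraMap ℝ (ProcessRing 𝓕 μ)), ← cls_const]
  rfl

lemma cls_sub (hH : IsContAdapted 𝓕 μ H) (hK : IsContAdapted 𝓕 μ K) :
    cls 𝓕 μ (H - K) = cls 𝓕 μ H - cls 𝓕 μ K := by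
  rw [eq_sub_iff_add_eq, ← cls_add (hH.sub hK) hK, sub_add_cancel]

lemma cls_sum {ι : Type*} {s : Finset ι} {H : ι → ℝ≥0 → Ω → ℝ}
    (h : ∀ i ∈ s, IsContAdapted 𝓕 μ (H i)) :
    cls 𝓕 μ (∑ i ∈ s, H i) = ∑ i ∈ s, cls 𝓕 μ (H i) := by
  classical
  induction s using Finset.induction_on with
  | empty =>
    rw [Finset.sum_empty, Finset.sum_empty, ← map_zero (algebraMap ℝ (ProcessRing 𝓕 μ)),
      ← cls_const]
    rfl
  | insert i s hi ih =>
    rw [Finset.sum_insert hi, Finset.sum_insert hi, cls_add (h i (by simp))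
      (IsContAdapted.sum fun j hj => h j (by simp [hj])), ih fun j hj => h j (by simp [hj])]

variable (𝓕 μ) [IsFiniteMeasure μ] [ContainsNullSets 𝓕 μ]

/-- The space of continuous semimartingales. -/
def semimartingales : Submodule ℝ (ℝ≥0 → Ω → ℝ) where
  carrier := {X | IsContSemimartingale 𝓕 μ X}
  add_mem' := IsContSemimartingale.add
  zero_mem' := IsContSemimartingale.const 0
  smul_mem' c _ := IsContSemimartingale.smul c

/-- The semimartingales that are almost surely constant in time. -/
def constantsInTime : Submodule ℝ (semimartingales 𝓕 μ) where
  carrier := {X | ∀ᵐ ω ∂μ, ∀ t, X.1 t ω = X.1 0 ω}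
  add_mem' {X Y} hX hY := by
    have hX : ∀ᵐ ω ∂μ, ∀ t, X.1 t ω = X.1 0 ω := hX
    have hY : ∀ᵐ ω ∂μ, ∀ t, Y.1 t ω = Y.1 0 ω := hY
    exact (hX.and hY).mono fun ω h t => congrArg₂ (· + ·) (h.1 t) (h.2 t)
  zero_mem' := ae_of_all _ fun _ _ => rfl
  smul_mem' c X hX := by
    have hX : ∀ᵐ ω ∂μ, ∀ t, X.1 t ω = X.1 0 ω := hX
    exact hX.mono fun ω h t => congrArg (c * ·) (h t)

/-- Stochastic differentials: continuous semimartingales up to processes constant in time and up to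
indistinguishability. -/
def Differential : Type _ := semimartingales 𝓕 μ ⧸ constantsInTime 𝓕 μ

instance : AddCommGroup (Differential 𝓕 μ) :=
  inferInstanceAs (AddCommGroup (semimartingales 𝓕 μ ⧸ constantsInTime 𝓕 μ))

open Classical in
/-- The differential `dX` of a continuous semimartingale; zero for other processes. -/
def differential (X : ℝ≥0 → Ω → ℝ) : Differential 𝓕 μ :=
  if h : IsContSemimartingale 𝓕 μ X then Submodule.Quotient.mk ⟨X, h⟩ else 0

local notation "𝕕" => differential 𝓕 μ
local notation "𝕔" => cls 𝓕 μ

variable {𝓕 μ}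

lemma differential_eq (h : IsContSemimartingale 𝓕 μ X) :
    𝕕 X = (Submodule.Quotient.mk ⟨X, h⟩ : semimartingales 𝓕 μ ⧸ constantsInTime 𝓕 μ) := dif_pos h

lemma exists_differential_eq (a : Differential 𝓕 μ) :
    ∃ X, IsContSemimartingale 𝓕 μ X ∧ 𝕕 X = a := by
  obtain ⟨⟨X, hX⟩, h⟩ := Submodule.Quotient.mk_surjective (constantsInTime 𝓕 μ) a
  exact ⟨X, hX, (differential_eq hX).trans h⟩

lemma differential_eq_iff (hX : IsContSemimartingale 𝓕 μ X) (hY : IsContSemimartingale 𝓕 μ Y) :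
    𝕕 X = 𝕕 Y ↔ ∀ᵐ ω ∂μ, ∀ t, X t ω - X 0 ω = Y t ω - Y 0 ω := by
  rw [differential_eq hX, differential_eq hY]
  refine (Submodule.Quotient.eq _).trans ?_
  constructor <;> intro h <;> filter_upwards [h] with ω hω t
  · have : X t ω - Y t ω = X 0 ω - Y 0 ω := hω t
    linarith
  · have := hω t
    show X t ω - Y t ω = X 0 ω - Y 0 ω
    linarith

lemma differential_add (hX : IsContSemimartingale 𝓕 μ X) (hY : IsContSemimartingale 𝓕 μ Y) :
    𝕕 (X + Y) = 𝕕 X + 𝕕 Y := by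
  rw [differential_eq hX, differential_eq hY, differential_eq (hX.add hY)]
  rfl

lemma differential_constTime {ξ : Ω → ℝ} (hξ : StronglyMeasurable[𝓕 0] ξ) :
    𝕕 (fun _ => ξ) = 0 := by
  have h0 : 𝕕 0 = 0 := by
    have h := differential_add (IsContSemimartingale.const (𝓕 := 𝓕) (μ := μ) 0)
      (IsContSemimartingale.const 0)
    have e : ((fun _ _ => 0) + (fun _ _ => 0) : ℝ≥0 → Ω → ℝ) = fun _ _ => 0 := by
      funext t ω; simp
    rw [e] at h
    exact left_eq_add.1 h
  refine Eq.trans ?_ h0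
  change _ = 𝕕 (fun _ _ => 0)
  rw [differential_eq_iff (.of_isFV (IsFV.of_constTime hξ)) (.const 0)]
  exact ae_of_all _ fun ω t => by simp

lemma differential_const (c : ℝ) : 𝕕 (fun _ _ => c) = 0 :=
  differential_constTime stronglyMeasurable_const

lemma differential_neg (hX : IsContSemimartingale 𝓕 μ X) : 𝕕 (-X) = -𝕕 X := by
  rw [eq_neg_iff_add_eq_zero, ← differential_add hX.neg hX, neg_add_cancel]
  exact differential_const 0

lemma differential_sub (hX : IsContSemimartingale 𝓕 μ X) (hY : IsContSemimartingale 𝓕 μ Y) :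
    𝕕 (X - Y) = 𝕕 X - 𝕕 Y := by
  rw [sub_eq_add_neg, differential_add hX hY.neg, differential_neg hY, sub_eq_add_neg]

lemma differential_sum {ι : Type*} {s : Finset ι} {X : ι → ℝ≥0 → Ω → ℝ}
    (h : ∀ i ∈ s, IsContSemimartingale 𝓕 μ (X i)) :
    𝕕 (∑ i ∈ s, X i) = ∑ i ∈ s, 𝕕 (X i) := by
  classical
  induction s using Finset.induction_on with
  | empty => exact differential_const 0
  | insert i s hi ih =>
    rw [Finset.sum_insert hi, Finset.sum_insert hi, differential_add (h i (by simp))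
      (IsContSemimartingale.sum fun j hj => h j (by simp [hj])), ih fun j hj => h j (by simp [hj])]

omit [IsFiniteMeasure μ] in
lemma indist_add_initial (h : ∀ᵐ ω ∂μ, ∀ t, X t ω - X 0 ω = Y t ω - Y 0 ω) :
    Indist μ X ((fun _ => X 0 - Y 0) + Y) := by
  filter_upwards [h] with ω hω t
  have := hω t
  simp only [Pi.add_apply, Pi.sub_apply]
  linarith

lemma IsRiemannLimit.indist_of_eq {H' X' I' : ℝ≥0 → Ω → ℝ} (h : IsRiemannLimit μ H X I)
    (h' : IsRiemannLimit μ H' X' I') (hH : Indist μ H H')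
    (hX : ∀ᵐ ω ∂μ, ∀ t, X t ω - X 0 ω = X' t ω - X' 0 ω) : Indist μ I I' := by
  refine (h.congr hH (indist_add_initial hX) (Indist.refl _)).unique ?_
  intro π hπ
  simpa only [leftSum_constTime_add] using h' π hπ

lemma IsCovLimit.indist_of_eq {X' Y' B' : ℝ≥0 → Ω → ℝ} (h : IsCovLimit μ X Y B)
    (h' : IsCovLimit μ X' Y' B') (hX : ∀ᵐ ω ∂μ, ∀ t, X t ω - X 0 ω = X' t ω - X' 0 ω)
    (hY : ∀ᵐ ω ∂μ, ∀ t, Y t ω - Y 0 ω = Y' t ω - Y' 0 ω) : Indist μ B B' := by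
  refine (h.congr (indist_add_initial hX) (indist_add_initial hY) (Indist.refl _)).unique ?_
  intro π hπ
  have : ∀ (π : ℕ → ℝ≥0) (ξ ζ : Ω → ℝ), covSum π ((fun _ => ξ) + X') ((fun _ => ζ) + Y') =
      covSum π X' Y' := fun π ξ ζ => by
    funext t ω
    exact tsum_congr fun _ => by simp
  simpa only [this] using h' π hπ

lemma exists_smul (a : ProcessRing 𝓕 μ) (α : Differential 𝓕 μ) : ∃ I H X,
    IsContAdapted 𝓕 μ H ∧ IsContSemimartingale 𝓕 μ X ∧ 𝕔 H = a ∧ 𝕕 X = α ∧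
      IsContSemimartingale 𝓕 μ I ∧ IsRiemannLimit μ H X I := by
  obtain ⟨H, hH, rfl⟩ := exists_cls_eq a
  obtain ⟨X, hX, rfl⟩ := exists_differential_eq α
  obtain ⟨I, hI, h⟩ := hX.exists_integral hH
  exact ⟨I, H, X, hH, hX, rfl, rfl, hI, h⟩

/-- `H • dX = d (∫ H dX)`. -/
instance : SMul (ProcessRing 𝓕 μ) (Differential 𝓕 μ) := ⟨fun a α => 𝕕 (exists_smul a α).choose⟩

lemma differential_eq_of_indist (hX : IsContSemimartingale 𝓕 μ X)
    (hY : IsContSemimartingale 𝓕 μ Y) (h : Indist μ X Y) : 𝕕 X = 𝕕 Y := by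
  rw [differential_eq_iff hX hY]
  filter_upwards [h] with ω hω t
  rw [hω, hω]

lemma cls_smul_differential (hH : IsContAdapted 𝓕 μ H) (hX : IsContSemimartingale 𝓕 μ X)
    (hI : IsContSemimartingale 𝓕 μ I) (h : IsRiemannLimit μ H X I) : 𝕔 H • 𝕕 X = 𝕕 I := by
  obtain ⟨H', X', hH', hX', e1, e2, hI', h'⟩ := (exists_smul (𝕔 H) (𝕕 X)).choose_spec
  refine differential_eq_of_indist hI' hI (h'.indist_of_eq h ?_ ?_)
  · exact (cls_eq_cls_iff hH' hH).1 e1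
  · exact (differential_eq_iff hX' hX).1 e2

instance : Module (ProcessRing 𝓕 μ) (Differential 𝓕 μ) :=
  Module.ofMinimalAxioms
    (fun a α β => by
      obtain ⟨H, hH, rfl⟩ := exists_cls_eq a
      obtain ⟨X, hX, rfl⟩ := exists_differential_eq α
      obtain ⟨Y, hY, rfl⟩ := exists_differential_eq β
      obtain ⟨I, hI, h⟩ := hX.exists_integral hH
      obtain ⟨J, hJ, h'⟩ := hY.exists_integral hH
      rw [← differential_add hX hY, cls_smul_differential hH hX hI h,
        cls_smul_differential hH hY hJ h', cls_smul_differential hH (hX.add hY) (hI.add hJ)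
        (h.add_right h'), differential_add hI hJ])
    (fun a b α => by
      obtain ⟨H, hH, rfl⟩ := exists_cls_eq a
      obtain ⟨K, hK, rfl⟩ := exists_cls_eq b
      obtain ⟨X, hX, rfl⟩ := exists_differential_eq α
      obtain ⟨I, hI, h⟩ := hX.exists_integral hH
      obtain ⟨J, hJ, h'⟩ := hX.exists_integral hK
      rw [← cls_add hH hK, cls_smul_differential hH hX hI h,
        cls_smul_differential hK hX hJ h', cls_smul_differential (hH.add hK) hX (hI.add hJ)
        (h.add_left h'), differential_add hI hJ])
    (fun a b α => by
      obtain ⟨H, hH, rfl⟩ := exists_cls_eq a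
      obtain ⟨K, hK, rfl⟩ := exists_cls_eq b
      obtain ⟨X, hX, rfl⟩ := exists_differential_eq α
      obtain ⟨I, hI, h⟩ := hX.exists_integral hK
      obtain ⟨J, hJ, h'⟩ := hI.exists_integral hH
      rw [← cls_mul hH hK, cls_smul_differential hK hX hI h, cls_smul_differential hH hI hJ h',
        cls_smul_differential (hH.mul hK) hX hJ (h.to_assoc hX.isGoodIntegrator hK hH h')])
    (fun α => by
      obtain ⟨X, hX, rfl⟩ := exists_differential_eq α
      have h0 : IsContSemimartingale 𝓕 μ (fun t ω => X t ω - X 0 ω) :=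
        hX.sub (.of_isFV (IsFV.of_constTime (hX.1.adapted 0)))
      rw [← cls_one, cls_smul_differential (show IsContAdapted 𝓕 μ 1 from .const 1) hX h0
        (IsRiemannLimit.one X),
        differential_eq_iff h0 hX]
      exact ae_of_all _ fun ω t => by ring)

lemma exists_bracket (α β : Differential 𝓕 μ) : ∃ B X Y, IsContSemimartingale 𝓕 μ X ∧
    IsContSemimartingale 𝓕 μ Y ∧ 𝕕 X = α ∧ 𝕕 Y = β ∧ IsFV 𝓕 μ B ∧ IsCovLimit μ X Y B := by
  obtain ⟨X, hX, rfl⟩ := exists_differential_eq α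
  obtain ⟨Y, hY, rfl⟩ := exists_differential_eq β
  obtain ⟨B, hB, h⟩ := exists_isCovLimit hX hY
  exact ⟨B, X, Y, hX, hY, rfl, rfl, hB, h⟩

lemma bracket_aux (hX : IsContSemimartingale 𝓕 μ X) (hY : IsContSemimartingale 𝓕 μ Y)
    (hB : IsContSemimartingale 𝓕 μ B) (h : IsCovLimit μ X Y B) :
    𝕕 (exists_bracket (𝕕 X) (𝕕 Y)).choose = 𝕕 B := by
  obtain ⟨X', Y', hX', hY', e1, e2, hB', h'⟩ := (exists_bracket (𝕕 X) (𝕕 Y)).choose_spec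
  exact differential_eq_of_indist (.of_isFV hB') hB
    (h'.indist_of_eq h ((differential_eq_iff hX' hX).1 e1) ((differential_eq_iff hY' hY).1 e2))

lemma bracket_aux_comm (α β : Differential 𝓕 μ) :
    𝕕 (exists_bracket α β).choose = 𝕕 (exists_bracket β α).choose := by
  obtain ⟨B, X, Y, hX, hY, rfl, rfl, hB, h⟩ := exists_bracket α β
  rw [bracket_aux hX hY (.of_isFV hB) h, bracket_aux hY hX (.of_isFV hB) h.comm]

lemma bracket_aux_add (α β γ : Differential 𝓕 μ) : 𝕕 (exists_bracket (α + β) γ).choose =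
    𝕕 (exists_bracket α γ).choose + 𝕕 (exists_bracket β γ).choose := by
  obtain ⟨X, hX, rfl⟩ := exists_differential_eq α
  obtain ⟨Y, hY, rfl⟩ := exists_differential_eq β
  obtain ⟨Z, hZ, rfl⟩ := exists_differential_eq γ
  obtain ⟨B, hB, h⟩ := exists_isCovLimit hX hZ
  obtain ⟨B', hB', h'⟩ := exists_isCovLimit hY hZ
  rw [← differential_add hX hY, bracket_aux hX hZ (.of_isFV hB) h,
    bracket_aux hY hZ (.of_isFV hB') h', bracket_aux (hX.add hY) hZ (.of_isFV (hB.add hB'))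
      (h.add_left h'), differential_add (.of_isFV hB) (.of_isFV hB')]

lemma bracket_aux_smul (a : ProcessRing 𝓕 μ) (α β : Differential 𝓕 μ) :
    𝕕 (exists_bracket (a • α) β).choose = a • 𝕕 (exists_bracket α β).choose := by
  obtain ⟨H, hH, rfl⟩ := exists_cls_eq a
  obtain ⟨X, hX, rfl⟩ := exists_differential_eq α
  obtain ⟨Y, hY, rfl⟩ := exists_differential_eq β
  obtain ⟨I, hI, hI'⟩ := hX.exists_integral hH
  obtain ⟨B, hB, h⟩ := exists_isCovLimit hX hY
  have hBs := IsContSemimartingale.of_isFV hB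
  obtain ⟨J, hJ, hJ'⟩ := hBs.exists_integral hH
  rw [cls_smul_differential hH hX hI hI', bracket_aux hX hY hBs h,
    cls_smul_differential hH hBs hJ hJ', bracket_aux hI hY hJ (h.integral hX hY hH hI' hI.1 hJ')]

variable (𝓕 μ) in
/-- The covariation bracket `d⟨X, Y⟩` as a bilinear map on stochastic differentials; bilinearity
over processes is the Kunita–Watanabe identity. -/
def bracket : Differential 𝓕 μ →ₗ[ProcessRing 𝓕 μ] Differential 𝓕 μ →ₗ[ProcessRing 𝓕 μ]
    Differential 𝓕 μ :=
  LinearMap.mk₂ _ (fun α β => 𝕕 (exists_bracket α β).choose) bracket_aux_add bracket_aux_smul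
    (fun α β γ => by
      rw [bracket_aux_comm, bracket_aux_add, bracket_aux_comm β, bracket_aux_comm γ])
    (fun a α β => by rw [bracket_aux_comm, bracket_aux_smul, bracket_aux_comm β])

lemma bracket_differential (hX : IsContSemimartingale 𝓕 μ X) (hY : IsContSemimartingale 𝓕 μ Y)
    (hB : IsContSemimartingale 𝓕 μ B) (h : IsCovLimit μ X Y B) :
    bracket 𝓕 μ (𝕕 X) (𝕕 Y) = 𝕕 B := bracket_aux hX hY hB h

lemma bracket_comm (α β : Differential 𝓕 μ) : bracket 𝓕 μ α β = bracket 𝓕 μ β α :=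
  bracket_aux_comm α β

/-- Covariations have finite variation, hence no covariation with anything. -/
lemma bracket_bracket (α β γ : Differential 𝓕 μ) :
    bracket 𝓕 μ γ (bracket 𝓕 μ α β) = 0 := by
  obtain ⟨B, X, Y, hX, hY, rfl, rfl, hB, h⟩ := exists_bracket α β
  obtain ⟨Z, hZ, rfl⟩ := exists_differential_eq γ
  have hBs := IsContSemimartingale.of_isFV hB
  rw [bracket_differential hX hY hBs h]
  obtain ⟨C, hC, hC'⟩ := exists_isCovLimit hZ hBs
  rw [bracket_differential hZ hBs (.of_isFV hC) hC',
    differential_eq_of_indist (.of_isFV hC) (.const 0) (hC'.eq_zero_of_isFV hZ.1 hB)]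
  exact differential_const 0

/-- The product rule. -/
lemma differential_mul (hX : IsContSemimartingale 𝓕 μ X) (hY : IsContSemimartingale 𝓕 μ Y) :
    𝕕 (X * Y) = 𝕔 X • 𝕕 Y + 𝕔 Y • 𝕕 X + bracket 𝓕 μ (𝕕 X) (𝕕 Y) := by
  obtain ⟨I, hI, hI'⟩ := hY.exists_integral hX.1
  obtain ⟨J, hJ, hJ'⟩ := hX.exists_integral hY.1
  obtain ⟨B, hB, h⟩ := exists_isCovLimit hX hY
  have hBs := IsContSemimartingale.of_isFV hB
  have hξ := (hX.1.adapted 0).mul (hY.1.adapted 0)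
  have h0 : IsContSemimartingale 𝓕 μ fun _ => X 0 * Y 0 := .of_isFV (IsFV.of_constTime hξ)
  rw [cls_smul_differential hX.1 hY hI hI', cls_smul_differential hY.1 hX hJ hJ',
    bracket_differential hX hY hBs h, differential_eq_of_indist (hX.mul hY)
    (((h0.add hI).add hJ).add hBs) (h.parts hI' hJ'), differential_add ((h0.add hI).add hJ) hBs,
    differential_add (h0.add hI) hJ, differential_add h0 hI, differential_constTime hξ, zero_add]

/-- Itô's formula in differential form. -/
lemma differential_comp {f f' f'' : ℝ → ℝ} (hf : HasUniformTaylor f f' f'')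
    (hX : IsContSemimartingale 𝓕 μ X) (hpos : ∀ᵐ ω ∂μ, ∀ t, 0 < X t ω)
    (hf0 : StronglyAdapted 𝓕 fun t ω => f (X t ω))
    (hf' : IsContAdapted 𝓕 μ fun t ω => f' (X t ω))
    (hf'' : IsContAdapted 𝓕 μ fun t ω => f'' (X t ω)) :
    IsContSemimartingale 𝓕 μ (fun t ω => f (X t ω)) ∧
    𝕕 (fun t ω => f (X t ω)) = 𝕔 (fun t ω => f' (X t ω)) • 𝕕 X +
      (algebraMap ℝ (ProcessRing 𝓕 μ) (1 / 2) * 𝕔 fun t ω => f'' (X t ω)) •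
        bracket 𝓕 μ (𝕕 X) (𝕕 X) := by
  obtain ⟨B, hB, h⟩ := exists_isCovLimit hX hX
  have hBs := IsContSemimartingale.of_isFV hB
  obtain ⟨I, hI, hI'⟩ := hX.exists_integral hf'
  obtain ⟨J, hJ, hJ'⟩ := hBs.exists_integral hf''
  have h0 : IsContSemimartingale 𝓕 μ fun _ ω => f (X 0 ω) := .of_isFV (IsFV.of_constTime (hf0 0))
  have hsum := ((h0.add hI).add (hJ.smul (1 / 2)))
  have hito : Indist μ (fun t ω => f (X t ω)) ((fun _ ω => f (X 0 ω)) + I + (1 / 2 : ℝ) • J) :=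
    ito_formula hf hX hpos hf' hf'' h hI' hJ'
  have hs := hsum.congr hf0 hito.symm
  refine ⟨hs, ?_⟩
  have hhalf : algebraMap ℝ (ProcessRing 𝓕 μ) (1 / 2) • 𝕕 J = 𝕕 ((1 / 2 : ℝ) • J) := by
    rw [← cls_const]
    refine cls_smul_differential (IsContAdapted.const _) hJ (hJ.smul _) ?_
    have h1 := (IsRiemannLimit.one (μ := μ) J).smul_left (1 / 2)
    have e1 : ((1 / 2 : ℝ) • (1 : ℝ≥0 → Ω → ℝ)) = fun _ _ => 1 / 2 := by
      funext t ω; simp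
    rw [e1] at h1
    refine h1.congr (Indist.refl _) (Indist.refl _) ?_
    filter_upwards [hJ'.null_zero] with ω hω t
    simp [hω]
  rw [mul_smul, bracket_differential hX hX hBs h, cls_smul_differential hf' hX hI hI',
    cls_smul_differential hf'' hBs hJ hJ', hhalf,
    differential_eq_of_indist hs hsum hito, differential_add (h0.add hI) (hJ.smul _),
    differential_add h0 hI, differential_constTime (hf0 0), zero_add]

end Differentials

/-! ### Logarithmic differentials with bounded coefficients -/

section Taylor

lemma hasUniformTaylor_inv :
    HasUniformTaylor (fun x => x⁻¹) (fun x => -(x⁻¹) ^ 2) (fun x => 2 * (x⁻¹) ^ 3) := by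
  intro a b ha ε hε
  refine ⟨ε * a ^ 4, by positivity, fun x hx y hy hxy => ?_⟩
  have hx0 : 0 < x := ha.trans_le hx.1
  have hy0 : 0 < y := ha.trans_le hy.1
  have e : y⁻¹ - x⁻¹ - -(x⁻¹) ^ 2 * (y - x) - 1 / 2 * (2 * (x⁻¹) ^ 3 * (y - x) ^ 2) =
      -(y - x) * (y - x) ^ 2 / (x ^ 3 * y) := by
    field_simp
    ring
  rw [e, abs_div, abs_mul, abs_neg, abs_of_pos (a := x ^ 3 * y) (by positivity), abs_sq,
    div_le_iff₀ (by positivity)]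
  have h1 : a ^ 4 ≤ x ^ 3 * y := by
    calc a ^ 4 = a ^ 3 * a := by ring
      _ ≤ x ^ 3 * y := mul_le_mul (pow_le_pow_left₀ ha.le hx.1 3) hy.1 ha.le (by positivity)
  calc |y - x| * (y - x) ^ 2 ≤ ε * a ^ 4 * (y - x) ^ 2 := by gcongr
    _ ≤ ε * (x ^ 3 * y) * (y - x) ^ 2 := by gcongr
    _ = _ := by ring

lemma hasUniformTaylor_log :
    HasUniformTaylor Real.log (fun x => x⁻¹) (fun x => -(x⁻¹) ^ 2) := by
  intro a b ha ε hε
  refine ⟨min (a / 2) (ε * a ^ 3 / 2), by positivity, fun x hx y hy hxy => ?_⟩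
  have hx0 : 0 < x := ha.trans_le hx.1
  have hy0 : 0 < y := ha.trans_le hy.1
  have h1 : |y - x| < a / 2 := hxy.trans_le (min_le_left _ _)
  have h2 : |y - x| < ε * a ^ 3 / 2 := hxy.trans_le (min_le_right _ _)
  set u := (x - y) / x with hu
  have hu1 : |u| ≤ 1 / 2 := by
    rw [hu, abs_div, abs_of_pos hx0, div_le_iff₀ hx0, abs_sub_comm]
    linarith [hx.1]
  have h3 := Real.abs_log_sub_add_sum_range_le (x := u) (by linarith) 2
  have e1 : 1 - u = y / x := by rw [hu]; field_simp; ring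
  rw [e1, Real.log_div hy0.ne' hx0.ne', Finset.sum_range_succ, Finset.sum_range_one] at h3
  have e : Real.log y - Real.log x - x⁻¹ * (y - x) - 1 / 2 * (-(x⁻¹) ^ 2 * (y - x) ^ 2) =
      u ^ (0 + 1) / ((0 : ℕ) + 1) + u ^ (1 + 1) / ((1 : ℕ) + 1) + (Real.log y - Real.log x) := by
    rw [hu]
    push_cast
    field_simp
    ring
  rw [e]
  refine h3.trans ?_
  have h4 : |u| ^ (2 + 1) / (1 - |u|) ≤ 2 * |u| ^ 3 := by
    rw [div_le_iff₀ (by linarith)]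
    have := mul_nonneg (pow_nonneg (abs_nonneg u) 3) (sub_nonneg.2 hu1)
    rw [show 2 + 1 = 3 from rfl]
    linarith
  refine h4.trans ?_
  have h5 : |u| ^ 3 = |y - x| * (y - x) ^ 2 / x ^ 3 := by
    rw [hu, abs_div, abs_of_pos hx0, abs_sub_comm, div_pow, ← sq_abs (y - x)]
    ring
  rw [h5, ← mul_div_assoc, div_le_iff₀ (by positivity)]
  have h6 : a ^ 3 ≤ x ^ 3 := pow_le_pow_left₀ ha.le hx.1 3
  calc 2 * (|y - x| * (y - x) ^ 2) ≤ 2 * (ε * a ^ 3 / 2 * (y - x) ^ 2) := by gcongr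
    _ = ε * (y - x) ^ 2 * a ^ 3 := by ring
    _ ≤ _ := by gcongr

end Taylor

section LogRegular

variable {Ω : Type*} {mΩ : MeasurableSpace Ω} {𝓕 : Filtration ℝ≥0 mΩ} {μ : Measure Ω}
  [IsFiniteMeasure μ] [ContainsNullSets 𝓕 μ] {G G' H X : ℝ≥0 → Ω → ℝ}

local notation "𝕕" => differential 𝓕 μ
local notation "𝕔" => cls 𝓕 μ
local notation "⟪" α ", " β "⟫" => bracket 𝓕 μ α β

omit [IsFiniteMeasure μ] [ContainsNullSets 𝓕 μ] in
lemma cls_mul_cls_inv (hX : IsContAdapted 𝓕 μ X) (h : ∀ᵐ ω ∂μ, ∀ t, 0 < X t ω) :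
    𝕔 X * 𝕔 X⁻¹ = 1 := by
  have hne : ∀ᵐ ω ∂μ, ∀ t, X t ω ≠ 0 := h.mono fun ω hω t => (hω t).ne'
  rw [← cls_mul hX (hX.inv hne), ← cls_one,
    cls_eq_cls_iff (hX.mul (hX.inv hne)) (show IsContAdapted 𝓕 μ 1 from .const 1)]
  filter_upwards [hne] with ω hω t using mul_inv_cancel₀ (hω t)

omit [IsFiniteMeasure μ] [ContainsNullSets 𝓕 μ] in
lemma IsContAdapted.inv_of_pos (hX : IsContAdapted 𝓕 μ X) (h : ∀ᵐ ω ∂μ, ∀ t, 0 < X t ω) :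
    IsContAdapted 𝓕 μ X⁻¹ := hX.inv (h.mono fun _ hω t => (hω t).ne')

lemma IsContSemimartingale.inv_and_differential (hX : IsContSemimartingale 𝓕 μ X)
    (h : ∀ᵐ ω ∂μ, ∀ t, 0 < X t ω) : IsContSemimartingale 𝓕 μ X⁻¹ ∧
      𝕕 X⁻¹ = -(𝕔 X⁻¹ ^ 2) • 𝕕 X + 𝕔 X⁻¹ ^ 3 • ⟪𝕕 X, 𝕕 X⟫ := by
  have hc := hX.1.inv_of_pos h
  have e2 : (fun t ω => -((X t ω)⁻¹) ^ 2) = -(X⁻¹ * X⁻¹) := by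
    funext t ω; simp [sq]
  have e3 : (fun t ω => 2 * ((X t ω)⁻¹) ^ 3) = (fun _ _ => 2) * (X⁻¹ * X⁻¹ * X⁻¹) := by
    funext t ω; simp [pow_succ]
  have h2 : IsContAdapted 𝓕 μ fun t ω => -((X t ω)⁻¹) ^ 2 := by
    rw [e2]; exact (hc.mul hc).neg
  have h3 : IsContAdapted 𝓕 μ fun t ω => 2 * ((X t ω)⁻¹) ^ 3 := by
    rw [e3]; exact (IsContAdapted.const 2).mul ((hc.mul hc).mul hc)
  obtain ⟨hs, hd⟩ := differential_comp hasUniformTaylor_inv hX h hc.adapted h2 h3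
  refine ⟨hs, hd.trans ?_⟩
  have c2 : 𝕔 (-(X⁻¹ * X⁻¹)) = -(𝕔 X⁻¹ ^ 2) := by
    rw [eq_neg_iff_add_eq_zero, sq, ← cls_mul hc hc, ← cls_add (hc.mul hc).neg (hc.mul hc),
      neg_add_cancel, ← map_zero (algebraMap ℝ (ProcessRing 𝓕 μ)), ← cls_const]
    rfl
  have hhalf : algebraMap ℝ (ProcessRing 𝓕 μ) (1 / 2) * algebraMap ℝ (ProcessRing 𝓕 μ) 2 = 1 := by
    rw [← map_mul]; norm_num
  rw [e2, e3, c2, cls_mul (IsContAdapted.const 2) ((hc.mul hc).mul hc), cls_mul (hc.mul hc) hc,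
    cls_mul hc hc, cls_const, ← mul_assoc, hhalf]
  module

lemma IsContSemimartingale.inv (hX : IsContSemimartingale 𝓕 μ X)
    (h : ∀ᵐ ω ∂μ, ∀ t, 0 < X t ω) : IsContSemimartingale 𝓕 μ X⁻¹ :=
  (hX.inv_and_differential h).1

lemma IsContSemimartingale.log_and_differential (hX : IsContSemimartingale 𝓕 μ X)
    (h : ∀ᵐ ω ∂μ, ∀ t, 0 < X t ω) : IsContSemimartingale 𝓕 μ (fun t ω => Real.log (X t ω)) ∧
      𝕕 (fun t ω => Real.log (X t ω)) = 𝕔 X⁻¹ • 𝕕 X -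
        (algebraMap ℝ (ProcessRing 𝓕 μ) (1 / 2) * 𝕔 X⁻¹ ^ 2) • ⟪𝕕 X, 𝕕 X⟫ := by
  have hc := hX.1.inv_of_pos h
  have e2 : (fun t ω => -((X t ω)⁻¹) ^ 2) = -(X⁻¹ * X⁻¹) := by
    funext t ω; simp [sq]
  have h2 : IsContAdapted 𝓕 μ fun t ω => -((X t ω)⁻¹) ^ 2 := by
    rw [e2]; exact (hc.mul hc).neg
  obtain ⟨hs, hd⟩ := differential_comp hasUniformTaylor_log hX h (hX.1.log h).adapted hc h2
  refine ⟨hs, hd.trans ?_⟩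
  have c2 : 𝕔 (-(X⁻¹ * X⁻¹)) = -(𝕔 X⁻¹ ^ 2) := by
    rw [eq_neg_iff_add_eq_zero, sq, ← cls_mul hc hc, ← cls_add (hc.mul hc).neg (hc.mul hc),
      neg_add_cancel, ← map_zero (algebraMap ℝ (ProcessRing 𝓕 μ)), ← cls_const]
    rfl
  have c1 : 𝕔 (fun t ω => (X t ω)⁻¹) = 𝕔 X⁻¹ := rfl
  rw [e2, c2, c1]
  module

variable (𝓕 μ) in
/-- The ring of bounded continuous adapted processes, up to indistinguishability. -/
def boundedProcesses : Subring (ProcessRing 𝓕 μ) where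
  carrier := {a | ∃ H, IsContAdapted 𝓕 μ H ∧ IsBoundedProcess μ H ∧ 𝕔 H = a}
  mul_mem' := by
    rintro _ _ ⟨H, hH, ⟨C, hC⟩, rfl⟩ ⟨K, hK, ⟨D, hD⟩, rfl⟩
    refine ⟨H * K, hH.mul hK, ⟨C * D, ?_⟩, cls_mul hH hK⟩
    filter_upwards [hC, hD] with ω h1 h2 t
    rw [Pi.mul_apply, Pi.mul_apply, abs_mul]
    exact mul_le_mul (h1 t) (h2 t) (abs_nonneg _) ((abs_nonneg _).trans (h1 t))
  add_mem' := by
    rintro _ _ ⟨H, hH, ⟨C, hC⟩, rfl⟩ ⟨K, hK, ⟨D, hD⟩, rfl⟩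
    refine ⟨H + K, hH.add hK, ⟨C + D, ?_⟩, cls_add hH hK⟩
    filter_upwards [hC, hD] with ω h1 h2 t
    exact (abs_add_le _ _).trans (add_le_add (h1 t) (h2 t))
  neg_mem' := by
    rintro _ ⟨H, hH, ⟨C, hC⟩, rfl⟩
    refine ⟨-H, hH.neg, ⟨C, ?_⟩, ?_⟩
    · filter_upwards [hC] with ω h1 t
      rw [Pi.neg_apply, Pi.neg_apply, abs_neg]
      exact h1 t
    · rw [eq_neg_iff_add_eq_zero, ← cls_add hH.neg hH, neg_add_cancel,
        ← map_zero (algebraMap ℝ (ProcessRing 𝓕 μ)), ← cls_const]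
      rfl
  one_mem' := ⟨1, IsContAdapted.const 1, ⟨1, ae_of_all _ fun _ _ => by simp⟩, cls_one⟩
  zero_mem' := ⟨0, IsContAdapted.const 0, ⟨0, ae_of_all _ fun _ _ => by simp⟩, by
    rw [← map_zero (algebraMap ℝ (ProcessRing 𝓕 μ)), ← cls_const]; rfl⟩

omit [IsFiniteMeasure μ] [ContainsNullSets 𝓕 μ] in
lemma cls_mem_boundedProcesses (hH : IsContAdapted 𝓕 μ H) (hb : IsBoundedProcess μ H) :
    𝕔 H ∈ boundedProcesses 𝓕 μ := ⟨H, hH, hb, rfl⟩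

omit [IsFiniteMeasure μ] [ContainsNullSets 𝓕 μ] in
lemma algebraMap_mem_boundedProcesses (c : ℝ) :
    algebraMap ℝ (ProcessRing 𝓕 μ) c ∈ boundedProcesses 𝓕 μ :=
  ⟨_, IsContAdapted.const c, ⟨|c|, ae_of_all _ fun _ _ => le_rfl⟩, cls_const c⟩

variable {ι : Type*} {s : Finset ι} {y : ι → ℝ≥0 → Ω → ℝ}

variable (𝓕 μ s y) in
/-- Differentials `∑ Xᵢ dyᵢ + ∑ Yᵢₖ d⟨yᵢ, yₖ⟩` with bounded continuous adapted coefficients. -/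
def boundedDifferentials : Submodule (boundedProcesses 𝓕 μ) (Differential 𝓕 μ) :=
  Submodule.span _ ({α | ∃ i ∈ s, α = 𝕕 (y i)} ∪
    {α | ∃ i ∈ s, ∃ k ∈ s, α = ⟪𝕕 (y i), 𝕕 (y k)⟫})

lemma smul_mem_boundedDifferentials {a : ProcessRing 𝓕 μ} {β : Differential 𝓕 μ}
    (ha : a ∈ boundedProcesses 𝓕 μ) (hβ : β ∈ boundedDifferentials 𝓕 μ s y) :
    a • β ∈ boundedDifferentials 𝓕 μ s y :=
  (boundedDifferentials 𝓕 μ s y).smul_mem ⟨a, ha⟩ hβ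

lemma bracket_mem_boundedDifferentials {α β : Differential 𝓕 μ}
    (hα : α ∈ boundedDifferentials 𝓕 μ s y) (hβ : β ∈ boundedDifferentials 𝓕 μ s y) :
    ⟪α, β⟫ ∈ boundedDifferentials 𝓕 μ s y := by
  induction hα using Submodule.span_induction with
  | zero => rw [map_zero]; exact zero_mem _
  | add x z _ _ hx hz => rw [map_add]; exact add_mem hx hz
  | smul a x _ hx =>
    rw [Subring.smul_def, map_smul]
    exact smul_mem_boundedDifferentials a.2 hx
  | mem x hx =>
    induction hβ using Submodule.span_induction with
    | zero => rw [map_zero]; exact zero_mem _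
    | add u z _ _ hu hz => rw [map_add]; exact add_mem hu hz
    | smul a u _ hu =>
      rw [Subring.smul_def, map_smul]
      exact smul_mem_boundedDifferentials a.2 hu
    | mem z hz =>
      rcases hx with ⟨i, hi, rfl⟩ | ⟨i, hi, k, hk, rfl⟩
      · rcases hz with ⟨j, hj, rfl⟩ | ⟨j, hj, l, hl, rfl⟩
        · exact Submodule.subset_span (Or.inr ⟨i, hi, j, hj, rfl⟩)
        · rw [bracket_bracket]; exact zero_mem _
      · rw [bracket_comm, bracket_bracket]; exact zero_mem _

/-- The members of `boundedDifferentials` written out with their coefficient processes. -/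
lemma exists_of_mem_boundedDifferentials [DecidableEq ι] {β : Differential 𝓕 μ}
    (hβ : β ∈ boundedDifferentials 𝓕 μ s y) :
    ∃ (X : ι → ℝ≥0 → Ω → ℝ) (Y : ι → ι → ℝ≥0 → Ω → ℝ),
      (∀ i, IsContAdapted 𝓕 μ (X i) ∧ IsBoundedProcess μ (X i)) ∧
      (∀ i k, IsContAdapted 𝓕 μ (Y i k) ∧ IsBoundedProcess μ (Y i k)) ∧
      β = ∑ i ∈ s, 𝕔 (X i) • 𝕕 (y i) + ∑ i ∈ s, ∑ k ∈ s, 𝕔 (Y i k) • ⟪𝕕 (y i), 𝕕 (y k)⟫ := by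
  suffices h : ∃ (a : ι → boundedProcesses 𝓕 μ) (b : ι → ι → boundedProcesses 𝓕 μ),
      β = ∑ i ∈ s, (a i : ProcessRing 𝓕 μ) • 𝕕 (y i) +
        ∑ i ∈ s, ∑ k ∈ s, (b i k : ProcessRing 𝓕 μ) • ⟪𝕕 (y i), 𝕕 (y k)⟫ by
    obtain ⟨a, b, h⟩ := h
    choose X hX hXb hXa using fun i => (a i).2
    choose Y hY hYb hYb' using fun i k => (b i k).2
    exact ⟨X, Y, fun i => ⟨hX i, hXb i⟩, fun i k => ⟨hY i k, hYb i k⟩, by simp only [hXa, hYb', h]⟩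
  induction hβ using Submodule.span_induction with
  | zero => exact ⟨0, 0, by simp⟩
  | add u v _ _ hu hv =>
    obtain ⟨a, b, rfl⟩ := hu
    obtain ⟨a', b', rfl⟩ := hv
    refine ⟨a + a', b + b', ?_⟩
    simp only [Pi.add_apply, Subring.coe_add, add_smul, Finset.sum_add_distrib]
    abel
  | smul c u _ hu =>
    obtain ⟨a, b, rfl⟩ := hu
    refine ⟨fun i => c * a i, fun i k => c * b i k, ?_⟩
    simp only [Subring.smul_def, Subring.coe_mul, mul_smul, Finset.smul_sum, smul_add]
  | mem u hu =>
    rcases hu with ⟨i, hi, rfl⟩ | ⟨i, hi, k, hk, rfl⟩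
    · refine ⟨Pi.single i 1, 0, ?_⟩
      rw [Finset.sum_eq_single_of_mem i hi fun j _ hj => by simp [hj]]
      simp
    · refine ⟨0, Pi.single i (Pi.single k 1), ?_⟩
      rw [Finset.sum_eq_zero fun j _ => by simp, zero_add, Finset.sum_eq_single_of_mem i hi
        fun j _ hj => by simp [hj], Pi.single_eq_same, Finset.sum_eq_single_of_mem k hk
        fun j _ hj => by simp [hj]]
      simp

variable (𝓕 μ s y) in
/-- Positive semimartingales `G` whose logarithmic differential `dG / G` has bounded coefficients
with respect to the `dyᵢ` and `d⟨yᵢ, yₖ⟩`. -/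
structure IsLogRegular (G : ℝ≥0 → Ω → ℝ) : Prop where
  semimartingale : IsContSemimartingale 𝓕 μ G
  pos : ∀ᵐ ω ∂μ, ∀ t, 0 < G t ω
  differential : ∃ β ∈ boundedDifferentials 𝓕 μ s y, 𝕕 G = 𝕔 G • β

namespace IsLogRegular

lemma const {c : ℝ} (hc : 0 < c) : IsLogRegular 𝓕 μ s y fun _ _ => c :=
  ⟨.const c, ae_of_all _ fun _ _ => hc, 0, zero_mem _, by rw [differential_const, smul_zero]⟩

lemma congr (hG : IsLogRegular 𝓕 μ s y G) (hG' : StronglyAdapted 𝓕 G') (h : Indist μ G G') :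
    IsLogRegular 𝓕 μ s y G' := by
  obtain ⟨β, hβ, e⟩ := hG.differential
  have hs := hG.semimartingale.congr hG' h
  refine ⟨hs, ?_, β, hβ, ?_⟩
  · filter_upwards [hG.pos, h] with ω h1 h2 t
    rw [← h2]; exact h1 t
  · rw [← differential_eq_of_indist hG.semimartingale hs h, e,
      (cls_eq_cls_iff hG.semimartingale.1 hs.1).2 h]

lemma mul (hG : IsLogRegular 𝓕 μ s y G) (hG' : IsLogRegular 𝓕 μ s y G') :
    IsLogRegular 𝓕 μ s y (G * G') := by
  obtain ⟨β, hβ, e⟩ := hG.differential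
  obtain ⟨β', hβ', e'⟩ := hG'.differential
  refine ⟨hG.semimartingale.mul hG'.semimartingale, ?_, β' + β + ⟪β, β'⟫,
    add_mem (add_mem hβ' hβ) (bracket_mem_boundedDifferentials hβ hβ'), ?_⟩
  · filter_upwards [hG.pos, hG'.pos] with ω h1 h2 t using mul_pos (h1 t) (h2 t)
  · rw [differential_mul hG.semimartingale hG'.semimartingale, e, e',
      cls_mul hG.semimartingale.1 hG'.semimartingale.1, map_smul, map_smul, LinearMap.smul_apply]
    module

lemma inv (hG : IsLogRegular 𝓕 μ s y G) : IsLogRegular 𝓕 μ s y G⁻¹ := by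
  obtain ⟨β, hβ, e⟩ := hG.differential
  obtain ⟨hs, hd⟩ := hG.semimartingale.inv_and_differential hG.pos
  have h1 := cls_mul_cls_inv hG.semimartingale.1 hG.pos
  refine ⟨hs, ?_, -β + ⟪β, β⟫, add_mem (neg_mem hβ) (bracket_mem_boundedDifferentials hβ hβ), ?_⟩
  · filter_upwards [hG.pos] with ω h1 t using inv_pos.2 (h1 t)
  · rw [hd, e, map_smul, map_smul, LinearMap.smul_apply]
    have h2 : 𝕔 G⁻¹ ^ 2 * 𝕔 G = 𝕔 G⁻¹ := by linear_combination 𝕔 G⁻¹ * h1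
    have h3 : 𝕔 G⁻¹ ^ 3 * 𝕔 G * 𝕔 G = 𝕔 G⁻¹ := by
      linear_combination (𝕔 G⁻¹ ^ 2 * 𝕔 G + 𝕔 G⁻¹) * h1
    rw [smul_smul, smul_smul, smul_smul, h3, neg_mul, h2]
    module

lemma bounded_ratio (hG : IsLogRegular 𝓕 μ s y G) (hG' : IsLogRegular 𝓕 μ s y G') :
    ∃ a ∈ boundedProcesses 𝓕 μ, 𝕔 (G + G') * a = 𝕔 G := by
  have hpos : ∀ᵐ ω ∂μ, ∀ t, 0 < (G + G') t ω := by
    filter_upwards [hG.pos, hG'.pos] with ω h1 h2 t using add_pos (h1 t) (h2 t)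
  have hs := hG.semimartingale.1.add hG'.semimartingale.1
  have hi := hs.inv_of_pos hpos
  refine ⟨𝕔 (G * (G + G')⁻¹), cls_mem_boundedProcesses (hG.semimartingale.1.mul hi) ⟨1, ?_⟩, ?_⟩
  · filter_upwards [hG.pos, hG'.pos] with ω h1 h2 t
    have h1 := h1 t
    have h2 := h2 t
    simp only [Pi.mul_apply, Pi.inv_apply, Pi.add_apply]
    rw [abs_of_pos (by positivity), ← div_eq_mul_inv, div_le_one (by positivity)]
    linarith
  · rw [cls_mul hG.semimartingale.1 hi]
    linear_combination 𝕔 G * cls_mul_cls_inv hs hpos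

lemma add (hG : IsLogRegular 𝓕 μ s y G) (hG' : IsLogRegular 𝓕 μ s y G') :
    IsLogRegular 𝓕 μ s y (G + G') := by
  obtain ⟨β, hβ, e⟩ := hG.differential
  obtain ⟨β', hβ', e'⟩ := hG'.differential
  obtain ⟨a, ha, h⟩ := hG.bounded_ratio hG'
  obtain ⟨a', ha', h'⟩ := hG'.bounded_ratio hG
  rw [add_comm] at h'
  refine ⟨hG.semimartingale.add hG'.semimartingale, ?_, a • β + a' • β',
    add_mem (smul_mem_boundedDifferentials ha hβ) (smul_mem_boundedDifferentials ha' hβ'), ?_⟩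
  · filter_upwards [hG.pos, hG'.pos] with ω h1 h2 t using add_pos (h1 t) (h2 t)
  · rw [differential_add hG.semimartingale hG'.semimartingale, e, e', smul_add, smul_smul,
      smul_smul, h, h']

lemma sum {κ : Type*} {u : Finset κ} (hu : u.Nonempty) {G : κ → ℝ≥0 → Ω → ℝ}
    (h : ∀ k ∈ u, IsLogRegular 𝓕 μ s y (G k)) : IsLogRegular 𝓕 μ s y (∑ k ∈ u, G k) := by
  classical
  induction hu using Finset.Nonempty.cons_induction with
  | singleton k => simpa using h k
  | cons k u hk hu ih =>
    rw [Finset.sum_cons]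
    exact (h k (by simp)).add (ih fun j hj => h j (by simp [hj]))

lemma prod {κ : Type*} {u : Finset κ} {G : κ → ℝ≥0 → Ω → ℝ}
    (h : ∀ k ∈ u, IsLogRegular 𝓕 μ s y (G k)) : IsLogRegular 𝓕 μ s y (∏ k ∈ u, G k) := by
  classical
  induction u using Finset.induction_on with
  | empty => exact const one_pos
  | insert k u hk ih =>
    rw [Finset.prod_insert hk]
    exact (h k (by simp)).mul (ih fun j hj => h j (by simp [hj]))

end IsLogRegular

/-- With `y = log R`, `dR = R dy + ½ R d⟨y, y⟩`. -/
lemma differential_eq_log {R : ℝ≥0 → Ω → ℝ} (hR : IsContSemimartingale 𝓕 μ R)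
    (h : ∀ᵐ ω ∂μ, ∀ t, 0 < R t ω) :
    𝕕 R = 𝕔 R • (𝕕 (fun t ω => Real.log (R t ω)) + algebraMap ℝ (ProcessRing 𝓕 μ) (1 / 2) •
      ⟪𝕕 (fun t ω => Real.log (R t ω)), 𝕕 (fun t ω => Real.log (R t ω))⟫) := by
  obtain ⟨hs, hd⟩ := hR.log_and_differential h
  have h1 := cls_mul_cls_inv hR.1 h
  have e : ⟪𝕕 (fun t ω => Real.log (R t ω)), 𝕕 (fun t ω => Real.log (R t ω))⟫ =
      (𝕔 R⁻¹ ^ 2) • ⟪𝕕 R, 𝕕 R⟫ := by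
    rw [hd]
    simp only [map_sub, map_smul, LinearMap.sub_apply, LinearMap.smul_apply, bracket_bracket,
      bracket_comm ⟪𝕕 R, 𝕕 R⟫, smul_zero, sub_zero, smul_smul, sq]
  rw [e, hd]
  refine ((one_smul (ProcessRing 𝓕 μ) (𝕕 R)).symm.trans ?_)
  rw [← h1]
  module

/-- Each `R i` is regular with respect to its logarithm: `dR / R = d log R + d⟨log R⟩ / 2`. -/
lemma isLogRegular_of_log {R : ι → ℝ≥0 → Ω → ℝ} {i : ι} (hi : i ∈ s)
    (hR : IsContSemimartingale 𝓕 μ (R i)) (h : ∀ᵐ ω ∂μ, ∀ t, 0 < R i t ω) :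
    IsLogRegular 𝓕 μ s (fun i t ω => Real.log (R i t ω)) (R i) :=
  ⟨hR, h, _, add_mem (Submodule.subset_span (Or.inl ⟨i, hi, rfl⟩))
    (smul_mem_boundedDifferentials (algebraMap_mem_boundedProcesses _)
      (Submodule.subset_span (Or.inr ⟨i, hi, i, hi, rfl⟩))), differential_eq_log hR h⟩

end LogRegular

/-! ### Positive martingales and change of numeraire -/

section Numeraire

variable {Ω : Type*} {mΩ : MeasurableSpace Ω} {𝓕 : Filtration ℝ≥0 mΩ} {μ : Measure Ω}
  {Z D N : ℝ≥0 → Ω → ℝ}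

/-- A continuous martingale that is positive at time `u` is positive before `u`: the mean of its
terminal value over the event of having come below `ε` before is at most `ε`. -/
theorem ae_pos_of_martingale [IsFiniteMeasure μ] [ContainsNullSets 𝓕 μ] (hM : Martingale Z 𝓕 μ)
    (hc : IsContAdapted 𝓕 μ Z) {u : ℝ≥0} (hu : ∀ᵐ ω ∂μ, 0 < Z u ω) :
    ∀ᵐ ω ∂μ, ∀ t ≤ u, 0 < Z t ω := by
  obtain ⟨Z', hZ', hZc, hZZ'⟩ := hc.exists_version
  have hM' : Martingale Z' 𝓕 μ := hM.congr hZ' fun t => by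
    filter_upwards [hZZ'] with ω hω using hω t
  have hu' : ∀ᵐ ω ∂μ, 0 < Z' u ω := by
    filter_upwards [hu, hZZ'] with ω h1 h2
    rw [← h2]; exact h1
  -- `|W|` reaches the level `1 - ε` exactly when `Z'` comes down to `ε`.
  let W : ℝ≥0 → Ω → ℝ := fun t ω => max (1 - Z' t ω) 0
  have hW : StronglyAdapted 𝓕 W := fun t =>
    ((continuous_const.sub continuous_id).max continuous_const).comp_stronglyMeasurable (hZ' t)
  have hWc : ∀ ω, Continuous fun t => W t ω := fun ω =>
    (continuous_const.sub (hZc ω)).max continuous_const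
  have hWle : ∀ {ε : ℝ}, ε < 1 → ∀ t ω, 1 - ε ≤ |W t ω| ↔ Z' t ω ≤ ε := by
    intro ε hε t ω
    simp only [W, abs_of_nonneg (le_max_right (1 - Z' t ω) 0), le_max_iff]
    constructor
    · rintro (h | h) <;> linarith
    · intro h; left; linarith
  let S : ℝ → Set Ω := fun ε => {ω | hittingTime W (1 - ε) ω ≤ u}
  have hS : ∀ ε, MeasurableSet (S ε) := fun ε =>
    𝓕.le u _ (isStoppingTime_hittingTime hW hWc (1 - ε) u)
  have hint : ∀ ε : ℝ, 0 < ε → ε < 1 → ∫ ω in S ε, Z' u ω ∂μ ≤ ε * μ.real Set.univ := by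
    intro ε hε hε1
    let τ := hittingTime W (1 - ε)
    have hst := martingale_stoppedProcess hM' hZc (isStoppingTime_hittingTime hW hWc (1 - ε))
    have h1 : ∫ ω, stoppedProcess Z' τ u ω ∂μ = ∫ ω, Z' u ω ∂μ := by
      have e1 := hst.setIntegral_eq (zero_le : 0 ≤ u) MeasurableSet.univ
      have e2 := hM'.setIntegral_eq (zero_le : 0 ≤ u) MeasurableSet.univ
      rw [setIntegral_univ, setIntegral_univ] at e1 e2
      rw [← e1, ← e2]
      refine integral_congr_ae (ae_of_all _ fun ω => ?_)
      obtain ⟨s, hs, _, e⟩ := exists_stoppedProcess_eq τ 0 ω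
      rw [e, le_zero_iff.1 hs]
    have h2 : ∫ ω in S ε, Z' u ω - stoppedProcess Z' τ u ω ∂μ = 0 := by
      rw [setIntegral_eq_integral_of_forall_compl_eq_zero, integral_sub (hM'.integrable u)
        (hst.integrable u), h1, sub_self]
      intro ω hω
      have : (u : WithTop ℝ≥0) ≤ τ ω := (not_le.1 hω).le
      rw [stoppedProcess_eq_of_le this, sub_self]
    rw [integral_sub (hM'.integrable u).integrableOn (hst.integrable u).integrableOn,
      sub_eq_zero] at h2
    rw [h2]
    have h3 : ∫ ω in S ε, stoppedProcess Z' τ u ω ∂μ ≤ ∫ _ in S ε, ε ∂μ := by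
      refine setIntegral_mono_on (hst.integrable u).integrableOn (integrable_const _) (hS ε) ?_
      intro ω hω
      have hω : τ ω ≤ (u : WithTop ℝ≥0) := hω
      obtain ⟨r, hr⟩ := WithTop.ne_top_iff_exists.1 (ne_top_of_le_ne_top WithTop.coe_ne_top hω)
      have hru : r ≤ u := WithTop.coe_le_coe.1 (hr.trans_le hω)
      obtain ⟨s, hs, hs'⟩ := (hittingTime_le_iff (hWc ω)).1 (hr.symm.le : τ ω ≤ (r : WithTop ℝ≥0))
      have hrs : r ≤ s := by
        have := (hittingTime_le_iff (t := s) (hWc ω)).2 ⟨s, le_rfl, hs'⟩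
        exact WithTop.coe_le_coe.1 (hr.trans_le this)
      rw [stoppedProcess_of_coe hr.symm, min_eq_right hru, le_antisymm hrs hs]
      exact (hWle hε1 s ω).1 hs'
    refine h3.trans ?_
    rw [setIntegral_const, smul_eq_mul, mul_comm]
    exact mul_le_mul_of_nonneg_left (measureReal_mono (Set.subset_univ _)) hε.le
  let e : ℕ → ℝ := fun n => 1 / ((n : ℝ) + 2)
  have he : ∀ n, 0 < e n ∧ e n < 1 := fun n => ⟨by positivity, by
    simp only [e]; rw [div_lt_one (by positivity)]; linarith [(n.cast_nonneg : (0 : ℝ) ≤ n)]⟩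
  let C : Set Ω := ⋂ n, S (e n)
  have hC : MeasurableSet C := MeasurableSet.iInter fun n => hS _
  have hnn : 0 ≤ᵐ[μ] Z' u := hu'.mono fun ω h => h.le
  have hle : ∀ n, ∫ ω in C, Z' u ω ∂μ ≤ e n * μ.real Set.univ := fun n =>
    (setIntegral_mono_set (hM'.integrable u).integrableOn (ae_restrict_of_ae hnn)
      (Set.iInter_subset _ n).eventuallyLE).trans (hint _ (he n).1 (he n).2)
  have hlim : Tendsto (fun n => e n * μ.real Set.univ) atTop (𝓝 0) := by
    have : Tendsto e atTop (𝓝 0) := by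
      refine tendsto_const_nhds.div_atTop (tendsto_atTop_add_const_right _ _
        tendsto_natCast_atTop_atTop)
    simpa using this.mul_const (μ.real Set.univ)
  have h0 : ∫ ω in C, Z' u ω ∂μ = 0 := le_antisymm (ge_of_tendsto' hlim hle)
    (setIntegral_nonneg_of_ae hnn)
  rw [setIntegral_eq_zero_iff_of_nonneg_ae (ae_restrict_of_ae hnn)
    (hM'.integrable u).integrableOn] at h0
  have h1 := (ae_restrict_iff' hC).1 h0
  filter_upwards [h1, hu', hZZ'] with ω h1 h2 h3 t ht
  have hω : ω ∉ C := fun h => h2.ne' (h1 h)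
  simp only [C, Set.mem_iInter, not_forall] at hω
  obtain ⟨n, hn⟩ := hω
  by_contra hcon
  refine hn ((hittingTime_le_iff (hWc ω)).2 ⟨t, ht, (hWle (he n).2 t ω).2 ?_⟩)
  rw [← h3]
  exact (not_lt.1 hcon).trans (he n).1.le

variable {Q : Measure Ω}

/-- On `𝓕 t`, the density `D u` of a martingale `D` that is constant from time `u` on can be
replaced by `D t`. -/
lemma withDensity_apply_of_martingale [IsFiniteMeasure Q] {u : ℝ≥0} (hD : Martingale D 𝓕 Q)
    (hDnn : ∀ t, 0 ≤ᵐ[Q] D t) (hu : ∀ t, u ≤ t → D t = D u) {t : ℝ≥0} {F : Set Ω}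
    (hF : MeasurableSet[𝓕 t] F) :
    Q.withDensity (fun ω => ENNReal.ofReal (D u ω)) F =
      Q.withDensity (fun ω => ENNReal.ofReal (D t ω)) F := by
  have hF' := 𝓕.le t _ hF
  rw [withDensity_apply _ hF', withDensity_apply _ hF',
    ← ofReal_integral_eq_lintegral_ofReal (hD.integrable u).integrableOn
      (ae_restrict_of_ae (hDnn u)),
    ← ofReal_integral_eq_lintegral_ofReal (hD.integrable t).integrableOn
      (ae_restrict_of_ae (hDnn t)), hD.setIntegral_eq (le_max_left t u) hF,
    hu _ (le_max_right t u)]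

lemma lintegral_withDensity_of_martingale [IsFiniteMeasure Q] {u : ℝ≥0} (hD : Martingale D 𝓕 Q)
    (hDnn : ∀ t, 0 ≤ᵐ[Q] D t) (hu : ∀ t, u ≤ t → D t = D u) {t : ℝ≥0} {g : Ω → ℝ≥0∞}
    (hg : Measurable[𝓕 t] g) :
    ∫⁻ ω, g ω ∂(Q.withDensity fun ω => ENNReal.ofReal (D u ω)) =
      ∫⁻ ω, ENNReal.ofReal (D t ω) * g ω ∂Q := by
  have htrim : (Q.withDensity fun ω => ENNReal.ofReal (D u ω)).trim (𝓕.le t) =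
      (Q.withDensity fun ω => ENNReal.ofReal (D t ω)).trim (𝓕.le t) := by
    refine @Measure.ext _ (𝓕 t) _ _ fun F hF => ?_
    rw [trim_measurableSet_eq (𝓕.le t) hF, trim_measurableSet_eq (𝓕.le t) hF,
      withDensity_apply_of_martingale hD hDnn hu hF]
  rw [← lintegral_trim (𝓕.le t) hg, htrim, lintegral_trim (𝓕.le t) hg,
    lintegral_withDensity_eq_lintegral_mul _ (((hD.stronglyMeasurable t).mono
      (𝓕.le t)).measurable.ennreal_ofReal) (hg.mono (𝓕.le t) le_rfl)]
  rfl

/-- Change of numeraire: `N` is a martingale under the measure with density process `D` if `N D` is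
a martingale under the original measure. -/
theorem martingale_withDensity [IsFiniteMeasure Q] {u : ℝ≥0} (hD : Martingale D 𝓕 Q)
    (hDnn : ∀ t, 0 ≤ᵐ[Q] D t) (hu : ∀ t, u ≤ t → D t = D u)
    [IsFiniteMeasure (Q.withDensity fun ω => ENNReal.ofReal (D u ω))] (hN : StronglyAdapted 𝓕 N)
    (hNnn : ∀ t, 0 ≤ᵐ[Q] N t) (hZ : Martingale Z 𝓕 Q) (h : ∀ t, ∀ᵐ ω ∂Q, D t ω * N t ω = Z t ω) :
    Martingale N 𝓕 (Q.withDensity fun ω => ENNReal.ofReal (D u ω)) := by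
  set Q' := Q.withDensity fun ω => ENNReal.ofReal (D u ω)
  have hac : Q' ≪ Q := withDensity_absolutelyContinuous _ _
  have hZnn : ∀ t, 0 ≤ᵐ[Q] Z t := fun t => by
    filter_upwards [hDnn t, hNnn t, h t] with ω h1 h2 h3
    rw [← h3]
    exact mul_nonneg h1 h2
  have key : ∀ t F, MeasurableSet[𝓕 t] F →
      ∫⁻ ω in F, ENNReal.ofReal (N t ω) ∂Q' = ∫⁻ ω in F, ENNReal.ofReal (Z t ω) ∂Q := by
    intro t F hF
    have hF' := 𝓕.le t _ hF
    rw [← lintegral_indicator hF', ← lintegral_indicator hF',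
      lintegral_withDensity_of_martingale hD hDnn hu
        (Measurable.indicator (hN t).measurable.ennreal_ofReal hF)]
    refine lintegral_congr_ae ?_
    filter_upwards [hDnn t, h t] with ω h1 h2
    by_cases hω : ω ∈ F
    · simp only [Set.indicator_of_mem hω]
      rw [← ENNReal.ofReal_mul h1, h2]
    · simp [hω]
  have hNm : ∀ t, StronglyMeasurable (N t) := fun t => (hN t).mono (𝓕.le t)
  have hfin : ∀ t, Integrable (N t) Q' := by
    intro t
    refine ⟨(hNm t).aestronglyMeasurable, ?_⟩
    rw [hasFiniteIntegral_iff_ofReal (hac (hNnn t)), ← setLIntegral_univ,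
      key t _ MeasurableSet.univ, setLIntegral_univ]
    exact (hasFiniteIntegral_iff_ofReal (hZnn t)).1 (hZ.integrable t).2
  have hval : ∀ t F, MeasurableSet[𝓕 t] F → ∫ ω in F, N t ω ∂Q' = ∫ ω in F, Z t ω ∂Q := by
    intro t F hF
    rw [integral_eq_lintegral_of_nonneg_ae (ae_restrict_of_ae (hac (hNnn t)))
      (hNm t).aestronglyMeasurable, key t F hF, integral_eq_lintegral_of_nonneg_ae
      (ae_restrict_of_ae (hZnn t)) ((hZ.integrable t).aestronglyMeasurable.restrict)]
  refine martingale_of_setIntegral_eq hN hfin fun s t hst F hF => ?_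
  rw [hval s F hF, hval t F (𝓕.mono hst _ hF), hZ.setIntegral_eq hst hF]

/-- A random variable measurable with respect to events of probability `0` or `1` is constant. -/
lemma ae_eq_integral_of_trivial [IsProbabilityMeasure Q] {f : Ω → ℝ} (hf : Integrable f Q)
    (h : ∀ c, Q {ω | c < f ω} = 0 ∨ ∀ᵐ ω ∂Q, c < f ω)
    (h' : ∀ c, Q {ω | f ω < c} = 0 ∨ ∀ᵐ ω ∂Q, f ω < c) : ∀ᵐ ω ∂Q, f ω = ∫ ω, f ω ∂Q := by
  set c := ∫ ω, f ω ∂Q with hc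
  have hpos : ∀ g : Ω → ℝ, Integrable g Q → (∀ᵐ ω ∂Q, 0 < g ω) → 0 < ∫ ω, g ω ∂Q := by
    intro g hg hgpos
    refine (integral_pos_iff_support_of_nonneg_ae (hgpos.mono fun ω h => h.le) hg).2 ?_
    have : Q (Function.support g) = 1 := by
      rw [← measure_univ (μ := Q)]
      refine measure_congr ?_
      filter_upwards [hgpos] with ω hω
      exact propext ⟨fun _ => trivial, fun _ => hω.ne'⟩
    rw [this]
    exact one_pos
  have h1 : Q {ω | c < f ω} = 0 := by
    refine (h c).resolve_right fun hcon => ?_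
    have := hpos (fun ω => f ω - c) (hf.sub (integrable_const c))
      (hcon.mono fun ω h => sub_pos.2 h)
    rw [integral_sub hf (integrable_const c), integral_const] at this
    simp [← hc] at this
  have h2 : Q {ω | f ω < c} = 0 := by
    refine (h' c).resolve_right fun hcon => ?_
    have := hpos (fun ω => c - f ω) ((integrable_const c).sub hf)
      (hcon.mono fun ω h => sub_pos.2 h)
    rw [integral_sub (integrable_const c) hf, integral_const] at this
    simp [← hc] at this
  filter_upwards [measure_eq_zero_iff_ae_notMem.1 h1, measure_eq_zero_iff_ae_notMem.1 h2]
    with ω h1 h2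
  exact le_antisymm (not_lt.1 h1) (not_lt.1 h2)

end Numeraire

/-! ### The bond market -/

section MarketFacts

lemma moneyMarket_pos {Ω : Type*} (r : ℝ≥0 → Ω → ℝ) (t : ℝ≥0) (ω : Ω) : 0 < moneyMarket r t ω :=
  Real.exp_pos _

lemma moneyMarket_zero {Ω : Type*} (r : ℝ≥0 → Ω → ℝ) (ω : Ω) : moneyMarket r 0 ω = 1 := by
  simp [moneyMarket]

lemma accrual_pos {T : ℕ → ℝ≥0} {N j : ℕ} (hT : StrictMonoOn T (Set.Iic N)) (h1 : 1 ≤ j)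
    (hj : j ≤ N) : 0 < accrual T j :=
  sub_pos.2 (NNReal.coe_lt_coe.2 (hT (Set.mem_Iic.2 (by omega)) (Set.mem_Iic.2 hj) (by omega)))

variable {Ω : Type*} [mΩ : MeasurableSpace Ω] {Pr Q : Measure Ω} {𝓕 : Filtration ℝ≥0 mΩ}
  {r : ℝ≥0 → Ω → ℝ} {P : ℝ≥0 → ℝ≥0 → Ω → ℝ}

lemma IsContAdapted.mono_ac {μ ν : Measure Ω} {X : ℝ≥0 → Ω → ℝ} (hX : IsContAdapted 𝓕 μ X)
    (h : ν ≪ μ) : IsContAdapted 𝓕 ν X := ⟨hX.adapted, h hX.continuous⟩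

namespace IsMarket

variable (hm : IsMarket Pr Q 𝓕 r P)
include hm

lemma containsNullSets {μ : Measure Ω} (h : Pr ≪ μ) : ContainsNullSets 𝓕 μ :=
  ⟨fun s hs h0 => (hm.initial s).2 ⟨hs, Or.inl (h h0)⟩⟩

/-- The bond with maturity `0` is the money market account. -/
lemma bond_zero (t : ℝ≥0) (ω : Ω) : P t 0 ω = moneyMarket r t ω := by
  rw [hm.bond_extend t 0 ω zero_le, moneyMarket_zero, div_one]

lemma moneyMarket_contAdapted : IsContAdapted 𝓕 Pr (moneyMarket r) := by
  have : moneyMarket r = fun t => P t 0 := by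
    funext t ω; exact (hm.bond_zero t ω).symm
  rw [this]
  exact hm.bond_contAdapted 0

lemma discounted_contAdapted (u : ℝ≥0) :
    IsContAdapted 𝓕 Pr fun t ω => P t u ω / moneyMarket r t ω :=
  (hm.bond_contAdapted u).div hm.moneyMarket_contAdapted
    (ae_of_all _ fun ω t => (moneyMarket_pos r t ω).ne')

lemma discounted_of_le {t u : ℝ≥0} (h : u ≤ t) (ω : Ω) :
    P t u ω / moneyMarket r t ω = 1 / moneyMarket r u ω := by
  rw [hm.bond_extend t u ω h]
  have := (moneyMarket_pos r t ω).ne'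
  field_simp

/-- Bond prices are positive. -/
lemma bond_pos (u : ℝ≥0) : ∀ᵐ ω ∂Pr, ∀ t, 0 < P t u ω := by
  have := hm.prob_riskNeutral
  have := hm.containsNullSets hm.absCont'
  have h := ae_pos_of_martingale (hm.bond_martingale u)
    ((hm.discounted_contAdapted u).mono_ac hm.absCont) (u := u) (ae_of_all _ fun ω => by
      rw [hm.discounted_of_le le_rfl]
      exact one_div_pos.2 (moneyMarket_pos r u ω))
  filter_upwards [hm.absCont' h] with ω hω t
  rcases le_total t u with htu | hut
  · exact (div_pos_iff_of_pos_right (moneyMarket_pos r t ω)).1 (hω t htu)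
  · rw [hm.bond_extend t u ω hut]
    exact div_pos (moneyMarket_pos r t ω) (moneyMarket_pos r u ω)

variable {T : ℕ → ℝ≥0} {N I J : ℕ}

lemma annuity_contAdapted : IsContAdapted 𝓕 Pr (annuity P T I J) := by
  have : annuity P T I J = ∑ j ∈ Finset.Icc (I + 1) J, accrual T j • fun t => P t (T j) := by
    funext t ω
    simp [annuity]
  rw [this]
  exact IsContAdapted.sum fun j _ => (hm.bond_contAdapted _).smul _

lemma bond_pos_all (T : ℕ → ℝ≥0) : ∀ᵐ ω ∂Pr, ∀ k t, 0 < P t (T k) ω :=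
  ae_all_iff.2 fun k => hm.bond_pos (T k)

omit hm mΩ in
lemma annuity_pos_of_bond_pos (hT : StrictMonoOn T (Set.Iic N)) (hIJ : I < J) (hJN : J ≤ N)
    {t : ℝ≥0} {ω : Ω} (h : ∀ k, 0 < P t (T k) ω) : 0 < annuity P T I J t ω := by
  refine Finset.sum_pos (fun j hj => ?_) ⟨J, Finset.mem_Icc.2 ⟨hIJ, le_rfl⟩⟩
  rw [Finset.mem_Icc] at hj
  exact mul_pos (accrual_pos hT (by omega) (hj.2.trans hJN)) (h j)

lemma annuity_pos (hT : StrictMonoOn T (Set.Iic N)) (hIJ : I < J) (hJN : J ≤ N) :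
    ∀ᵐ ω ∂Pr, ∀ t, 0 < annuity P T I J t ω := by
  filter_upwards [hm.bond_pos_all T] with ω hω t
  exact annuity_pos_of_bond_pos hT hIJ hJN fun k => hω k t

/-- The initial value of the annuity is almost surely constant. -/
lemma annuity_zero_eq : ∃ c, ∀ᵐ ω ∂Q, annuity P T I J 0 ω = c := by
  have := hm.prob_riskNeutral
  have := hm.prob
  have hi : Integrable (annuity P T I J 0) Q := by
    refine integrable_finsetSum _ fun j _ => Integrable.const_mul ?_ _
    have := (hm.bond_martingale (T j)).integrable 0
    simpa only [moneyMarket_zero, div_one] using this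
  have hmeas := hm.annuity_contAdapted (T := T) (I := I) (J := J) |>.adapted 0
  have h01 : ∀ F : Set Ω, MeasurableSet[𝓕 0] F → Q F = 0 ∨ ∀ᵐ ω ∂Q, ω ∈ F := by
    intro F hF
    obtain ⟨hF', h⟩ := (hm.initial F).1 hF
    refine h.imp (fun h => hm.absCont h) fun h => ?_
    exact hm.absCont ((prob_compl_eq_zero_iff hF').2 h)
  exact ⟨_, ae_eq_integral_of_trivial hi
    (fun c => h01 _ (StronglyMeasurable.measurableSet_lt stronglyMeasurable_const hmeas))
    (fun c => h01 _ (StronglyMeasurable.measurableSet_lt hmeas stronglyMeasurable_const))⟩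

lemma discountedAnnuity_martingale :
    Martingale (fun t ω => annuity P T I J t ω / moneyMarket r t ω) 𝓕 Q := by
  have e : (fun t ω => annuity P T I J t ω / moneyMarket r t ω) =
      ∑ j ∈ Finset.Icc (I + 1) J, accrual T j •
        fun t ω => P t (T j) ω / moneyMarket r t ω := by
    funext t ω
    simp only [annuity, Finset.sum_apply, Pi.smul_apply, smul_eq_mul, Finset.sum_div]
    exact Finset.sum_congr rfl fun _ _ => mul_div_assoc _ _ _
  rw [e]
  refine Finset.sum_induction _ (fun X => Martingale X 𝓕 Q) (fun _ _ h h' => h.add h')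
    (martingale_zero _ _ _) fun j _ => (hm.bond_martingale (T j)).smul _

/-- Under the forward swap measure, which is equivalent to the physical measure, bond prices in
units of the annuity are martingales. -/
theorem swapMeasure_martingale (hT : StrictMonoOn T (Set.Iic N)) (hIJ : I < J) (hJN : J ≤ N) :
    IsFiniteMeasure (swapMeasure Q r P T N I J) ∧ swapMeasure Q r P T N I J ≪ Pr ∧
      Pr ≪ swapMeasure Q r P T N I J ∧
      ∀ u, Martingale (fun t ω => P t u ω / annuity P T I J t ω) 𝓕
        (swapMeasure Q r P T N I J) := by
  have := hm.prob_riskNeutral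
  obtain ⟨c, hc⟩ := hm.annuity_zero_eq (T := T) (I := I) (J := J)
  have hApos := hm.absCont (hm.annuity_pos hT hIJ hJN)
  have hc0 : 0 < c := by
    obtain ⟨ω, h1, h2⟩ := (hc.and hApos).exists
    rw [← h1]; exact h2 0
  let D : ℝ≥0 → Ω → ℝ := c⁻¹ • fun t ω => annuity P T I J t ω / moneyMarket r t ω
  have hD : Martingale D 𝓕 Q := hm.discountedAnnuity_martingale.smul c⁻¹
  have hDpos : ∀ t, ∀ᵐ ω ∂Q, 0 < D t ω := fun t => by
    filter_upwards [hApos] with ω hω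
    exact mul_pos (inv_pos.2 hc0) (div_pos (hω t) (moneyMarket_pos r t ω))
  have hDnn : ∀ t, 0 ≤ᵐ[Q] D t := fun t => (hDpos t).mono fun ω h => h.le
  have hTmono : ∀ j ∈ Finset.Icc (I + 1) J, T j ≤ T N := fun j hj =>
    hT.monotoneOn (Set.mem_Iic.2 ((Finset.mem_Icc.1 hj).2.trans hJN)) (Set.mem_Iic.2 le_rfl)
      ((Finset.mem_Icc.1 hj).2.trans hJN)
  have hu : ∀ t, T N ≤ t → D t = D (T N) := by
    intro t ht
    funext ω
    simp only [D, Pi.smul_apply, annuity, Finset.sum_div, mul_div_assoc]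
    congr 1
    refine Finset.sum_congr rfl fun j hj => ?_
    rw [hm.discounted_of_le ((hTmono j hj).trans ht), hm.discounted_of_le (hTmono j hj)]
  have hQs : swapMeasure Q r P T N I J = Q.withDensity fun ω => ENNReal.ofReal (D (T N) ω) := by
    refine withDensity_congr_ae ?_
    filter_upwards [hc] with ω hω
    simp [D, hω]
  have hfin : IsFiniteMeasure (Q.withDensity fun ω => ENNReal.ofReal (D (T N) ω)) :=
    isFiniteMeasure_withDensity_ofReal (hD.integrable (T N)).2
  have hac : Q ≪ Q.withDensity fun ω => ENNReal.ofReal (D (T N) ω) := by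
    refine withDensity_absolutelyContinuous'
      (hD.integrable (T N)).aestronglyMeasurable.aemeasurable.ennreal_ofReal ?_
    filter_upwards [hDpos (T N)] with ω hω
    exact (ENNReal.ofReal_pos.2 hω).ne'
  rw [hQs]
  refine ⟨hfin, (withDensity_absolutelyContinuous _ _).trans hm.absCont, hm.absCont'.trans hac,
    fun u => ?_⟩
  have hApos' := hm.annuity_pos hT hIJ hJN
  refine martingale_withDensity (Z := c⁻¹ • fun t ω => P t u ω / moneyMarket r t ω) hD hDnn hu
    ((hm.bond_contAdapted u).div hm.annuity_contAdapted
      (hApos'.mono fun ω h t => (h t).ne')).adapted ?_ ((hm.bond_martingale u).smul _) ?_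
  · intro t
    filter_upwards [hApos, hm.absCont (hm.bond_pos u)] with ω h1 h2
    exact div_nonneg (h2 t).le (h1 t).le
  · intro t
    filter_upwards [hApos] with ω h1
    have := (h1 t).ne'
    have := (moneyMarket_pos r t ω).ne'
    simp only [D, Pi.smul_apply, smul_eq_mul]
    field_simp

end IsMarket

end MarketFacts

/-! ### Martingale differentials and the forward swap rate -/

section MartingaleDifferentials

variable {Ω : Type*} {mΩ : MeasurableSpace Ω} {𝓕 : Filtration ℝ≥0 mΩ} {μ : Measure Ω}
  [IsFiniteMeasure μ] [ContainsNullSets 𝓕 μ] {H L S X Y : ℝ≥0 → Ω → ℝ}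

local notation "𝕕" => differential 𝓕 μ
local notation "𝕔" => cls 𝓕 μ

variable (𝓕 μ) in
/-- The differentials of continuous local martingales. -/
def martingaleDifferentials : Submodule (ProcessRing 𝓕 μ) (Differential 𝓕 μ) where
  carrier := {α | ∃ L, IsCLM 𝓕 μ L ∧ 𝕕 L = α}
  add_mem' := by
    rintro _ _ ⟨L, hL, rfl⟩ ⟨L', hL', rfl⟩
    exact ⟨L + L', hL.add hL', differential_add (.of_isCLM hL) (.of_isCLM hL')⟩
  zero_mem' := ⟨0, IsCLM.zero_process, differential_const 0⟩
  smul_mem' := by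
    rintro a _ ⟨L, hL, rfl⟩
    obtain ⟨H, hH, rfl⟩ := exists_cls_eq a
    obtain ⟨V, hV, h⟩ := hL.exists_integral hH
    exact ⟨V, hV, (cls_smul_differential hH (.of_isCLM hL) (.of_isCLM hV) h).symm⟩

variable (𝓕 μ) in
/-- The differentials of continuous adapted processes of finite variation. -/
def finiteVariationDifferentials : Submodule (ProcessRing 𝓕 μ) (Differential 𝓕 μ) where
  carrier := {α | ∃ A, IsFV 𝓕 μ A ∧ 𝕕 A = α}
  add_mem' := by
    rintro _ _ ⟨A, hA, rfl⟩ ⟨B, hB, rfl⟩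
    exact ⟨A + B, hA.add hB, differential_add (.of_isFV hA) (.of_isFV hB)⟩
  zero_mem' := ⟨fun _ _ => 0, IsFV.of_constTime stronglyMeasurable_const, differential_const 0⟩
  smul_mem' := by
    rintro a _ ⟨A, hA, rfl⟩
    obtain ⟨H, hH, rfl⟩ := exists_cls_eq a
    obtain ⟨V, hV, h⟩ := (IsContSemimartingale.of_isFV hA).exists_integral hH
    exact ⟨V, hA.integral hH hV.1 h, (cls_smul_differential hH (.of_isFV hA) hV h).symm⟩

lemma bracket_mem_finiteVariationDifferentials (α β : Differential 𝓕 μ) :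
    bracket 𝓕 μ α β ∈ finiteVariationDifferentials 𝓕 μ := by
  obtain ⟨B, X, Y, hX, hY, rfl, rfl, hB, h⟩ := exists_bracket α β
  exact ⟨B, hB, (bracket_differential hX hY (.of_isFV hB) h).symm⟩

/-- A continuous local martingale of finite variation is constant in time. -/
lemma disjoint_martingaleDifferentials :
    Disjoint (martingaleDifferentials 𝓕 μ) (finiteVariationDifferentials 𝓕 μ) := by
  rw [Submodule.disjoint_def]
  rintro _ ⟨L, hL, rfl⟩ ⟨A, hA, h⟩
  rw [differential_eq_iff (.of_isFV hA) (.of_isCLM hL)] at h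
  have hv : IsFV 𝓕 μ L := by
    refine (hA.sub (IsFV.of_constTime (hA.adapted 0))).congr hL.adapted ?_
    filter_upwards [h] with ω hω t
    rw [← sub_zero (L t ω), ← hL.zero ω, ← hω t]
    rfl
  rw [differential_eq_of_indist (.of_isCLM hL) (.const 0)
    (hL.eq_zero_of_finiteVariation hv.finiteVariation), differential_const]

lemma differential_localMartingalePart {α ν : Differential 𝓕 μ} (hX : IsContAdapted 𝓕 μ X)
    (hL : IsLocalMartingalePart 𝓕 μ X L) (hα : α ∈ martingaleDifferentials 𝓕 μ)
    (hν : ν ∈ finiteVariationDifferentials 𝓕 μ) (h : 𝕕 X = α + ν) :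
    IsContSemimartingale 𝓕 μ L ∧ 𝕕 L = α := by
  obtain ⟨L', A, hL', hA, h1, h2⟩ := hL.exists_decomposition hX
  have hLs := (IsContSemimartingale.of_isCLM hL').congr hL.localMartingale.adapted h1.symm
  refine ⟨hLs, ?_⟩
  rw [differential_eq_of_indist hLs (.of_isCLM hL') h1]
  have e : 𝕕 L' + 𝕕 A = α + ν := by
    rw [← h, ← differential_add (.of_isCLM hL') (.of_isFV hA)]
    exact (differential_eq_of_indist ⟨hX, L, hL⟩
      ((IsContSemimartingale.of_isCLM hL').add (.of_isFV hA)) h2).symm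
  have e' : 𝕕 L' - α = ν - 𝕕 A := by rw [sub_eq_sub_iff_add_eq_add, e, add_comm]
  refine sub_eq_zero.1 (Submodule.disjoint_def.1 disjoint_martingaleDifferentials _
    (sub_mem ⟨L', hL', rfl⟩ hα) ?_)
  rw [e']
  exact sub_mem hν ⟨A, hA, rfl⟩

lemma differential_mem_of_martingale (hM : Martingale X 𝓕 μ) (hX : IsContAdapted 𝓕 μ X) :
    IsContSemimartingale 𝓕 μ X ∧ 𝕕 X ∈ martingaleDifferentials 𝓕 μ := by
  obtain ⟨X', hX', hc, h⟩ := hX.exists_version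
  have hM' : Martingale X' 𝓕 μ := hM.congr hX' fun t => h.mono fun ω hω => hω t
  have hL := isCLM_of_martingale hM' hc
  have h0 : IsFV 𝓕 μ fun _ => X' 0 := IsFV.of_constTime (hX' 0)
  have hi : Indist μ X ((fun t ω => X' t ω - X' 0 ω) + fun _ => X' 0) := by
    filter_upwards [h] with ω hω t
    simp only [Pi.add_apply, sub_add_cancel, hω]
  have hs := IsContSemimartingale.of_indist hX hL h0 hi
  refine ⟨hs, _, hL, ?_⟩
  rw [differential_eq_of_indist hs ((IsContSemimartingale.of_isCLM hL).add (.of_isFV h0)) hi,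
    differential_add (.of_isCLM hL) (.of_isFV h0), differential_constTime (hX' 0), add_zero]

/-- The ratio of two positive martingale-driven processes. -/
lemma differential_ratio {X Y : ℝ≥0 → Ω → ℝ} (hX : IsContSemimartingale 𝓕 μ X)
    (hY : IsContSemimartingale 𝓕 μ Y) (h : ∀ᵐ ω ∂μ, ∀ t, 0 < Y t ω) :
    ∃ ν ∈ finiteVariationDifferentials 𝓕 μ,
      𝕕 (X * Y⁻¹) = (𝕔 Y⁻¹ • 𝕕 X - (𝕔 X * 𝕔 Y⁻¹ ^ 2) • 𝕕 Y) + ν := by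
  obtain ⟨hs, hd⟩ := hY.inv_and_differential h
  refine ⟨𝕔 X • 𝕔 Y⁻¹ ^ 3 • bracket 𝓕 μ (𝕕 Y) (𝕕 Y) + bracket 𝓕 μ (𝕕 X) (𝕕 Y⁻¹),
    add_mem (Submodule.smul_mem _ _ (Submodule.smul_mem _ _
      (bracket_mem_finiteVariationDifferentials _ _)))
      (bracket_mem_finiteVariationDifferentials _ _), ?_⟩
  rw [differential_mul hX hs]
  nth_rw 1 [hd]
  module

end MartingaleDifferentials

/-- Summation by parts behind the formula for the differential of the swap rate. -/
lemma sum_smul_sub_eq {A M : Type*} [CommRing A] [AddCommGroup M] [Module A M] {I J : ℕ}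
    (hIJ : I ≤ J) (n x θ : ℕ → A) (s : A) (δ : ℕ → M) (hx : ∀ k, n k * x k = 1) :
    ∑ j ∈ Finset.Icc (I + 1) J, (n J + s * ∑ k ∈ Finset.Icc j J, θ k * n k) •
        (x (j - 1) • δ (j - 1) - x j • δ j) =
      ((n J + s * ∑ k ∈ Finset.Icc (I + 1) J, θ k * n k) * x I) • δ I - δ J -
        s • ∑ k ∈ Finset.Icc (I + 1) J, θ k • δ k := by
  induction hIJ using Nat.decreasingInduction with
  | self => simp [hx]
  | of_succ m hm ih =>
    have hA (f : ℕ → A) : ∑ k ∈ Finset.Icc (m + 1) J, f k =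
        f (m + 1) + ∑ k ∈ Finset.Icc (m + 1 + 1) J, f k := by
      rw [← Finset.insert_Icc_add_one_left_eq_Icc hm, Finset.sum_insert (by simp)]
    have hM (f : ℕ → M) : ∑ k ∈ Finset.Icc (m + 1) J, f k =
        f (m + 1) + ∑ k ∈ Finset.Icc (m + 1 + 1) J, f k := by
      rw [← Finset.insert_Icc_add_one_left_eq_Icc hm, Finset.sum_insert (by simp)]
    rw [hM, ih, hA, hM fun k => θ k • δ k, Nat.add_sub_cancel]
    have e : (s * (θ (m + 1) * n (m + 1)) * x (m + 1)) • δ (m + 1) = (s * θ (m + 1)) • δ (m + 1) := by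
      congr 1
      linear_combination s * θ (m + 1) * hx (m + 1)
    rw [← sub_eq_zero] at e ⊢
    rw [← neg_eq_zero.2 e]
    module

section SwapRateDifferential

variable {Ω : Type*} {mΩ : MeasurableSpace Ω} {𝓕 : Filtration ℝ≥0 mΩ} {μ : Measure Ω}
  [IsFiniteMeasure μ] [ContainsNullSets 𝓕 μ]

local notation "𝕕" => differential 𝓕 μ
local notation "𝕔" => cls 𝓕 μ

/-- Simple rates formed from ratios of positive semimartingales with martingale differentials. -/
lemma differential_simpleRate {X Y R : ℝ≥0 → Ω → ℝ} (hX : IsContSemimartingale 𝓕 μ X)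
    (hY : IsContSemimartingale 𝓕 μ Y) (hXm : 𝕕 X ∈ martingaleDifferentials 𝓕 μ)
    (hYm : 𝕕 Y ∈ martingaleDifferentials 𝓕 μ) (h : ∀ᵐ ω ∂μ, ∀ t, 0 < Y t ω) (c : ℝ)
    (hR : StronglyAdapted 𝓕 R) (hRXY : Indist μ R ((fun _ _ => c) * (X * Y⁻¹ - fun _ _ => 1))) :
    IsContSemimartingale 𝓕 μ R ∧ ∀ L, IsLocalMartingalePart 𝓕 μ R L →
      IsContSemimartingale 𝓕 μ L ∧ 𝕕 L = algebraMap ℝ (ProcessRing 𝓕 μ) c •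
        (𝕔 Y⁻¹ • 𝕕 X - (𝕔 X * 𝕔 Y⁻¹ ^ 2) • 𝕕 Y) := by
  obtain ⟨ν, hν, hd⟩ := differential_ratio hX hY h
  have h1 := hX.mul (hY.inv h)
  have h2 : IsContSemimartingale 𝓕 μ ((fun _ _ => c) * (X * Y⁻¹ - fun _ _ => 1)) :=
    (IsContSemimartingale.const c).mul (h1.sub (.const 1))
  have hRs := h2.congr hR hRXY.symm
  refine ⟨hRs, fun L hL => differential_localMartingalePart hRs.1 hL
    (ν := algebraMap ℝ (ProcessRing 𝓕 μ) c • ν) ?_ (Submodule.smul_mem _ _ hν) ?_⟩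
  · exact Submodule.smul_mem _ _ (sub_mem (Submodule.smul_mem _ _ hXm)
      (Submodule.smul_mem _ _ hYm))
  · rw [differential_eq_of_indist hRs h2 hRXY, differential_mul (.const c) (h1.sub (.const 1)),
      differential_sub h1 (.const 1), differential_const, differential_const, cls_const, hd,
      smul_zero, add_zero, sub_zero, map_zero, LinearMap.zero_apply, add_zero, smul_add]

/-- The differential of a swap rate, driven by the local martingale parts of the simple rates.
Here `n k` is the price of the `k`-th bond in units of the annuity. -/
theorem differential_swapRate {n R W Rstar : ℕ → ℝ≥0 → Ω → ℝ} {S : ℝ≥0 → Ω → ℝ} {θ : ℕ → ℝ}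
    {I J : ℕ} (hIJ : I ≤ J) (hn : ∀ k, IsContSemimartingale 𝓕 μ (n k))
    (hm : ∀ k, 𝕕 (n k) ∈ martingaleDifferentials 𝓕 μ) (hpos : ∀ k, ∀ᵐ ω ∂μ, ∀ t, 0 < n k t ω)
    (hθ : ∀ j ∈ Finset.Icc (I + 1) J, θ j ≠ 0)
    (hsum : Indist μ (∑ k ∈ Finset.Icc (I + 1) J, (fun _ _ => θ k) * n k) 1)
    (hS : IsContSemimartingale 𝓕 μ S) (hSn : Indist μ S (n I - n J))
    (hR : ∀ j ∈ Finset.Icc (I + 1) J, StronglyAdapted 𝓕 (R j))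
    (hRn : ∀ j ∈ Finset.Icc (I + 1) J,
      Indist μ (R j) ((fun _ _ => 1 / θ j) * (n (j - 1) * (n j)⁻¹ - fun _ _ => 1)))
    (hW : ∀ j ∈ Finset.Icc (I + 1) J, IsContAdapted 𝓕 μ (W j))
    (hWn : ∀ j ∈ Finset.Icc (I + 1) J, Indist μ (W j) ((fun _ _ => θ j) * n j * (n (j - 1))⁻¹ *
      (n J + S * ∑ k ∈ Finset.Icc j J, (fun _ _ => θ k) * n k)))
    (hL : ∀ j ∈ Finset.Icc (I + 1) J, IsLocalMartingalePart 𝓕 μ (R j) (Rstar j)) :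
    𝕕 S = ∑ j ∈ Finset.Icc (I + 1) J, 𝕔 (W j) • 𝕕 (Rstar j) := by
  have hinv k := (hn k).inv (hpos k)
  have hx k : 𝕔 (n k) * 𝕔 (n k)⁻¹ = 1 := cls_mul_cls_inv (hn k).1 (hpos k)
  have hθn k : IsContSemimartingale 𝓕 μ ((fun _ _ => θ k) * n k) :=
    (IsContSemimartingale.const _).mul (hn k)
  have hcsum (u : Finset ℕ) : 𝕔 (∑ k ∈ u, (fun _ _ => θ k) * n k) =
      ∑ k ∈ u, algebraMap ℝ (ProcessRing 𝓕 μ) (θ k) * 𝕔 (n k) := by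
    rw [cls_sum fun k _ => (hθn k).1]
    exact Finset.sum_congr rfl fun k _ => by rw [cls_mul (.const _) (hn k).1, cls_const]
  have hone : IsContSemimartingale 𝓕 μ 1 := .const 1
  have h1 : ∑ k ∈ Finset.Icc (I + 1) J, algebraMap ℝ (ProcessRing 𝓕 μ) (θ k) * 𝕔 (n k) = 1 := by
    rw [← hcsum, ← cls_one,
      (cls_eq_cls_iff (IsContSemimartingale.sum fun k _ => hθn k).1 hone.1).2 hsum]
  have hd1 : ∑ k ∈ Finset.Icc (I + 1) J, algebraMap ℝ (ProcessRing 𝓕 μ) (θ k) • 𝕕 (n k) = 0 := by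
    have : 𝕕 (∑ k ∈ Finset.Icc (I + 1) J, (fun _ _ => θ k) * n k) = 0 := by
      rw [differential_eq_of_indist (IsContSemimartingale.sum fun k _ => hθn k) hone hsum]
      exact differential_const 1
    rw [← this, differential_sum fun k _ => hθn k]
    refine Finset.sum_congr rfl fun k _ => ?_
    rw [differential_mul (.const _) (hn k), differential_const, cls_const, smul_zero, add_zero,
      map_zero, LinearMap.zero_apply, add_zero]
  have hcS : 𝕔 S = 𝕔 (n I) - 𝕔 (n J) := by
    rw [← cls_sub (hn I).1 (hn J).1, (cls_eq_cls_iff hS.1 ((hn I).1.sub (hn J).1)).2 hSn]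
  have hdS : 𝕕 S = 𝕕 (n I) - 𝕕 (n J) := by
    rw [← differential_sub (hn I) (hn J), differential_eq_of_indist hS ((hn I).sub (hn J)) hSn]
  have hkey := sum_smul_sub_eq hIJ (fun k => 𝕔 (n k)) (fun k => 𝕔 (n k)⁻¹)
    (fun k => algebraMap ℝ (ProcessRing 𝓕 μ) (θ k)) (𝕔 S) (fun k => 𝕕 (n k)) hx
  rw [h1, hd1, mul_one, smul_zero, sub_zero, hcS, add_sub_cancel, hx, one_smul, ← hdS,
    ← hcS] at hkey
  rw [← hkey]
  refine Finset.sum_congr rfl fun j hj => ?_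
  rw [((differential_simpleRate (hn (j - 1)) (hn j) (hm _) (hm _) (hpos j) (1 / θ j) (hR j hj)
    (hRn j hj)).2 _ (hL j hj)).2]
  have hsums := IsContSemimartingale.sum (s := Finset.Icc j J) fun k _ => hθn k
  have hu := (hn J).add (hS.mul hsums)
  have hWs := (((IsContSemimartingale.const (𝓕 := 𝓕) (μ := μ) (θ j)).mul (hn j)).mul
    (hinv (j - 1))).mul hu
  have hcW : 𝕔 (W j) = algebraMap ℝ (ProcessRing 𝓕 μ) (θ j) * 𝕔 (n j) * 𝕔 (n (j - 1))⁻¹ *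
      (𝕔 (n J) + 𝕔 S *
        ∑ k ∈ Finset.Icc j J, algebraMap ℝ (ProcessRing 𝓕 μ) (θ k) * 𝕔 (n k)) := by
    rw [(cls_eq_cls_iff (hW j hj) hWs.1).2 (hWn j hj), cls_mul ((hθn j).mul (hinv _)).1 hu.1,
      cls_mul (hθn j).1 (hinv _).1, cls_mul (.const _) (hn j).1, cls_const,
      cls_add (hn J).1 (hS.mul hsums).1, cls_mul hS.1 hsums.1, hcsum]
  have hθj : algebraMap ℝ (ProcessRing 𝓕 μ) (θ j) * algebraMap ℝ (ProcessRing 𝓕 μ) (1 / θ j) =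
      1 := by
    rw [← map_mul, mul_one_div_cancel (hθ j hj), map_one]
  rw [hcW]
  simp only [smul_sub, smul_smul]
  congr 2
  · linear_combination (-(𝕔 (n J) + 𝕔 S * ∑ k ∈ Finset.Icc j J,
      algebraMap ℝ (ProcessRing 𝓕 μ) (θ k) * 𝕔 (n k)) * 𝕔 (n (j - 1))⁻¹) *
        (𝕔 (n j) * 𝕔 (n j)⁻¹ * hθj + hx j)
  · linear_combination (-(𝕔 (n J) + 𝕔 S * ∑ k ∈ Finset.Icc j J,
      algebraMap ℝ (ProcessRing 𝓕 μ) (θ k) * 𝕔 (n k)) * 𝕔 (n j)⁻¹) *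
        (𝕔 (n j) * 𝕔 (n j)⁻¹ * 𝕔 (n (j - 1)) * 𝕔 (n (j - 1))⁻¹ * hθj +
          𝕔 (n (j - 1)) * 𝕔 (n (j - 1))⁻¹ * hx j + hx (j - 1))

end SwapRateDifferential

/-! ### Bounded coefficients -/

section BoundedCoefficients

variable {Ω : Type*} {mΩ : MeasurableSpace Ω} {𝓕 : Filtration ℝ≥0 mΩ} {μ : Measure Ω}
  [IsFiniteMeasure μ] [ContainsNullSets 𝓕 μ]

local notation "𝕕" => differential 𝓕 μ
local notation "𝕔" => cls 𝓕 μ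
local notation "⟪" α ", " β "⟫" => bracket 𝓕 μ α β

/-- A bounded process with bounded logarithmic coefficients has bounded coefficients with respect
to the relative differentials `dRᵢ / Rᵢ` and the covariations of the `log Rᵢ`. -/
theorem IsLogRegular.exists_bounded_coefficients {ι : Type*} [DecidableEq ι] {s : Finset ι}
    {R : ι → ℝ≥0 → Ω → ℝ} {B : ι → ι → ℝ≥0 → Ω → ℝ} {G : ℝ≥0 → Ω → ℝ}
    (hR : ∀ i ∈ s, IsContSemimartingale 𝓕 μ (R i)) (hpos : ∀ i ∈ s, ∀ᵐ ω ∂μ, ∀ t, 0 < R i t ω)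
    (hB : ∀ i ∈ s, ∀ k ∈ s, IsFV 𝓕 μ (B i k) ∧ IsCovLimit μ (fun t ω => Real.log (R i t ω))
      (fun t ω => Real.log (R k t ω)) (B i k))
    (hG : IsLogRegular 𝓕 μ s (fun i t ω => Real.log (R i t ω)) G) (hb : IsBoundedProcess μ G) :
    ∃ (X U : ι → ℝ≥0 → Ω → ℝ) (Y K : ι → ι → ℝ≥0 → Ω → ℝ),
      (∀ i ∈ s, IsContAdapted 𝓕 μ (X i) ∧ IsBoundedProcess μ (X i) ∧
        IsItoIntegral 𝓕 μ (fun t ω => X i t ω / R i t ω) (R i) (U i)) ∧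
      (∀ i ∈ s, ∀ k ∈ s, IsContAdapted 𝓕 μ (Y i k) ∧ IsBoundedProcess μ (Y i k) ∧
        IsItoIntegral 𝓕 μ (Y i k) (B i k) (K i k)) ∧
      ∀ᵐ ω ∂μ, ∀ t, G t ω = G 0 ω + ∑ i ∈ s, U i t ω + ∑ i ∈ s, ∑ k ∈ s, K i k t ω := by
  obtain ⟨β, hβ, hd⟩ := hG.differential
  obtain ⟨X, Z, hX, hZ, he⟩ := exists_of_mem_boundedDifferentials
    (smul_mem_boundedDifferentials (cls_mem_boundedProcesses hG.semimartingale.1 hb) hβ)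
  rw [← hd] at he
  -- the second order term of `d log Rᵢ` is absorbed into the covariation coefficients
  let Y : ι → ι → ℝ≥0 → Ω → ℝ := fun i k => Z i k - if i = k then (fun _ _ => 1 / 2) * X i else 0
  have hhalf i : IsContAdapted 𝓕 μ ((fun _ _ => 1 / 2) * X i) := (IsContAdapted.const _).mul (hX i).1
  have hY i k : IsContAdapted 𝓕 μ (Y i k) := by
    refine (hZ i k).1.sub ?_
    split_ifs
    · exact hhalf i
    · exact IsContAdapted.const 0
  have hYb i k : IsBoundedProcess μ (Y i k) := by
    obtain ⟨C, hC⟩ := (hX i).2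
    obtain ⟨D, hD⟩ := (hZ i k).2
    refine ⟨D + C, ?_⟩
    filter_upwards [hC, hD] with ω h1 h2 t
    refine (abs_sub _ _).trans (add_le_add (h2 t) ?_)
    have := h1 t
    split_ifs
    · simp only [Pi.mul_apply, abs_mul]
      rw [abs_of_pos (by norm_num : (0 : ℝ) < 1 / 2)]
      linarith [abs_nonneg (X i t ω)]
    · simpa using (abs_nonneg _).trans this
  have hcY i k : 𝕔 (Y i k) = 𝕔 (Z i k) -
      if i = k then algebraMap ℝ (ProcessRing 𝓕 μ) (1 / 2) * 𝕔 (X i) else 0 := by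
    simp only [Y]
    split_ifs with h
    · rw [cls_sub (hZ i k).1 (hhalf i), cls_mul (.const _) (hX i).1, cls_const]
    · rw [sub_zero, sub_zero]
  have hXR : ∀ i ∈ s, IsContAdapted 𝓕 μ fun t ω => X i t ω / R i t ω := fun i hi =>
    (hX i).1.div (hR i hi).1 ((hpos i hi).mono fun ω h t => (h t).ne')
  choose! U hU hU' using fun i (hi : i ∈ s) => (hR i hi).exists_integral (hXR i hi)
  choose! K hK hK' using fun i (hi : i ∈ s) k (hk : k ∈ s) =>
    (IsContSemimartingale.of_isFV (hB i hi k hk).1).exists_integral (hY i k)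
  refine ⟨X, U, Y, K, fun i hi => ⟨(hX i).1, (hX i).2, hXR i hi, hR i hi, (hU i hi).1, hU' i hi⟩,
    fun i hi k hk => ⟨hY i k, hYb i k, hY i k, .of_isFV (hB i hi k hk).1, (hK i hi k hk).1,
      hK' i hi k hk⟩, ?_⟩
  have hbr : ∀ i ∈ s, ∀ k ∈ s, ⟪𝕕 (fun t ω => Real.log (R i t ω)),
      𝕕 (fun t ω => Real.log (R k t ω))⟫ = 𝕕 (B i k) := fun i hi k hk =>
    bracket_differential ((hR i hi).log_and_differential (hpos i hi)).1
      ((hR k hk).log_and_differential (hpos k hk)).1 (.of_isFV (hB i hi k hk).1) (hB i hi k hk).2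
  have h1 : ∀ i ∈ s, 𝕔 (X i) • 𝕕 (fun t ω => Real.log (R i t ω)) =
      𝕕 (U i) - (algebraMap ℝ (ProcessRing 𝓕 μ) (1 / 2) * 𝕔 (X i)) • 𝕕 (B i i) := by
    intro i hi
    have hinv := (hR i hi).inv (hpos i hi)
    have e : (fun t ω => X i t ω / R i t ω) = X i * (R i)⁻¹ := by
      funext t ω; exact div_eq_mul_inv _ _
    rw [← cls_smul_differential (hXR i hi) (hR i hi) (hU i hi) (hU' i hi), e,
      cls_mul (hX i).1 hinv.1, differential_eq_log (hR i hi) (hpos i hi), hbr i hi i hi, smul_smul,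
      mul_assoc, mul_comm (𝕔 (R i)⁻¹), cls_mul_cls_inv (hR i hi).1 (hpos i hi)]
    module
  have hUs := IsContSemimartingale.sum hU
  have hKs' : ∀ i ∈ s, IsContSemimartingale 𝓕 μ (∑ k ∈ s, K i k) := fun i hi =>
    IsContSemimartingale.sum (hK i hi)
  have hKs := IsContSemimartingale.sum hKs'
  have hfin : 𝕕 G = 𝕕 (∑ i ∈ s, U i + ∑ i ∈ s, ∑ k ∈ s, K i k) := by
    rw [he, differential_add hUs hKs, differential_sum hU, differential_sum hKs',
      Finset.sum_congr rfl h1, Finset.sum_sub_distrib, sub_add]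
    rw [sub_eq_add_neg, neg_sub, ← Finset.sum_sub_distrib]
    congr 1
    refine Finset.sum_congr rfl fun i hi => ?_
    rw [differential_sum (hK i hi)]
    have h2 : ∀ k ∈ s, 𝕕 (K i k) = 𝕔 (Z i k) • 𝕕 (B i k) - if i = k then
        (algebraMap ℝ (ProcessRing 𝓕 μ) (1 / 2) * 𝕔 (X i)) • 𝕕 (B i k) else 0 := by
      intro k hk
      rw [← cls_smul_differential (hY i k) (.of_isFV (hB i hi k hk).1) (hK i hi k hk)
        (hK' i hi k hk), hcY, sub_smul, ite_smul, zero_smul]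
    rw [Finset.sum_congr rfl h2, Finset.sum_sub_distrib, Finset.sum_ite_eq, if_pos hi]
    congr 1
    exact Finset.sum_congr rfl fun k hk => by rw [hbr i hi k hk]
  rw [differential_eq_iff hG.semimartingale (hUs.add hKs)] at hfin
  have hU0 : ∀ᵐ ω ∂μ, ∀ i ∈ s, U i 0 ω = 0 :=
    (eventually_all_finset s).2 fun i hi => (hU' i hi).null_zero
  have hK0 : ∀ᵐ ω ∂μ, ∀ i ∈ s, ∀ k ∈ s, K i k 0 ω = 0 :=
    (eventually_all_finset s).2 fun i hi => (eventually_all_finset s).2 fun k hk =>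
      (hK' i hi k hk).null_zero
  filter_upwards [hfin, hU0, hK0] with ω h hU0 hK0 t
  have := h t
  simp only [Pi.add_apply, Finset.sum_apply] at this
  rw [Finset.sum_eq_zero hU0, Finset.sum_eq_zero fun i hi => Finset.sum_eq_zero (hK0 i hi)] at this
  linarith

end BoundedCoefficients

/-! ### Algebra of the swap weights -/

section Algebra

variable {p θ : ℕ → ℝ} {I J j : ℕ}

/-- With nonnegative simple rates, bond prices decrease in the maturity. -/
lemma bond_antitone (hp : ∀ k, 0 < p k) (hθ : ∀ j ∈ Finset.Icc (I + 1) J, 0 < θ j)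
    (h : ∀ j ∈ Finset.Icc (I + 1) J, 0 ≤ 1 / θ j * (p (j - 1) / p j - 1)) {k l : ℕ} (hk : I ≤ k)
    (hkl : k ≤ l) (hl : l ≤ J) : p l ≤ p k := by
  have h' : ∀ j ∈ Finset.Icc (I + 1) J, p j ≤ p (j - 1) := fun j hj => (one_le_div (hp j)).1
    (sub_nonneg.1 (nonneg_of_mul_nonneg_right (h j hj) (one_div_pos.2 (hθ j hj))))
  induction l, hkl using Nat.le_induction with
  | base => exact le_rfl
  | succ l hkl ih =>
    exact (h' (l + 1) (Finset.mem_Icc.2 ⟨by omega, hl⟩)).trans (ih (by omega))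

/-- With nonnegative simple rates, the contribution of one rate to the swap rate is at most the swap
rate: the bracket is at most `p I`, and `p J ≤ p j ≤ p (j - 1) ≤ p I`. -/
lemma weight_mul_rate_le (hp : ∀ k, 0 < p k) (hθ : ∀ j ∈ Finset.Icc (I + 1) J, 0 < θ j)
    (h : ∀ j ∈ Finset.Icc (I + 1) J, 0 ≤ 1 / θ j * (p (j - 1) / p j - 1))
    (hj : j ∈ Finset.Icc (I + 1) J) :
    θ j * p j / ((∑ k ∈ Finset.Icc (I + 1) J, θ k * p k) * p (j - 1)) *
      (p J + (p I - p J) / (∑ k ∈ Finset.Icc (I + 1) J, θ k * p k) *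
        ∑ k ∈ Finset.Icc j J, θ k * p k) * (1 / θ j * (p (j - 1) / p j - 1)) ≤
      (p I - p J) / ∑ k ∈ Finset.Icc (I + 1) J, θ k * p k := by
  obtain ⟨h1, h2⟩ := Finset.mem_Icc.1 hj
  have hsub : Finset.Icc j J ⊆ Finset.Icc (I + 1) J := Finset.Icc_subset_Icc_left h1
  set A := ∑ k ∈ Finset.Icc (I + 1) J, θ k * p k with hA
  have hA0 : 0 < A := Finset.sum_pos (fun k hk => mul_pos (hθ k hk) (hp k)) ⟨j, hj⟩
  have haA : ∑ k ∈ Finset.Icc j J, θ k * p k ≤ A := Finset.sum_le_sum_of_subset_of_nonneg hsub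
    fun k hk _ => (mul_pos (hθ k hk) (hp k)).le
  set a := ∑ k ∈ Finset.Icc j J, θ k * p k
  have hIJ : p J ≤ p I := bond_antitone hp hθ h le_rfl (by omega) le_rfl
  have hIj : p (j - 1) ≤ p I := bond_antitone hp hθ h le_rfl (by omega) (by omega)
  have hjJ : p J ≤ p j := bond_antitone hp hθ h (by omega) h2 le_rfl
  have hjj : p j ≤ p (j - 1) := bond_antitone hp hθ h (by omega) (by omega) h2
  have hpj := hp j
  have hpj' := hp (j - 1)
  have hθj := hθ j hj
  have hu : p J + (p I - p J) / A * a ≤ p I := by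
    have : (p I - p J) / A * a ≤ (p I - p J) / A * A :=
      mul_le_mul_of_nonneg_left haA (div_nonneg (sub_nonneg.2 hIJ) hA0.le)
    rw [div_mul_cancel₀ _ hA0.ne'] at this
    linarith
  set u := p J + (p I - p J) / A * a
  have e : θ j * p j / (A * p (j - 1)) * u * (1 / θ j * (p (j - 1) / p j - 1)) =
      (p (j - 1) - p j) * u / p (j - 1) / A := by
    field_simp
  rw [e]
  refine div_le_div_of_nonneg_right ?_ hA0.le
  rw [div_le_iff₀ hpj']
  have h3 := mul_le_mul_of_nonneg_left hu (sub_nonneg.2 hjj)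
  have h4 := mul_le_mul hjJ hIj hpj'.le hpj.le
  linarith

/-- The forward price `P(T k) / P(T J)` in terms of the rates, without subtractions. -/
lemma prod_one_add_rate (hp : ∀ k, 0 < p k) (hθ : ∀ j ∈ Finset.Icc (I + 1) J, 0 < θ j) {k : ℕ}
    (hI : I ≤ k) (hk : k ≤ J) :
    ∏ m ∈ Finset.Icc (k + 1) J, (1 + θ m * (1 / θ m * (p (m - 1) / p m - 1))) = p k / p J := by
  induction hk using Nat.decreasingInduction with
  | self => simp [(hp J).ne']
  | of_succ m hm ih =>
    rw [← Finset.insert_Icc_add_one_left_eq_Icc hm, Finset.prod_insert (by simp), ih (by omega),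
      Nat.add_sub_cancel]
    have := hp m
    have := hp (m + 1)
    have := hp J
    have := hθ (m + 1) (Finset.mem_Icc.2 ⟨by omega, hm⟩)
    field_simp
    ring

/-- The floating leg of the swap telescopes. -/
lemma sum_rate_mul (hp : ∀ k, 0 < p k) (hθ : ∀ j ∈ Finset.Icc (I + 1) J, 0 < θ j) (hIJ : I ≤ J) :
    ∑ m ∈ Finset.Icc (I + 1) J, θ m * (1 / θ m * (p (m - 1) / p m - 1)) * (p m / p J) =
      (p I - p J) / p J := by
  have h : ∑ m ∈ Finset.Icc (I + 1) J, (p (m - 1) - p m) = p I - p J := by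
    induction J, hIJ using Nat.le_induction with
    | base => simp
    | succ J hIJ ih =>
      rw [Finset.sum_Icc_succ_top (by omega), ih fun j hj => hθ j (by
        rw [Finset.mem_Icc] at hj ⊢; omega), Nat.add_sub_cancel]
      ring
  rw [← h, Finset.sum_div]
  refine Finset.sum_congr rfl fun m hm => ?_
  have := hp m
  have := hp J
  have := hθ m hm
  field_simp

/-- The relative contribution of one rate to the swap rate is a subtraction-free expression in the
rates. -/
lemma weight_mul_rate_div (hp : ∀ k, 0 < p k) (hθ : ∀ j ∈ Finset.Icc (I + 1) J, 0 < θ j)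
    {R q : ℕ → ℝ} (hR : ∀ j ∈ Finset.Icc (I + 1) J, R j = 1 / θ j * (p (j - 1) / p j - 1))
    (hRpos : ∀ j ∈ Finset.Icc (I + 1) J, 0 < R j)
    (hq : ∀ k ∈ Finset.Icc (I + 1) J, q k = ∏ m ∈ Finset.Icc (k + 1) J, (1 + θ m * R m))
    (hj : j ∈ Finset.Icc (I + 1) J) :
    θ j * p j / ((∑ k ∈ Finset.Icc (I + 1) J, θ k * p k) * p (j - 1)) *
      (p J + (p I - p J) / (∑ k ∈ Finset.Icc (I + 1) J, θ k * p k) *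
        ∑ k ∈ Finset.Icc j J, θ k * p k) * R j /
      ((p I - p J) / ∑ k ∈ Finset.Icc (I + 1) J, θ k * p k) =
    θ j * R j * (1 + θ j * R j)⁻¹ * ((∑ k ∈ Finset.Icc (I + 1) J, θ k * R k * q k)⁻¹ +
      (∑ k ∈ Finset.Icc (I + 1) J, θ k * q k)⁻¹ * ∑ k ∈ Finset.Icc j J, θ k * q k) := by
  obtain ⟨h1, h2⟩ := Finset.mem_Icc.1 hj
  have hsub : Finset.Icc j J ⊆ Finset.Icc (I + 1) J := Finset.Icc_subset_Icc_left h1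
  have hq' : ∀ k ∈ Finset.Icc (I + 1) J, q k = p k / p J := fun k hk => by
    obtain ⟨h3, h4⟩ := Finset.mem_Icc.1 hk
    rw [hq k hk, ← prod_one_add_rate hp hθ (by omega) h4]
    refine Finset.prod_congr rfl fun m hm => ?_
    rw [hR m (Finset.Icc_subset_Icc_left (by omega) hm)]
  have hpJ := hp J
  have hpj := hp j
  have hpj' := hp (j - 1)
  have hθj := hθ j hj
  have hsum : ∀ u ⊆ Finset.Icc (I + 1) J, ∑ k ∈ u, θ k * q k = (∑ k ∈ u, θ k * p k) / p J := by
    intro u hu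
    rw [Finset.sum_div]
    exact Finset.sum_congr rfl fun k hk => by rw [hq' k (hu hk), mul_div_assoc]
  have hb : ∑ k ∈ Finset.Icc (I + 1) J, θ k * R k * q k = (p I - p J) / p J := by
    rw [← sum_rate_mul hp hθ (by omega)]
    exact Finset.sum_congr rfl fun k hk => by rw [hq' k hk, hR k hk]
  have hb0 : 0 < (p I - p J) / p J := by
    rw [← hb]
    refine Finset.sum_pos (fun k hk => ?_) ⟨j, hj⟩
    rw [hq' k hk]
    exact mul_pos (mul_pos (hθ k hk) (hRpos k hk)) (div_pos (hp k) hpJ)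
  have hA0 : 0 < ∑ k ∈ Finset.Icc (I + 1) J, θ k * p k :=
    Finset.sum_pos (fun k hk => mul_pos (hθ k hk) (hp k)) ⟨j, hj⟩
  rw [hb, hsum _ hsub, hsum _ le_rfl]
  have hRj : p (j - 1) = p j * (1 + θ j * R j) := by
    rw [hR j hj]
    field_simp
    ring
  have hne : p I - p J ≠ 0 := fun h => by simp [h] at hb0
  have h1R : 0 < 1 + θ j * R j := by
    have := mul_pos hθj (hRpos j hj)
    linarith
  rw [hRj]
  generalize ∑ k ∈ Finset.Icc (I + 1) J, θ k * p k = A at *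
  generalize ∑ k ∈ Finset.Icc j J, θ k * p k = a at *
  field_simp

end Algebra

/-! ### Swap rates in the bond market -/

namespace IsMarket

variable {Ω : Type*} [mΩ : MeasurableSpace Ω] {Pr Q : Measure Ω} {𝓕 : Filtration ℝ≥0 mΩ}
  {r : ℝ≥0 → Ω → ℝ} {P : ℝ≥0 → ℝ≥0 → Ω → ℝ} {T : ℕ → ℝ≥0} {N I J : ℕ}

lemma termRate_contAdapted (hm : IsMarket Pr Q 𝓕 r P) (j : ℕ) :
    IsContAdapted 𝓕 Pr (termRate P T j) :=
  (IsContAdapted.const (1 / accrual T j)).mul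
    (((hm.bond_contAdapted (T (j - 1))).div (hm.bond_contAdapted (T j))
      ((hm.bond_pos (T j)).mono fun _ h t => (h t).ne')).sub (IsContAdapted.const 1))

lemma swapRate_contAdapted (hm : IsMarket Pr Q 𝓕 r P) (hT : StrictMonoOn T (Set.Iic N))
    (hIJ : I < J) (hJN : J ≤ N) : IsContAdapted 𝓕 Pr (swapRate P T I J) :=
  ((hm.bond_contAdapted (T I)).sub (hm.bond_contAdapted (T J))).div hm.annuity_contAdapted
    ((hm.annuity_pos hT hIJ hJN).mono fun _ h t => (h t).ne')

lemma swapWeight_contAdapted (hm : IsMarket Pr Q 𝓕 r P) (hT : StrictMonoOn T (Set.Iic N))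
    (hIJ : I < J) (hJN : J ≤ N) (j : ℕ) : IsContAdapted 𝓕 Pr (swapWeight P T I J j) := by
  have hden : ∀ᵐ ω ∂Pr, ∀ t, annuity P T I J t ω * P t (T (j - 1)) ω ≠ 0 := by
    filter_upwards [hm.annuity_pos hT hIJ hJN, hm.bond_pos (T (j - 1))] with ω h1 h2 t using
      (mul_pos (h1 t) (h2 t)).ne'
  have hsum : IsContAdapted 𝓕 Pr fun t ω => ∑ k ∈ Finset.Icc j J, accrual T k * P t (T k) ω := by
    have e : (fun t ω => ∑ k ∈ Finset.Icc j J, accrual T k * P t (T k) ω) =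
        ∑ k ∈ Finset.Icc j J, accrual T k • fun t => P t (T k) := by
      funext t ω; simp
    rw [e]
    exact IsContAdapted.sum fun k _ => (hm.bond_contAdapted _).smul _
  exact (((IsContAdapted.const (accrual T j)).mul (hm.bond_contAdapted (T j))).div
    (hm.annuity_contAdapted.mul (hm.bond_contAdapted _)) hden).mul
      ((hm.bond_contAdapted (T J)).add ((hm.swapRate_contAdapted hT hIJ hJN).mul hsum))

lemma accrual_pos_of_mem (hT : StrictMonoOn T (Set.Iic N)) (hJN : J ≤ N) :
    ∀ j ∈ Finset.Icc (I + 1) J, 0 < accrual T j := fun j hj =>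
  accrual_pos hT (by have := (Finset.mem_Icc.1 hj).1; omega) ((Finset.mem_Icc.1 hj).2.trans hJN)

lemma swapRate_nonneg (hm : IsMarket Pr Q 𝓕 r P) (hT : StrictMonoOn T (Set.Iic N)) (hIJ : I < J)
    (hJN : J ≤ N) (h : ∀ j ∈ Finset.Icc (I + 1) J, ∀ᵐ ω ∂Pr, ∀ t, 0 ≤ termRate P T j t ω) :
    ∀ᵐ ω ∂Pr, ∀ t, 0 ≤ swapRate P T I J t ω := by
  filter_upwards [hm.bond_pos_all T, (eventually_all_finset _).2 h] with ω hp h t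
  refine div_nonneg (sub_nonneg.2 ?_) (annuity_pos_of_bond_pos hT hIJ hJN fun k => hp k t).le
  exact bond_antitone (p := fun k => P t (T k) ω) (fun k => hp k t) (accrual_pos_of_mem hT hJN)
    (fun k hk => h k hk t) le_rfl hIJ.le le_rfl

/-- If all simple rates are nonnegative, none of them contributes more than the swap rate. -/
lemma swapWeight_mul_termRate_le (hm : IsMarket Pr Q 𝓕 r P) (hT : StrictMonoOn T (Set.Iic N))
    (hJN : J ≤ N) (h : ∀ j ∈ Finset.Icc (I + 1) J, ∀ᵐ ω ∂Pr, ∀ t, 0 ≤ termRate P T j t ω) :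
    ∀ j ∈ Finset.Icc (I + 1) J, ∀ᵐ ω ∂Pr, ∀ t,
      swapWeight P T I J j t ω * termRate P T j t ω ≤ swapRate P T I J t ω := by
  intro j hj
  filter_upwards [hm.bond_pos_all T, (eventually_all_finset _).2 h] with ω hp h t
  exact weight_mul_rate_le (fun k => hp k t) (accrual_pos_of_mem hT hJN) (fun k hk => h k hk t) hj

section SwapMeasure

variable {μ : Measure Ω} [IsFiniteMeasure μ] [ContainsNullSets 𝓕 μ]

/-- The dynamics of the swap rate in terms of differentials, under a measure for which the discounted
bond prices `P(u) / A` are martingales. -/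
lemma differential_termRate_swapRate (hm : IsMarket Pr Q 𝓕 r P) (hT : StrictMonoOn T (Set.Iic N))
    (hIJ : I < J) (hJN : J ≤ N) (hμ : μ ≪ Pr)
    (hM : ∀ u, Martingale (fun t ω => P t u ω / annuity P T I J t ω) 𝓕 μ) :
    (∀ j ∈ Finset.Icc (I + 1) J, IsContSemimartingale 𝓕 μ (termRate P T j)) ∧
    IsContSemimartingale 𝓕 μ (swapRate P T I J) ∧
    ∀ Rstar : ℕ → ℝ≥0 → Ω → ℝ,
      (∀ j ∈ Finset.Icc (I + 1) J, IsLocalMartingalePart 𝓕 μ (termRate P T j) (Rstar j)) →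
      (∀ j ∈ Finset.Icc (I + 1) J, IsContSemimartingale 𝓕 μ (Rstar j)) ∧
      differential 𝓕 μ (swapRate P T I J) = ∑ j ∈ Finset.Icc (I + 1) J,
        cls 𝓕 μ (swapWeight P T I J j) • differential 𝓕 μ (Rstar j) := by
  have hA := hm.annuity_pos hT hIJ hJN
  have hP := hm.bond_pos_all T
  have hθ := accrual_pos_of_mem (I := I) hT hJN
  let n : ℕ → ℝ≥0 → Ω → ℝ := fun k t ω => P t (T k) ω / annuity P T I J t ω
  have hnc k : IsContAdapted 𝓕 μ (n k) := ((hm.bond_contAdapted (T k)).div hm.annuity_contAdapted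
    (hA.mono fun ω h t => (h t).ne')).mono_ac hμ
  have hn k := differential_mem_of_martingale (hM (T k)) (hnc k)
  have hnpos k : ∀ᵐ ω ∂μ, ∀ t, 0 < n k t ω := by
    filter_upwards [hμ hA, hμ hP] with ω h1 h2 t using div_pos (h2 k t) (h1 t)
  have hSc := (hm.swapRate_contAdapted hT hIJ hJN).mono_ac hμ
  have hSn : Indist μ (swapRate P T I J) (n I - n J) :=
    ae_of_all _ fun ω t => sub_div _ _ _
  have hS : IsContSemimartingale 𝓕 μ (swapRate P T I J) :=
    ((hn I).1.sub (hn J).1).congr hSc.adapted hSn.symm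
  have hRn j : Indist μ (termRate P T j)
      ((fun _ _ => 1 / accrual T j) * (n (j - 1) * (n j)⁻¹ - fun _ _ => 1)) := by
    filter_upwards [hμ hA, hμ hP] with ω h1 h2 t
    have := (h1 t).ne'
    have := (h2 j t).ne'
    simp only [termRate, Pi.mul_apply, Pi.sub_apply, Pi.inv_apply, n]
    field_simp
  have hRa j : StronglyAdapted 𝓕 (termRate P T j) := (hm.termRate_contAdapted j).adapted
  have hR j := differential_simpleRate (hn (j - 1)).1 (hn j).1 (hn _).2 (hn _).2 (hnpos j) _
    (hRa j) (hRn j)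
  refine ⟨fun j _ => (hR j).1, hS, fun Rstar hL => ⟨fun j hj => ((hR j).2 _ (hL j hj)).1, ?_⟩⟩
  refine differential_swapRate hIJ.le (fun k => (hn k).1) (fun k => (hn k).2) hnpos
    (fun j hj => (hθ j hj).ne') ?_ hS hSn (fun j _ => hRa j) (fun j _ => hRn j)
    (fun j _ => (hm.swapWeight_contAdapted hT hIJ hJN j).mono_ac hμ) (fun j hj => ?_) hL
  · filter_upwards [hμ hA] with ω h1 t
    have e : ∀ k, accrual T k * (P t (T k) ω / annuity P T I J t ω) =
        accrual T k * P t (T k) ω / annuity P T I J t ω := fun k => (mul_div_assoc _ _ _).symm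
    simp only [Finset.sum_apply, Pi.mul_apply, e, ← Finset.sum_div, Pi.one_apply]
    exact div_self (h1 t).ne'
  · filter_upwards [hμ hA, hμ hP] with ω h1 h2 t
    have e : ∀ k, accrual T k * (P t (T k) ω / annuity P T I J t ω) =
        accrual T k * P t (T k) ω / annuity P T I J t ω := fun k => (mul_div_assoc _ _ _).symm
    have := (h1 t).ne'
    have := (h2 (j - 1) t).ne'
    simp only [swapWeight, Finset.sum_apply, Pi.mul_apply, Pi.add_apply, Pi.inv_apply, e,
      ← Finset.sum_div]
    field_simp

/-- The swap rate is the sum of the integrals of the swap weights against the local martingale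
parts of the simple rates. -/
theorem swapRate_eq_sum_integral (hm : IsMarket Pr Q 𝓕 r P) (hT : StrictMonoOn T (Set.Iic N))
    (hIJ : I < J) (hJN : J ≤ N) (hμ : μ ≪ Pr)
    (hM : ∀ u, Martingale (fun t ω => P t u ω / annuity P T I J t ω) 𝓕 μ)
    {Rstar : ℕ → ℝ≥0 → Ω → ℝ}
    (hL : ∀ j ∈ Finset.Icc (I + 1) J, IsLocalMartingalePart 𝓕 μ (termRate P T j) (Rstar j)) :
    ∃ V : ℕ → ℝ≥0 → Ω → ℝ,
      (∀ j ∈ Finset.Icc (I + 1) J,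
        IsItoIntegral 𝓕 μ (swapWeight P T I J j) (Rstar j) (V j)) ∧
      ∀ᵐ ω ∂μ, ∀ t, swapRate P T I J t ω =
        swapRate P T I J 0 ω + ∑ j ∈ Finset.Icc (I + 1) J, V j t ω := by
  obtain ⟨_, hS, h⟩ := hm.differential_termRate_swapRate hT hIJ hJN hμ hM
  obtain ⟨hLs, hd⟩ := h Rstar hL
  have hW j := (hm.swapWeight_contAdapted hT hIJ hJN j).mono_ac hμ
  choose! V hV hV' using fun j (hj : j ∈ Finset.Icc (I + 1) J) =>
    (hLs j hj).exists_integral (hW j)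
  refine ⟨V, fun j hj => ⟨hW j, hLs j hj, (hV j hj).1, hV' j hj⟩, ?_⟩
  rw [Finset.sum_congr rfl fun j hj =>
    cls_smul_differential (hW j) (hLs j hj) (hV j hj) (hV' j hj), ← differential_sum hV,
    differential_eq_iff hS (IsContSemimartingale.sum hV)] at hd
  filter_upwards [hd, (eventually_all_finset _).2 fun j hj => (hV' j hj).null_zero] with ω h h0 t
  have := h t
  simp only [Finset.sum_apply] at this
  rw [Finset.sum_eq_zero h0] at this
  linarith

/-- The relative contributions of the rates to the swap rate have bounded coefficients. -/
lemma isLogRegular_swapWeight (hm : IsMarket Pr Q 𝓕 r P) (hT : StrictMonoOn T (Set.Iic N))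
    (hIJ : I < J) (hJN : J ≤ N) (hμ : μ ≪ Pr)
    (hR : ∀ j ∈ Finset.Icc (I + 1) J, IsContSemimartingale 𝓕 μ (termRate P T j))
    (hRpos : ∀ j ∈ Finset.Icc (I + 1) J, ∀ᵐ ω ∂μ, ∀ t, 0 < termRate P T j t ω) {j : ℕ}
    (hj : j ∈ Finset.Icc (I + 1) J) :
    IsLogRegular 𝓕 μ (Finset.Icc (I + 1) J) (fun i t ω => Real.log (termRate P T i t ω))
      fun t ω => swapWeight P T I J j t ω * termRate P T j t ω / swapRate P T I J t ω := by
  have hθ := accrual_pos_of_mem (I := I) hT hJN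
  have hc : ∀ k ∈ Finset.Icc (I + 1) J, IsLogRegular 𝓕 μ (Finset.Icc (I + 1) J)
      (fun i t ω => Real.log (termRate P T i t ω)) fun _ _ => accrual T k := fun k hk =>
    IsLogRegular.const (hθ k hk)
  have hθR : ∀ k ∈ Finset.Icc (I + 1) J, IsLogRegular 𝓕 μ (Finset.Icc (I + 1) J)
      (fun i t ω => Real.log (termRate P T i t ω)) ((fun _ _ => accrual T k) * termRate P T k) :=
    fun k hk => (hc k hk).mul (isLogRegular_of_log hk (hR k hk) (hRpos k hk))
  have h1 : ∀ k ∈ Finset.Icc (I + 1) J, IsLogRegular 𝓕 μ (Finset.Icc (I + 1) J)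
      (fun i t ω => Real.log (termRate P T i t ω))
        ((fun _ _ => 1) + (fun _ _ => accrual T k) * termRate P T k) :=
    fun k hk => (IsLogRegular.const one_pos).add (hθR k hk)
  let q : ℕ → ℝ≥0 → Ω → ℝ := fun k =>
    ∏ m ∈ Finset.Icc (k + 1) J, ((fun _ _ => 1) + (fun _ _ => accrual T m) * termRate P T m)
  have hq : ∀ k ∈ Finset.Icc (I + 1) J, IsLogRegular 𝓕 μ (Finset.Icc (I + 1) J)
      (fun i t ω => Real.log (termRate P T i t ω)) (q k) := fun k hk =>
    IsLogRegular.prod fun m hm => h1 m (Finset.Icc_subset_Icc_left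
      ((Finset.mem_Icc.1 hk).1.trans k.le_succ) hm)
  have hθq : ∀ k ∈ Finset.Icc (I + 1) J, IsLogRegular 𝓕 μ (Finset.Icc (I + 1) J)
      (fun i t ω => Real.log (termRate P T i t ω)) ((fun _ _ => accrual T k) * q k) := fun k hk =>
    (hc k hk).mul (hq k hk)
  have hsub : Finset.Icc j J ⊆ Finset.Icc (I + 1) J :=
    Finset.Icc_subset_Icc_left (Finset.mem_Icc.1 hj).1
  have hG := ((hθR j hj).mul (h1 j hj).inv).mul
    ((IsLogRegular.sum ⟨j, hj⟩ fun k hk => (hθR k hk).mul (hq k hk)).inv.add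
      ((IsLogRegular.sum ⟨j, hj⟩ hθq).inv.mul (IsLogRegular.sum (u := Finset.Icc j J)
        ⟨j, Finset.mem_Icc.2 ⟨le_rfl, (Finset.mem_Icc.1 hj).2⟩⟩ fun k hk => hθq k (hsub hk))))
  refine hG.congr ?_ ?_
  · refine fun t => StronglyMeasurable.div ?_ ((hm.swapRate_contAdapted hT hIJ hJN).adapted t)
    exact ((hm.swapWeight_contAdapted hT hIJ hJN j).adapted t).mul
      ((hm.termRate_contAdapted j).adapted t)
  · filter_upwards [hμ (hm.bond_pos_all T), (eventually_all_finset _).2 hRpos] with ω hp hr t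
    have := weight_mul_rate_div (fun k => hp k t) hθ (R := fun k => termRate P T k t ω)
      (q := fun k => q k t ω) (fun k _ => rfl) (fun k hk => hr k hk t)
      (fun k _ => by simp [q, Finset.prod_apply]) hj
    simp only [Pi.mul_apply, Pi.add_apply, Pi.inv_apply, Finset.sum_apply]
    exact this.symm

end SwapMeasure

end IsMarket

end SwapRate

end

open SwapRate in
theorem lemma1 {Ω : Type*} [mΩ : MeasurableSpace Ω] (Pr Q : Measure Ω) (𝓕 : Filtration ℝ≥0 mΩ)
    (r : ℝ≥0 → Ω → ℝ) (P : ℝ≥0 → ℝ≥0 → Ω → ℝ) (hmarket : IsMarket Pr Q 𝓕 r P)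
    (N : ℕ) (T : ℕ → ℝ≥0) (hT0 : T 0 = 0) (hT : StrictMonoOn T (Set.Iic N))
    (I J : ℕ) (hI : 1 ≤ I) (hIJ : I < J) (hJN : J ≤ N)
    (R : ℕ → ℝ≥0 → Ω → ℝ) (hR : R = termRate P T)
    (S : ℝ≥0 → Ω → ℝ) (hS : S = swapRate P T I J)
    (W : ℕ → ℝ≥0 → Ω → ℝ) (hW : W = swapWeight P T I J)
    (Qs : Measure Ω) (hQs : Qs = swapMeasure Q r P T N I J) :
    -- each `R^j` has a local martingale part under the forward swap measure
    (∀ j ∈ Finset.Icc (I + 1) J, ∃ L, IsLocalMartingalePart 𝓕 Qs (R j) L) ∧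
    -- `dS = ∑_j Π^j dR^{j*}`
    (∀ Rstar : ℕ → ℝ≥0 → Ω → ℝ,
      (∀ j ∈ Finset.Icc (I + 1) J, IsLocalMartingalePart 𝓕 Qs (R j) (Rstar j)) →
      ∃ V : ℕ → ℝ≥0 → Ω → ℝ,
        (∀ j ∈ Finset.Icc (I + 1) J, IsItoIntegral 𝓕 Qs (W j) (Rstar j) (V j)) ∧
        ∀ᵐ ω ∂Pr, ∀ t, S t ω = S 0 ω + ∑ j ∈ Finset.Icc (I + 1) J, V j t ω) ∧
    -- if all `R^j ≥ 0`, then `Π^j R^j ≤ S`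
    ((∀ j ∈ Finset.Icc (I + 1) J, ∀ᵐ ω ∂Pr, ∀ t, 0 ≤ R j t ω) →
      ∀ j ∈ Finset.Icc (I + 1) J, ∀ᵐ ω ∂Pr, ∀ t, W j t ω * R j t ω ≤ S t ω) ∧
    -- if all `R^j > 0`, then `d(Π^j R^j / S)` is
    -- `∑_i X^{ji} dR^i / R^i + ∑_{i,k} Y^{jik} d⟨log R^i, log R^k⟩` with bounded `X`, `Y`
    ((∀ j ∈ Finset.Icc (I + 1) J, ∀ᵐ ω ∂Pr, ∀ t, 0 < R j t ω) →
      ∃ B : ℕ → ℕ → ℝ≥0 → Ω → ℝ,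
        (∀ i ∈ Finset.Icc (I + 1) J, ∀ k ∈ Finset.Icc (I + 1) J,
          IsCovariation 𝓕 Qs (fun t ω => Real.log (R i t ω)) (fun t ω => Real.log (R k t ω))
            (B i k)) ∧
        ∀ j ∈ Finset.Icc (I + 1) J,
          ∃ (X U : ℕ → ℝ≥0 → Ω → ℝ) (Y K : ℕ → ℕ → ℝ≥0 → Ω → ℝ),
            (∀ i ∈ Finset.Icc (I + 1) J,
              IsContAdapted 𝓕 Qs (X i) ∧ IsBoundedProcess Qs (X i) ∧
              IsItoIntegral 𝓕 Qs (fun t ω => X i t ω / R i t ω) (R i) (U i)) ∧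
            (∀ i ∈ Finset.Icc (I + 1) J, ∀ k ∈ Finset.Icc (I + 1) J,
              IsContAdapted 𝓕 Qs (Y i k) ∧ IsBoundedProcess Qs (Y i k) ∧
              IsItoIntegral 𝓕 Qs (Y i k) (B i k) (K i k)) ∧
            ∀ᵐ ω ∂Pr, ∀ t, W j t ω * R j t ω / S t ω = W j 0 ω * R j 0 ω / S 0 ω +
              ∑ i ∈ Finset.Icc (I + 1) J, U i t ω +
              ∑ i ∈ Finset.Icc (I + 1) J, ∑ k ∈ Finset.Icc (I + 1) J, K i k t ω) := by
  subst hR hS hW hQs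
  obtain ⟨hfin, hac, hac', hM⟩ := hmarket.swapMeasure_martingale hT hIJ hJN
  have := hmarket.containsNullSets hac'
  obtain ⟨hR, -, -⟩ := hmarket.differential_termRate_swapRate hT hIJ hJN hac hM
  refine ⟨fun j hj => (hR j hj).2, fun Rstar hL => ?_,
    hmarket.swapWeight_mul_termRate_le hT hJN, fun hRpos => ?_⟩
  · obtain ⟨V, hV, h⟩ := hmarket.swapRate_eq_sum_integral hT hIJ hJN hac hM hL
    exact ⟨V, hV, hac' h⟩
  · have hRpos' := fun j hj => hac (hRpos j hj)
    have hlog := fun i hi => ((hR i hi).log_and_differential (hRpos' i hi)).1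
    choose! B hB hB' using fun i (hi : i ∈ Finset.Icc (I + 1) J) k
      (hk : k ∈ Finset.Icc (I + 1) J) => exists_isCovLimit (hlog i hi) (hlog k hk)
    refine ⟨B, fun i hi k hk => ⟨hlog i hi, hlog k hk, (hB i hi k hk).toIsContAdapted,
      hB' i hi k hk⟩, fun j hj => ?_⟩
    have hG := hmarket.isLogRegular_swapWeight hT hIJ hJN hac hR hRpos' hj
    have hb : IsBoundedProcess (swapMeasure Q r P T N I J) fun t ω =>
        swapWeight P T I J j t ω * termRate P T j t ω / swapRate P T I J t ω := by
      have hnn := fun k hk => (hRpos k hk).mono fun ω h t => (h t).le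
      refine ⟨1, ?_⟩
      filter_upwards [hG.pos, hac (hmarket.swapWeight_mul_termRate_le hT hJN hnn j hj),
        hac (hmarket.swapRate_nonneg hT hIJ hJN hnn)] with ω h1 h2 h3 t
      rw [abs_of_pos (h1 t)]
      exact div_le_one_of_le₀ (h2 t) (h3 t)
    obtain ⟨X, U, Y, K, hX, hY, h⟩ := hG.exists_bounded_coefficients hR hRpos'
      (fun i hi k hk => ⟨hB i hi k hk, hB' i hi k hk⟩) hb
    exact ⟨X, U, Y, K, hX, hY, hac' h⟩
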